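/- **Setting.** Indices of vectors in $\mathbb{C}^d$ are read modulo $d$, $[n]_0=\{0,\dots,n-1\}$, $F_d$ is the unnormalized discrete Fourier transform $\widehat x_k=(F_d\mathbf x)_k=\sum_{n=0}^{d-1}x_n e^{-2\pi i nk/d}$, $(S_p\mathbf y)_n=y_{n+p}$, $\circ$ is the entrywise product, $\mathrm{sgn}(z)=z/|z|$ for $z\ne0$ and $\mathrm{sgn}(0)=1$. Let $\rho<d/2$, $2\le\kappa\le\rho$ be integers such that $L=\rho+\kappa-1$ divides $d$. Let $\mathbf x,\mathbf m\in\mathbb{C}^d$ be such that $\mathrm{supp}(\widehat{\mathbf m})\subseteq[\rho]_0$, $\min|\widehat{\mathbf x}|=\min_n|\widehat x_n|>0$ and $$\mu_1=\min_{|p|\le\kappa-1,\ q\in[d]_0}\bigl|F_d(\widehat{\mathbf m}\circ S_p\overline{\widehat{\mathbf m}})_q\bigr|>0 .$$ For a real noise matrix $N=N_{d,L}\in\mathbb{R}^{d\times L}$ let $Y=Y_{d,L}\in\mathbb R^{d\times L}$ be the matrix of measurements $$Y_{k,\ell}=\Bigl|\sum_{n=0}^{d-1}x_n\,m_{n-\ell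 d/L}\,e^{-2\pi i nk/d}\Bigr|^2+N_{k,\ell},\qquad k\in[d]_0,\ \ell\in[L]_0 .$$ **Algorithm 1** takes $Y$ and $\mathbf m$ (and $\rho$; $\kappa=L-\rho+1$). (1)–(2) For $|\alpha|\le\kappa-1$ put $\mathbf b_\alpha=\frac{d^2}{L}F_d^{-1}\Bigl(\frac{(F_dYF_L^T)_{-\alpha \bmod L}}{F_d(\widehat{\mathbf m}\circ S_{-\alpha}\overline{\widehat{\mathbf m}})}\Bigr)$, where $(\cdot)_\beta$ is the $\beta$-th column and the quotient is entrywise. (3)–(4) Let $B$ be the $d\times d$ matrix with $B_{j,k}=(\mathbf b_\alpha)_j$ if $k-j\equiv\alpha \pmod d$ with $|\alpha|<\kappa$, and $B_{j,k}=0$ otherwise, and let $G=\frac12(B+B^*)$. (5)–(6) Let $\widetilde Y_{j,k}=\mathrm{sgn}(G_{j,k})$ inside this band, and $0$ outside. (7) Let $\mathbf v$ be a normalized eigenvector for the largest eigenvalue of the Hermitian matrix $\widetilde Y$. The output is $\mathbf x_e=F_d^{-1}\widehat{\mathbf x}_e$ with $(\widehat{\mathbf x}_e)_j=\sqrt{\max(G_{j,j},0)}\;\mathrm{sgn}(v_j)$.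 **Theorem.** There are absolute constants $C,C'>0$ such that, for all data as above and every $N$, Algorithm 1 has an output, and each of its outputs $\mathbf x_e$ (for any choice of the leading eigenvector) satisfies $$\min_{\phi\in[0,2\pi]}\|\mathbf x-e^{i\phi}\mathbf x_e\|_2\le C\,\frac{d^{7/2}\,\|\widehat{\mathbf x}\|_\infty\,\|N\|_F}{L^{1/2}\,\mu_1\,\kappa^{5/2}\,\min|\widehat{\mathbf x}|^2}+C'\,\frac{d^{3/2}}{L^{1/4}}\sqrt{\frac{\|N\|_F}{\mu_1}} .\qquad(*)$$ Furthermore, for small noise Algorithm 1 can be carried out to any fixed relative precision $\varepsilon\in(0,1)$ in $O_\varepsilon\bigl(d(\rho+\kappa^2)\log d\bigr)$ flops. Precisely: there are constants $A(\varepsilon)$, depending only on $\varepsilon$, and for all $d,\rho,\kappa$ as above and all $\varepsilon$ a straight-line program depending only on $d,\rho,\kappa,\varepsilon$, which receives the entries of $Y$ and $\mathbf m$, consists of at most $A(\varepsilon)\,d(\rho+\kappa^2)\log d$ operations (reading an input, loading a constant, complex $+,-,\times,\div$, conjugation, real square root), and has the following property. For all $\mathbf x,\mathbf m$ as above there is $\eta>0$,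 not depending on $\varepsilon$, such that whenever $\|N\|_F\le\eta$ and $\varepsilon\in(0,1)$, the program returns a vector $\mathbf x'$ with $\|\mathbf x'-\mathbf x_e\|_2\le\varepsilon\|\mathbf x\|_2$ for some output $\mathbf x_e$ of Algorithm 1, and $\min_{\phi\in[0,2\pi]}\|\mathbf x-e^{i\phi}\mathbf x'\|_2$ is at most the right-hand side of $(*)$ plus $\varepsilon\|\mathbf x\|_2$. -/

import Mathlib

/-! ## Signals, masks and measurements

A signal `x ∈ ℂ^d` is a function `ZMod d → ℂ`, so that all indices are read modulo `d`.
The (unnormalised) discrete Fourier transform `F_d` is `ZMod.dft`, and `F_d⁻¹` is its inverse.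
-/

namespace Spectrogram

open Matrix

noncomputable section

/-- The Euclidean norm on `ℂ^d`. -/
def l2norm {d : ℕ} [NeZero d] (x : ZMod d → ℂ) : ℝ := ‖WithLp.toLp 2 x‖

/-- The Frobenius norm of a real matrix. -/
def frobNorm {d L : ℕ} [NeZero d] [NeZero L] (N : Matrix (ZMod d) (ZMod L) ℝ) : ℝ :=
  Real.sqrt (∑ k, ∑ l, N k l ^ 2)

/-- `‖y‖_∞`, the largest modulus of an entry. -/
def maxAbs {d : ℕ} (y : ZMod d → ℂ) : ℝ := ⨆ n, ‖y n‖

/-- `min |y|`, the smallest modulus of an entry. -/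
def minAbs {d : ℕ} (y : ZMod d → ℂ) : ℝ := ⨅ n, ‖y n‖

/-- The vector `y ∘ S_p ȳ`, with entries `y_n * conj y_{n+p}`. -/
def autocorr {d : ℕ} (y : ZMod d → ℂ) (p : ℤ) : ZMod d → ℂ :=
  fun n => y n * (starRingEnd ℂ) (y (n + (p : ZMod d)))

/-- The support of `y` is contained in `[ρ]_0 = {0, …, ρ - 1}`. -/
def SupportedIn {d : ℕ} (y : ZMod d → ℂ) (ρ : ℕ) : Prop := ∀ n, y n ≠ 0 → n.val < ρ

/-- The mask constant
`μ₁ = min_{|p| ≤ κ - 1, q ∈ [d]_0} |F_d (m̂ ∘ S_p conj m̂)_q|`. -/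
def maskConst {d : ℕ} [NeZero d] (κ : ℕ) (m : ZMod d → ℂ) : ℝ :=
  ⨅ pq : Set.Icc (1 - (κ : ℤ)) ((κ : ℤ) - 1) × ZMod d,
    ‖ZMod.dft (autocorr (ZMod.dft m) pq.1) pq.2‖

/-- The noisy measurement matrix `Y_{d,L}`: its `(k, ℓ)` entry is
`|∑_n x_n m_{n - ℓ d / L} exp (-2π i n k / d)|² + N_{k,ℓ}`. -/
def measurements {d L : ℕ} [NeZero d] (m x : ZMod d → ℂ) (N : Matrix (ZMod d) (ZMod L) ℝ) :
    Matrix (ZMod d) (ZMod L) ℝ :=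
  fun k l => ‖ZMod.dft (fun n => x n * m (n - ((l.val * (d / L) : ℕ) : ZMod d))) k‖ ^ 2 + N k l

/-! ## The algorithm -/

/-- The matrix `F_d Y F_L^T`. -/
def doubleDFT {d L : ℕ} [NeZero d] [NeZero L] (Y : Matrix (ZMod d) (ZMod L) ℝ) :
    Matrix (ZMod d) (ZMod L) ℂ :=
  fun w b => ZMod.dft (fun k => ZMod.dft (fun l => (Y k l : ℂ)) b) w

/-- Step 1: the estimate of `F_d (x̂ ∘ S_a conj x̂)`. The column index `-a` is read modulo `L`,
so it is `-a` for `a ≤ 0` and `L - a` for `a ≥ 1`. -/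
def bandFourier {d L : ℕ} [NeZero d] [NeZero L] (m : ZMod d → ℂ)
    (Y : Matrix (ZMod d) (ZMod L) ℝ) (a : ℤ) : ZMod d → ℂ :=
  fun w => (d : ℂ) ^ 2 * doubleDFT Y w ((-a : ℤ) : ZMod L) /
    ((L : ℂ) * ZMod.dft (autocorr (ZMod.dft m) (-a)) w)

/-- Step 2: the estimate of the diagonal band `x̂ ∘ S_a conj x̂`. -/
def band {d L : ℕ} [NeZero d] [NeZero L] (m : ZMod d → ℂ)
    (Y : Matrix (ZMod d) (ZMod L) ℝ) (a : ℤ) : ZMod d → ℂ :=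
  ZMod.dft.symm (bandFourier m Y a)

/-- The signed circular offset of the position `(j, k)` from the main diagonal: the representative
of `k - j` modulo `d` that lies in `(-d/2, d/2]`. -/
def offset {d : ℕ} (j k : ZMod d) : ℤ := (k - j).valMinAbs

/-- The banded `d × d` matrix `C_{2κ-1}(M)` whose diagonal bands are the columns `M_a`,
`1 - κ ≤ a ≤ κ - 1`. -/
def bandedMatrix {d : ℕ} (κ : ℕ) (M : ℤ → ZMod d → ℂ) : Matrix (ZMod d) (ZMod d) ℂ :=
  fun j k => if (offset j k).natAbs < κ then M (offset j k) j else 0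

/-- The Hermitian part `(M + M^*) / 2`. -/
def hermPart {d : ℕ} (M : Matrix (ZMod d) (ZMod d) ℂ) : Matrix (ZMod d) (ZMod d) ℂ :=
  (1 / 2 : ℂ) • (M + Mᴴ)

/-- The signum function on `ℂ`, with `sgn 0 = 1`. -/
def sgn (z : ℂ) : ℂ := if z = 0 then 1 else z / (‖z‖ : ℂ)

/-- Componentwise normalisation of the entries in the band; the entries outside stay `0`. -/
def normalizeBand {d : ℕ} (κ : ℕ) (M : Matrix (ZMod d) (ZMod d) ℂ) :
    Matrix (ZMod d) (ZMod d) ℂ :=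
  fun j k => if (offset j k).natAbs < κ then sgn (M j k) else 0

/-- `v` is a normalised eigenvector for the largest (real) eigenvalue of `M`. -/
def IsLeadingEigenvector {d : ℕ} [NeZero d] (M : Matrix (ZMod d) (ZMod d) ℂ)
    (v : ZMod d → ℂ) : Prop :=
  l2norm v = 1 ∧ ∃ lam : ℝ, M *ᵥ v = (lam : ℂ) • v ∧
    ∀ mu : ℝ, Module.End.HasEigenvalue (Matrix.toLin' M) (mu : ℂ) → mu ≤ lam

/-- Steps 3 and 4: the Hermitianised banded matrix. -/
def lifted {d L : ℕ} [NeZero d] [NeZero L] (κ : ℕ) (m : ZMod d → ℂ)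
    (Y : Matrix (ZMod d) (ZMod L) ℝ) : Matrix (ZMod d) (ZMod d) ℂ :=
  hermPart (bandedMatrix κ (band m Y))

/-- The output `F_d⁻¹ x̂_e` built from the magnitudes on the main diagonal and from the phases
of the vector `v`. -/
def synthesize {d L : ℕ} [NeZero d] [NeZero L] (κ : ℕ) (m : ZMod d → ℂ)
    (Y : Matrix (ZMod d) (ZMod L) ℝ) (v : ZMod d → ℂ) : ZMod d → ℂ :=
  ZMod.dft.symm (fun j => (Real.sqrt (lifted κ m Y j j).re : ℂ) * sgn (v j))

/-- `xe` is an output of aliased Wigner deconvolution followed by angular synchronisation, on the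
measurement matrix `Y` and a mask `m` whose Fourier transform is supported in `[ρ]_0`; the
algorithm uses `κ = L - ρ + 1`. -/
def IsOutput {d L : ℕ} [NeZero d] [NeZero L] (ρ : ℕ) (m : ZMod d → ℂ)
    (Y : Matrix (ZMod d) (ZMod L) ℝ) (xe : ZMod d → ℂ) : Prop :=
  ∃ v, IsLeadingEigenvector (normalizeBand (L + 1 - ρ) (lifted (L + 1 - ρ) m Y)) v ∧
    xe = synthesize (L + 1 - ρ) m Y v

/-- The right-hand side of the error estimate. -/
def errorBound {d L : ℕ} [NeZero d] [NeZero L] (C C' : ℝ) (κ : ℕ) (m x : ZMod d → ℂ)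
    (N : Matrix (ZMod d) (ZMod L) ℝ) : ℝ :=
  C * ((d : ℝ) ^ (7 / 2 : ℝ) * maxAbs (ZMod.dft x) * frobNorm N /
      ((L : ℝ) ^ (1 / 2 : ℝ) * maskConst κ m * (κ : ℝ) ^ (5 / 2 : ℝ) *
        minAbs (ZMod.dft x) ^ 2)) +
    C' * ((d : ℝ) ^ (3 / 2 : ℝ) / (L : ℝ) ^ (1 / 4 : ℝ) *
      Real.sqrt (frobNorm N / maskConst κ m))

/-! ## Arithmetic programs and their flop count -/

/-- One instruction of a straight-line program: it computes one new complex number from the inputs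
or from numbers computed by earlier instructions (which are referred to by their position). -/
inductive Instr (ι : Type) : Type
  | input (i : ι)
  | const (c : ℂ)
  | add (a b : ℕ)
  | sub (a b : ℕ)
  | mul (a b : ℕ)
  | div (a b : ℕ)
  | conj (a : ℕ)
  | sqrt (a : ℕ)

/-- The number computed by an instruction, given the inputs `u` and the list `vals` of the numbers
computed so far; `sqrt` is the square root of a nonnegative real number. -/
def Instr.eval {ι : Type} (u : ι → ℂ) (vals : List ℂ) : Instr ι → ℂ
  | .input i => u i
  | .const c => c
  | .add a b => vals.getD a 0 + vals.getD b 0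
  | .sub a b => vals.getD a 0 - vals.getD b 0
  | .mul a b => vals.getD a 0 * vals.getD b 0
  | .div a b => vals.getD a 0 / vals.getD b 0
  | .conj a => (starRingEnd ℂ) (vals.getD a 0)
  | .sqrt a => (Real.sqrt (vals.getD a 0).re : ℂ)

/-- A straight-line program with inputs indexed by `ι` and outputs indexed by `o`: a list of
instructions, and for each output the position of the instruction that computes it. -/
structure Program (ι o : Type) : Type where
  instrs : List (Instr ι)
  out : o → ℕ

/-- The list of all numbers that a program computes. -/
def Program.trace {ι o : Type} (P : Program ι o) (u : ι → ℂ) : List ℂ :=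
  P.instrs.foldl (fun vals c => vals ++ [c.eval u vals]) []

/-- The output of a program. -/
def Program.run {ι o : Type} (P : Program ι o) (u : ι → ℂ) : o → ℂ :=
  fun i => (P.trace u).getD (P.out i) 0

/-- The flop count of a program: every instruction costs one, also reading an input or loading a
constant. -/
def Program.flops {ι o : Type} (P : Program ι o) : ℕ := P.instrs.length

/-- Programs which take the entries of a real `d × L` measurement matrix and of a mask in `ℂ^d`,
and return a vector in `ℂ^d`. -/
abbrev RecoveryProgram (d L : ℕ) : Type := Program ((ZMod d × ZMod L) ⊕ ZMod d) (ZMod d)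

/-- The vector that a recovery program returns on `Y` and `m`. -/
def RecoveryProgram.recover {d L : ℕ} (P : RecoveryProgram d L) (m : ZMod d → ℂ)
    (Y : Matrix (ZMod d) (ZMod L) ℝ) : ZMod d → ℂ :=
  Program.run P (Sum.elim (fun p => (Y p.1 p.2 : ℂ)) m)

end

end Spectrogram

/-!
The proof has two independent parts: a perturbation analysis of the algorithm and the construction
of a fast straight-line program.

*Deconvolution.* Expanding the squared moduli, the transform of a row of measurements at `-a`
collects the products `x̂_j conj x̂_{j'}` with `j' - j ≡ a` modulo `L`. As `m̂` lives on `ρ`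
consecutive frequencies and `L = ρ + κ - 1`, only `j' = j + a` survives for `|a| < κ`, and the
convolution theorem separates the signal from the mask (`band_measurements`). The measurements enter
linearly, so by Parseval the matrix `G` differs on the band from `x̂ x̂*` by at most
`d² ‖N‖_F / (√L μ₁)` in the Frobenius norm (`bandSum_lifted_sub_le`).

*Synchronization.* Let `T` be the matrix of normalised entries, `u = sgn x̂`, and `δ` the Frobenius
distance on the band between `T` and `u u*`. If `w` is a leading eigenvector of norm `√d`, then the
energy `∑ |w_j - T_jk w_k|²` over the band is at most the energy of `u`, which is `δ²`. Each entry
of `w` is an average over one band, hence of size `O(√(d / κ))`, so that replacing `T_jk` by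
`u_j conj u_k` costs only a factor `O(d / κ)`. The Poincaré inequality of the circular band graph
(`poincare`), which is proved by writing each translation as a sum of `O(d / κ)` translations
shorter than `κ`, then shows that `w` is close to a multiple of `u`
(`IsPhaseMatrix.exists_phase_sgn`). The bound on the entries of `w` is what makes the exponent of
`κ` right: a direct perturbation of eigenspaces needs `δ` to be smaller than the spectral gap.

*The program.* All Fourier transforms are computed by Bluestein's algorithm on top of a radix-2 fast
Fourier transform. The leading eigenvector is approximated by `⌈1 / ε⌉` steps of a power iteration
on the band, started at the products of the relative phases along the path `0, 1, …, d - 1`. The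
convergence rate of this iteration depends on `d`, but the starting vector is already exact up to
the noise; as a geometric sequence with ratio `< 1` is `O(1 / t)`, the error after `t` steps is at
most `c δ / t` with `c` depending on `d` only
(`IsPhaseMatrix.exists_l2norm_powerIterate_le`), so a threshold on the noise that does not depend on
`ε` is enough. The flop count is organised by the relation `Computes`, which
speaks of sets of functions of the data instead of positions in a program.
-/

namespace Spectrogram

open Matrix

noncomputable section

/-! ### Straight-line programs as sets of computable functions -/

section Circuits

variable {ι U : Type}

/-- The numbers computed by a list of instructions on the input `u`. -/
def values (p : List (Instr ι)) (u : ι → ℂ) : List ℂ :=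
  p.foldl (fun vals c => vals ++ [c.eval u vals]) []

lemma values_concat (p : List (Instr ι)) (c : Instr ι) (u : ι → ℂ) :
    values (p ++ [c]) u = values p u ++ [c.eval u (values p u)] := by
  simp [values]

lemma length_values (p : List (Instr ι)) (u : ι → ℂ) : (values p u).length = p.length := by
  induction p using List.reverseRecOn with
  | nil => simp [values]
  | append_singleton p c ih => simp [values_concat, ih]

lemma getD_values_append (p q : List (Instr ι)) (u : ι → ℂ) {i : ℕ} (hi : i < p.length) :
    (values (p ++ q) u).getD i 0 = (values p u).getD i 0 := by
  induction q using List.reverseRecOn with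
  | nil => simp
  | append_singleton q c ih =>
    rw [← List.append_assoc, values_concat, List.getD_append, ih]
    rw [length_values, List.length_append]
    omega

variable (e : U → ι → ℂ)

/-- The instruction list `p` computes the function `f` of a parameter `u`, which is fed to the
program as the input vector `e u`. -/
def Available (p : List (Instr ι)) (f : U → ℂ) : Prop :=
  ∃ i < p.length, ∀ u, (values p (e u)).getD i 0 = f u

/-- Every program that has computed the functions in `S` can be extended by at most `c`
instructions so that it computes the functions in `T` as well. -/
def Computes (S T : Set (U → ℂ)) (c : ℕ) : Prop :=
  ∀ p : List (Instr ι), (∀ f ∈ S, Available e p f) →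
    ∃ q : List (Instr ι), q.length ≤ c ∧ ∀ f ∈ T, Available e (p ++ q) f

variable {e}

lemma Available.append {p : List (Instr ι)} {f : U → ℂ} (h : Available e p f)
    (q : List (Instr ι)) : Available e (p ++ q) f := by
  obtain ⟨i, hi, hf⟩ := h
  refine ⟨i, by rw [List.length_append]; omega, fun u => ?_⟩
  rw [getD_values_append _ _ _ hi, hf]

lemma available_concat (p : List (Instr ι)) (c : Instr ι) :
    Available e (p ++ [c]) (fun u => c.eval (e u) (values p (e u))) := by
  refine ⟨p.length, by simp, fun u => ?_⟩
  rw [values_concat, List.getD_append_right _ _ _ _ (by rw [length_values]), length_values]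
  simp

namespace Computes

variable {S S' T T' R : Set (U → ℂ)} {a b c c' : ℕ} {f g : U → ℂ} {J : Type*}

lemma mono (h : Computes e S T c) (hS : S ⊆ S') (hT : T' ⊆ T) (hc : c ≤ c') :
    Computes e S' T' c' := by
  intro p hp
  obtain ⟨q, hq, hq'⟩ := h p fun f hf => hp f (hS hf)
  exact ⟨q, hq.trans hc, fun f hf => hq' f (hT hf)⟩

lemma of_subset (h : T ⊆ S) : Computes e S T 0 :=
  fun p hp => ⟨[], by simp, fun f hf => by simpa using hp f (h hf)⟩

lemma of_mem (h : f ∈ S) : Computes e S {f} 0 :=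
  of_subset (by simpa using h)

lemma trans_union (h₁ : Computes e S T a) (h₂ : Computes e (S ∪ T) R b) :
    Computes e S (T ∪ R) (a + b) := by
  intro p hp
  obtain ⟨q, hq, hq'⟩ := h₁ p hp
  obtain ⟨r, hr, hr'⟩ := h₂ (p ++ q) (by
    rintro f (hf | hf)
    exacts [(hp f hf).append q, hq' f hf])
  refine ⟨q ++ r, by rw [List.length_append]; omega, ?_⟩
  rw [← List.append_assoc]
  rintro f (hf | hf)
  exacts [(hq' f hf).append r, hr' f hf]

lemma trans (h₁ : Computes e S T a) (h₂ : Computes e (S ∪ T) R b) :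
    Computes e S R (a + b) :=
  (h₁.trans_union h₂).mono subset_rfl Set.subset_union_right le_rfl

/-- A variant of `Computes.trans` where the second step uses only what the first one computed. -/
lemma comp (h₁ : Computes e S T a) (h₂ : Computes e T R b) : Computes e S R (a + b) :=
  h₁.trans (h₂.mono Set.subset_union_right subset_rfl le_rfl)

lemma union (h₁ : Computes e S T a) (h₂ : Computes e S R b) : Computes e S (T ∪ R) (a + b) :=
  h₁.trans_union (h₂.mono Set.subset_union_left subset_rfl le_rfl)

lemma biUnion (s : Finset J) {T : J → Set (U → ℂ)} (h : ∀ j ∈ s, Computes e S (T j) c) :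
    Computes e S (⋃ j ∈ s, T j) (s.card * c) := by
  classical
  induction s using Finset.induction_on with
  | empty => exact (of_subset (T := ∅) (by simp)).mono subset_rfl (by simp) (by simp)
  | insert j s hj ih =>
    rw [Finset.set_biUnion_insert, Finset.card_insert_of_notMem hj]
    refine ((h j (by simp)).union (ih fun i hi => h i (by simp [hi]))).mono subset_rfl subset_rfl ?_
    rw [add_mul, one_mul, add_comm]

lemma iUnion [Fintype J] {T : J → Set (U → ℂ)} (h : ∀ j, Computes e S (T j) c) :
    Computes e S (⋃ j, T j) (Fintype.card J * c) := by
  simpa using biUnion (e := e) (S := S) (T := T) (c := c) Finset.univ fun j _ => h j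

lemma family [Fintype J] {F : J → U → ℂ} (h : ∀ j, Computes e S {F j} c) :
    Computes e S (Set.range F) (Fintype.card J * c) := by
  refine (iUnion h).mono subset_rfl ?_ le_rfl
  rintro _ ⟨j, rfl⟩
  simp

lemma instr (h : ∀ p : List (Instr ι), (∀ f ∈ S, Available e p f) →
      ∃ c : Instr ι, ∀ u, c.eval (e u) (values p (e u)) = f u) : Computes e S {f} 1 := by
  intro p hp
  obtain ⟨c, hc⟩ := h p hp
  refine ⟨[c], by simp, ?_⟩
  rintro _ rfl
  simpa only [hc] using available_concat (e := e) p c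

lemma input (i : ι) : Computes e S {fun u => e u i} 1 :=
  instr fun _ _ => ⟨.input i, fun _ => rfl⟩

lemma const (z : ℂ) : Computes e S {fun _ => z} 1 :=
  instr fun _ _ => ⟨.const z, fun _ => rfl⟩

lemma unary {op : ℂ → ℂ} (i : ℕ → Instr ι)
    (hi : ∀ k u vals, (i k).eval u vals = op (vals.getD k 0))
    (hf : Computes e S {f} a) : Computes e S {fun u => op (f u)} (a + 1) := by
  refine hf.trans (instr fun p hp => ?_)
  obtain ⟨k, -, hk⟩ := hp f (by simp)
  exact ⟨i k, fun u => by rw [hi, hk]⟩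

lemma binary {op : ℂ → ℂ → ℂ} (i : ℕ → ℕ → Instr ι)
    (hi : ∀ k l u vals, (i k l).eval u vals = op (vals.getD k 0) (vals.getD l 0))
    (hf : Computes e S {f} a) (hg : Computes e S {g} b) :
    Computes e S {fun u => op (f u) (g u)} (a + b + 1) := by
  refine (hf.union hg).trans (instr fun p hp => ?_)
  obtain ⟨k, -, hk⟩ := hp f (by simp)
  obtain ⟨l, -, hl⟩ := hp g (by simp)
  exact ⟨i k l, fun u => by rw [hi, hk, hl]⟩

lemma add (hf : Computes e S {f} a) (hg : Computes e S {g} b) :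
    Computes e S {fun u => f u + g u} (a + b + 1) := binary .add (fun _ _ _ _ => rfl) hf hg

lemma mul (hf : Computes e S {f} a) (hg : Computes e S {g} b) :
    Computes e S {fun u => f u * g u} (a + b + 1) := binary .mul (fun _ _ _ _ => rfl) hf hg

lemma div (hf : Computes e S {f} a) (hg : Computes e S {g} b) :
    Computes e S {fun u => f u / g u} (a + b + 1) := binary .div (fun _ _ _ _ => rfl) hf hg

lemma conj (hf : Computes e S {f} a) :
    Computes e S {fun u => (starRingEnd ℂ) (f u)} (a + 1) := unary .conj (fun _ _ _ => rfl) hf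

lemma sqrt (hf : Computes e S {f} a) :
    Computes e S {fun u => (Real.sqrt (f u).re : ℂ)} (a + 1) :=
  unary (op := fun z => (Real.sqrt z.re : ℂ)) .sqrt (fun _ _ _ => rfl) hf

lemma sum (s : Finset J) {F : J → U → ℂ} (h : ∀ j ∈ s, Computes e S {F j} c) :
    Computes e S {fun u => ∑ j ∈ s, F j u} (s.card * (c + 1) + 1) := by
  classical
  induction s using Finset.induction_on with
  | empty => simpa using const (e := e) (S := S) 0
  | insert j s hj ih =>
    simp only [Finset.sum_insert hj, Finset.card_insert_of_notMem hj]
    refine ((h j (by simp)).add (ih fun i hi => h i (by simp [hi]))).mono subset_rfl subset_rfl ?_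
    ring_nf
    rfl

/-- The phase `z / |z|`, where `0` is sent to `0`. -/
lemma phase (hf : f ∈ S) : Computes e S {fun u => f u / (‖f u‖ : ℂ)} 4 := by
  have h := (of_mem (e := e) hf).div ((of_mem (e := e) hf).mul (of_mem (e := e) hf).conj).sqrt
  refine h.mono subset_rfl ?_ (by norm_num)
  intro g hg
  rw [Set.mem_singleton_iff] at hg ⊢
  rw [hg]
  funext u
  rw [Complex.mul_conj, Complex.ofReal_re, Complex.norm_def]

end Computes

/-- A family of functions that can be computed from nothing is the output of a program. -/
lemma Computes.exists_program {o : Type} {F : o → U → ℂ} {c : ℕ}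
    (h : Computes e ∅ (Set.range F) c) :
    ∃ P : Program ι o, P.flops ≤ c ∧ ∀ u, P.run (e u) = fun i => F i u := by
  obtain ⟨q, hq, hF⟩ := h [] (by simp)
  choose out _ hout using fun i => hF (F i) ⟨i, rfl⟩
  exact ⟨⟨q, out⟩, hq, fun u => funext fun i => hout i u⟩

end Circuits

/-! ### The fast Fourier transform -/

section FFT

variable {ι U : Type} {e : U → ι → ℂ} {S : Set (U → ℂ)}

/-- The Fourier sum of length `2 ^ n` for the root of unity `ω`. -/
def rootSum (n : ℕ) (ω : ℂ) (x : ℕ → ℂ) (k : ℕ) : ℂ := ∑ j ∈ Finset.range (2 ^ n), x j * ω ^ (j * k)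

lemma sum_range_two_mul (f : ℕ → ℂ) (n : ℕ) :
    ∑ j ∈ Finset.range (2 * n), f j =
      ∑ j ∈ Finset.range n, f (2 * j) + ∑ j ∈ Finset.range n, f (2 * j + 1) := by
  induction n with
  | zero => simp
  | succ n ih =>
    rw [show 2 * (n + 1) = 2 * n + 1 + 1 by ring, Finset.sum_range_succ, Finset.sum_range_succ, ih,
      Finset.sum_range_succ _ n, Finset.sum_range_succ _ n]
    ring

/-- The radix-2 splitting into the even and the odd positions. -/
lemma rootSum_succ (n : ℕ) (ω : ℂ) (x : ℕ → ℂ) (k : ℕ) :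
    rootSum (n + 1) ω x k = rootSum n (ω ^ 2) (fun j => x (2 * j)) k +
      ω ^ k * rootSum n (ω ^ 2) (fun j => x (2 * j + 1)) k := by
  simp only [rootSum]
  rw [pow_succ, mul_comm (2 ^ n), sum_range_two_mul, Finset.mul_sum]
  congr 1
  · refine Finset.sum_congr rfl fun j _ => ?_
    rw [← pow_mul]
    ring_nf
  · refine Finset.sum_congr rfl fun j _ => ?_
    rw [← pow_mul, show (2 * j + 1) * k = k + 2 * (j * k) by ring, pow_add]
    ring

lemma rootSum_mod {n : ℕ} {ω : ℂ} (hω : ω ^ (2 ^ n) = 1) (x : ℕ → ℂ) (k : ℕ) :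
    rootSum n ω x (k % 2 ^ n) = rootSum n ω x k := by
  refine Finset.sum_congr rfl fun j _ => ?_
  congr 1
  conv_rhs => rw [← Nat.mod_add_div k (2 ^ n)]
  rw [mul_add, pow_add, show j * (2 ^ n * (k / 2 ^ n)) = 2 ^ n * (j * (k / 2 ^ n)) by ring,
    pow_mul ω (2 ^ n), hω, one_pow, mul_one]

/-- The radix-2 fast Fourier transform. -/
lemma computes_rootSum (n : ℕ) {ω : ℂ} (hω : ω ^ (2 ^ n) = 1) {F : ℕ → U → ℂ}
    (hF : ∀ j < 2 ^ n, F j ∈ S) :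
    Computes e S (Set.range fun k u => rootSum n ω (fun j => F j u) k) (3 * n * 2 ^ n) := by
  induction n generalizing ω F with
  | zero =>
    refine Computes.of_subset ?_
    rintro _ ⟨k, rfl⟩
    simpa [rootSum] using hF 0 (by simp)
  | succ n ih =>
    have hω' : (ω ^ 2) ^ (2 ^ n) = 1 := by rw [← pow_mul, ← pow_succ', hω]
    have h₀ := ih hω' (F := fun j => F (2 * j)) fun j hj => hF _ (by rw [pow_succ]; omega)
    have h₁ := ih hω' (F := fun j => F (2 * j + 1)) fun j hj => hF _ (by rw [pow_succ]; omega)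
    have h₂ := (h₀.union h₁).comp (Computes.biUnion (Finset.range (2 ^ (n + 1)))
      (T := fun k => {fun u => rootSum (n + 1) ω (fun j => F j u) k}) (c := 3) fun k _ => ?_)
    · refine h₂.mono subset_rfl ?_ ?_
      · rintro _ ⟨k, rfl⟩
        simp only [Set.mem_iUnion]
        refine ⟨k % 2 ^ (n + 1), ?_, ?_⟩
        · rw [Finset.mem_range]
          exact Nat.mod_lt _ (by positivity)
        · simp only [rootSum_mod hω, Set.mem_singleton_iff]
      · rw [Finset.card_range, pow_succ]
        ring_nf
        rfl
    · simp only [rootSum_succ]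
      exact (Computes.of_mem (Or.inl ⟨k, rfl⟩)).add
        ((Computes.const (ω ^ k)).mul (Computes.of_mem (Or.inr ⟨k, rfl⟩)))

lemma add_choose_two (j k : ℕ) : (j + k).choose 2 = j.choose 2 + k.choose 2 + j * k := by
  induction k with
  | zero => simp
  | succ k ih =>
    rw [← add_assoc, Nat.choose_succ_succ' (j + k) 1, Nat.choose_succ_succ' k 1, ih]
    simp only [Nat.choose_one_right]
    ring

lemma sum_zmod_eq_sum_range {n : ℕ} [NeZero n] (f : ZMod n → ℂ) :
    ∑ j, f j = ∑ j ∈ Finset.range n, f (j : ZMod n) := by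
  refine Finset.sum_nbij' (fun j => j.val) (fun j => (j : ZMod n)) ?_ ?_ ?_ ?_ ?_
  · intro j _
    exact Finset.mem_range.2 (ZMod.val_lt j)
  · intro j _
    exact Finset.mem_univ _
  · intro j _
    exact ZMod.natCast_zmod_val j
  · intro j hj
    exact ZMod.val_cast_of_lt (Finset.mem_range.1 hj)
  · intro j _
    simp

/-- The correlation of two sequences through Fourier sums of length `2 ^ t`. -/
lemma correlation_eq_rootSum {n t : ℕ} (ht : 2 * n ≤ 2 ^ t) {ξ : ℂ}
    (hξ : IsPrimitiveRoot ξ (2 ^ t)) (a b : ℕ → ℂ) (ha : ∀ j, n ≤ j → a j = 0) {k : ℕ}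
    (hk : k < n) :
    ∑ j ∈ Finset.range n, a j * b (j + k) =
      ((2 : ℂ) ^ t)⁻¹ * rootSum t ξ (fun l => rootSum t ξ a l * rootSum t ξ⁻¹ b l) k := by
  have hξ0 : ξ ≠ 0 := hξ.ne_zero (by positivity)
  have key : ∀ j < n, ∀ i < 2 ^ t,
      ∑ l ∈ Finset.range (2 ^ t), ξ ^ (j * l) * ξ⁻¹ ^ (i * l) * ξ ^ (l * k) =
        if i = j + k then (2 : ℂ) ^ t else 0 := by
    intro j hj i hi
    have h1 : ∀ l, ξ ^ (j * l) * ξ⁻¹ ^ (i * l) * ξ ^ (l * k) = (ξ ^ (j + k) * (ξ⁻¹) ^ i) ^ l := by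
      intro l
      rw [mul_pow, ← pow_mul, ← pow_mul, add_mul, pow_add, mul_comm l k]
      ring
    simp only [h1]
    split_ifs with h
    · rw [h, ← mul_pow, mul_inv_cancel₀ hξ0]
      simp
    · have h2 : ξ ^ (j + k) * ξ⁻¹ ^ i ≠ 1 := by
        intro h3
        rw [inv_pow, mul_inv_eq_one₀ (pow_ne_zero _ hξ0)] at h3
        exact h (hξ.pow_inj hi (by omega) h3.symm)
      have h4 : (ξ ^ (j + k) * ξ⁻¹ ^ i) ^ (2 ^ t) = 1 := by
        rw [mul_pow, ← pow_mul, ← pow_mul, mul_comm (j + k), mul_comm i, pow_mul, pow_mul, inv_pow,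
          hξ.pow_eq_one]
        simp
      rw [geom_sum_eq h2, h4]
      simp
  have h2t : (2 : ℂ) ^ t ≠ 0 := pow_ne_zero _ two_ne_zero
  have h5 : rootSum t ξ (fun l => rootSum t ξ a l * rootSum t ξ⁻¹ b l) k =
      ∑ j ∈ Finset.range (2 ^ t), ∑ i ∈ Finset.range (2 ^ t), a j * b i *
        ∑ l ∈ Finset.range (2 ^ t), ξ ^ (j * l) * ξ⁻¹ ^ (i * l) * ξ ^ (l * k) := by
    simp only [rootSum, Finset.sum_mul, Finset.mul_sum]
    rw [Finset.sum_comm]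
    conv_rhs => rw [Finset.sum_comm]
    refine Finset.sum_congr rfl fun j _ => ?_
    rw [Finset.sum_comm]
    refine Finset.sum_congr rfl fun i _ => Finset.sum_congr rfl fun l _ => ?_
    ring
  rw [h5, ← Finset.sum_subset (Finset.range_subset_range.2 (show n ≤ 2 ^ t by omega)),
    Finset.mul_sum]
  · refine Finset.sum_congr rfl fun j hj => ?_
    rw [Finset.mem_range] at hj
    rw [Finset.sum_congr rfl fun i hi => by rw [key j hj i (Finset.mem_range.1 hi)]]
    simp only [mul_ite, mul_zero]
    rw [Finset.sum_ite_eq' , if_pos (Finset.mem_range.2 (by omega))]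
    field_simp
  · intro j _ hj
    rw [Finset.mem_range, not_lt] at hj
    simp [ha j hj]

/-- Bluestein's identity, which turns a Fourier transform of arbitrary length into a correlation
with the chirp `ζ ^ (j choose 2)`. -/
lemma dft_eq_chirp {n : ℕ} [NeZero n] (y : ZMod n → ℂ) {ζ : ℂ}
    (hζ : ζ = ZMod.stdAddChar (-1 : ZMod n)) (k : ZMod n) :
    ZMod.dft y k = ζ⁻¹ ^ (k.val.choose 2) * ∑ j ∈ Finset.range n,
      (y j * ζ⁻¹ ^ (j.choose 2)) * ζ ^ ((j + k.val).choose 2) := by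
  have hζ0 : ζ ≠ 0 := by
    rw [hζ, ZMod.stdAddChar_apply]
    exact Circle.coe_ne_zero _
  rw [ZMod.dft_apply, sum_zmod_eq_sum_range, Finset.mul_sum]
  refine Finset.sum_congr rfl fun j _ => ?_
  have h : ZMod.stdAddChar (-((j : ZMod n) * k)) = ζ ^ (j * k.val) := by
    rw [hζ, ← AddChar.map_nsmul_eq_pow]
    congr 1
    simp
  rw [h, add_choose_two, pow_add, pow_add, smul_eq_mul, inv_pow, inv_pow]
  field_simp

/-- The cost of Bluestein's algorithm for the Fourier transform of length `n`. -/
def dftCost (n : ℕ) : ℕ :=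
  6 * Nat.clog 2 (2 * n) * 2 ^ Nat.clog 2 (2 * n) + 2 * 2 ^ Nat.clog 2 (2 * n) + 5 * n + 2

lemma computes_dft {n : ℕ} [NeZero n] {F : ZMod n → U → ℂ} (hF : Set.range F ⊆ S) :
    Computes e S (Set.range fun k u => ZMod.dft (fun j => F j u) k) (dftCost n) := by
  set t := Nat.clog 2 (2 * n) with ht
  have h2n : 2 * n ≤ 2 ^ t := Nat.le_pow_clog one_lt_two _
  set ζ : ℂ := ZMod.stdAddChar (-1 : ZMod n) with hζ
  obtain ⟨ξ, hξ⟩ : ∃ ξ : ℂ, IsPrimitiveRoot ξ (2 ^ t) :=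
    ⟨_, Complex.isPrimitiveRoot_exp _ (by positivity)⟩
  have hξ1 := hξ.pow_eq_one
  let G : ℕ → U → ℂ := fun j u => if j < n then F j u * ζ⁻¹ ^ (j.choose 2) else 0
  let b : ℕ → ℂ := fun i => ζ ^ (i.choose 2)
  let H : ℕ → U → ℂ := fun l u => rootSum t ξ (fun j => G j u) l * rootSum t ξ⁻¹ b l
  have hG : Computes e S (Set.range G) (n * 2 + 1) := by
    refine ((Computes.biUnion (Finset.range n) (T := fun j => {G j}) (c := 2) fun j hj => ?_).union
      (Computes.const 0)).mono subset_rfl ?_ (by simp)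
    · have hj' := Finset.mem_range.1 hj
      simp only [G, hj', if_true]
      exact (Computes.of_mem (hF (Set.mem_range_self (j : ZMod n)))).mul (Computes.const _)
    · rintro _ ⟨j, rfl⟩
      by_cases hj : j < n
      · left
        simp only [Set.mem_iUnion]
        exact ⟨j, Finset.mem_range.2 hj, rfl⟩
      · right
        simp [G, hj]
  have hA := computes_rootSum (e := e) (S := Set.range G) t hξ1 (F := G) fun j _ => ⟨j, rfl⟩
  have hH : Computes e (Set.range fun k u => rootSum t ξ (fun j => G j u) k)
      (⋃ l ∈ Finset.range (2 ^ t), {H l}) (2 ^ t * 2) := by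
    refine (Computes.biUnion (Finset.range (2 ^ t)) (T := fun l => {H l}) (c := 2)
      fun l _ => ?_).mono subset_rfl subset_rfl (by simp)
    exact (Computes.of_mem (Set.mem_range_self l)).mul (Computes.const _)
  have hC := computes_rootSum (e := e) (S := ⋃ l ∈ Finset.range (2 ^ t), {H l}) t hξ1 (F := H)
    fun j hj => by simpa using ⟨j, hj, rfl⟩
  have hD : Computes e (Set.range fun k u => rootSum t ξ (fun l => H l u) k)
      (Set.range fun k u => ZMod.dft (fun j => F j u) k) (n * 2) := by
    refine (Computes.family (c := 2) fun k => ?_).mono subset_rfl subset_rfl (by simp [ZMod.card])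
    have h := (Computes.const (e := e) (ζ⁻¹ ^ (k.val.choose 2) * ((2 : ℂ) ^ t)⁻¹)).mul
      (Computes.of_mem (e := e) (S := Set.range fun k u => rootSum t ξ (fun l => H l u) k)
        ⟨k.val, rfl⟩)
    refine h.mono subset_rfl ?_ (by norm_num)
    rw [Set.singleton_subset_iff, Set.mem_singleton_iff]
    funext u
    rw [dft_eq_chirp _ hζ k, mul_assoc,
      ← correlation_eq_rootSum h2n hξ (fun j => G j u) b (fun j hj => by simp [G, hj])
        (ZMod.val_lt k)]
    congr 1
    refine Finset.sum_congr rfl fun j hj => ?_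
    simp [G, b, Finset.mem_range.1 hj]
  refine ((((hG.comp hA).comp hH).comp hC).comp hD).mono subset_rfl subset_rfl ?_
  simp only [dftCost, ← ht]
  linarith

lemma computes_dft_symm {n : ℕ} [NeZero n] {F : ZMod n → U → ℂ} (hF : Set.range F ⊆ S) :
    Computes e S (Set.range fun k u => ZMod.dft.symm (fun j => F j u) k) (dftCost n + n * 2) := by
  refine (computes_dft hF).comp ((Computes.family (c := 2) fun k => ?_).mono subset_rfl subset_rfl
    (by simp [ZMod.card]))
  simp only [ZMod.invDFT_apply', smul_eq_mul]
  exact (Computes.const (n : ℂ)⁻¹).mul (Computes.of_mem (Set.mem_range_self (-k)))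

end FFT

/-! ### Fourier analysis on `ZMod d` -/

section Fourier

variable {d : ℕ} [NeZero d]

lemma conj_stdAddChar (j : ZMod d) :
    (starRingEnd ℂ) (ZMod.stdAddChar j) = ZMod.stdAddChar (-j) := by
  rw [AddChar.map_neg_eq_conj]

lemma sum_stdAddChar_mul (t : ZMod d) :
    ∑ i, (ZMod.stdAddChar (t * i) : ℂ) = if t = 0 then (d : ℂ) else 0 := by
  split_ifs with h
  · simp [h, ZMod.card]
  · exact AddChar.sum_eq_zero_of_ne_one (ZMod.isPrimitive_stdAddChar d h)

lemma sum_dft_mul (y z : ZMod d → ℂ) : ∑ k, ZMod.dft y k * z k = ∑ j, y j * ZMod.dft z j := by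
  simp only [ZMod.dft_apply, smul_eq_mul, Finset.sum_mul, Finset.mul_sum]
  rw [Finset.sum_comm]
  refine Finset.sum_congr rfl fun j _ => Finset.sum_congr rfl fun k _ => ?_
  rw [mul_comm k j]
  ring

lemma conj_dft (y : ZMod d → ℂ) (k : ZMod d) :
    (starRingEnd ℂ) (ZMod.dft y k) = ZMod.dft (fun j => (starRingEnd ℂ) (y j)) (-k) := by
  simp only [ZMod.dft_apply, smul_eq_mul, map_sum, map_mul, conj_stdAddChar]
  simp

/-- Parseval's identity. -/
lemma sum_norm_sq_dft (y : ZMod d → ℂ) : ∑ k, ‖ZMod.dft y k‖ ^ 2 = d * ∑ j, ‖y j‖ ^ 2 := by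
  have h : ∑ k, ZMod.dft y k * (starRingEnd ℂ) (ZMod.dft y k) =
      d * ∑ j, y j * (starRingEnd ℂ) (y j) := by
    simp only [conj_dft]
    have h1 := ZMod.dft_comp_neg (fun j => (starRingEnd ℂ) (y j))
    simp only [fun k => (congrFun h1 k).symm]
    rw [sum_dft_mul, ZMod.dft_dft, Finset.mul_sum]
    refine Finset.sum_congr rfl fun j _ => ?_
    simp only [neg_neg, smul_eq_mul]
    ring
  simp only [Complex.mul_conj, Complex.normSq_eq_norm_sq] at h
  exact_mod_cast h

lemma sum_norm_sq_dft_symm (y : ZMod d → ℂ) :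
    ∑ k, ‖ZMod.dft.symm y k‖ ^ 2 = (d : ℝ)⁻¹ * ∑ j, ‖y j‖ ^ 2 := by
  have h := sum_norm_sq_dft (ZMod.dft.symm y)
  rw [LinearEquiv.apply_symm_apply] at h
  have hd : (d : ℝ) ≠ 0 := NeZero.ne _
  rw [h]
  field_simp

lemma dft_convolution (a b : ZMod d → ℂ) (w : ZMod d) :
    ZMod.dft (fun k => ∑ j, a j * b (k - j)) w = ZMod.dft a w * ZMod.dft b w := by
  simp only [ZMod.dft_apply, smul_eq_mul]
  rw [Finset.sum_mul_sum]
  simp only [Finset.mul_sum]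
  rw [Finset.sum_comm]
  refine Finset.sum_congr rfl fun j _ => ?_
  refine Fintype.sum_equiv (Equiv.subRight j) _ _ fun k => ?_
  have h : -(k * w) = -(j * w) + -((k - j) * w) := by ring
  rw [Equiv.subRight_apply, h, AddChar.map_add_eq_mul]
  ring

/-- The Fourier transform of a windowed signal, in terms of the transforms of the signal and of
the window. -/
lemma dft_mul_shift (x m : ZMod d → ℂ) (s k : ZMod d) :
    ZMod.dft (fun n => x n * m (n - s)) k = (d : ℂ)⁻¹ *
      ∑ j, ZMod.dft x j * (ZMod.dft m (k - j) * ZMod.stdAddChar (-((k - j) * s))) := by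
  have hx : ∀ n, x n = (d : ℂ)⁻¹ * ∑ j, ZMod.stdAddChar (j * n) * ZMod.dft x j := by
    intro n
    have h := ZMod.invDFT_apply (ZMod.dft x) n
    rwa [LinearEquiv.symm_apply_apply] at h
  have hm : ∀ i, ZMod.dft m i * ZMod.stdAddChar (-(i * s)) =
      ∑ n, ZMod.stdAddChar (-(n * i)) * m (n - s) := by
    intro i
    rw [ZMod.dft_apply, Finset.sum_mul]
    refine Fintype.sum_equiv (Equiv.addRight s) _ _ fun n => ?_
    have h : -((n + s) * i) = -(n * i) + -(i * s) := by ring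
    rw [Equiv.coe_addRight, h, AddChar.map_add_eq_mul, add_sub_cancel_right, smul_eq_mul]
    ring
  simp only [hm]
  rw [ZMod.dft_apply]
  conv_lhs =>
    enter [2, n]
    rw [hx n, smul_eq_mul]
  simp only [Finset.mul_sum, Finset.sum_mul]
  rw [Finset.sum_comm]
  refine Finset.sum_congr rfl fun j _ => Finset.sum_congr rfl fun n _ => ?_
  have h : -(n * (k - j)) = -(n * k) + j * n := by ring
  rw [h, AddChar.map_add_eq_mul]
  ring

lemma stdAddChar_mul_div {L : ℕ} [NeZero L] (hL : L ∣ d) (i : ZMod d) (l : ZMod L) :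
    (ZMod.stdAddChar (i * ((l.val * (d / L) : ℕ) : ZMod d)) : ℂ) =
      ZMod.stdAddChar (ZMod.castHom hL (ZMod L) i * l) := by
  have h1 : i * ((l.val * (d / L) : ℕ) : ZMod d) =
      (((i.val * (l.val * (d / L)) : ℕ) : ℤ) : ZMod d) := by
    rw [Int.cast_natCast, Nat.cast_mul i.val, ZMod.natCast_zmod_val]
  have h2 : ZMod.castHom hL (ZMod L) i * l = (((i.val * l.val : ℕ) : ℤ) : ZMod L) := by
    push_cast
    rw [ZMod.natCast_zmod_val l, ZMod.castHom_apply, ZMod.natCast_val]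
  rw [h1, h2, ZMod.stdAddChar_coe, ZMod.stdAddChar_coe]
  congr 1
  obtain ⟨c, rfl⟩ := hL
  have hL0 : (L : ℂ) ≠ 0 := NeZero.ne _
  have hc0 : (c : ℂ) ≠ 0 := by
    have := NeZero.ne (L * c)
    exact_mod_cast right_ne_zero_of_mul this
  rw [Nat.mul_div_cancel_left _ (Nat.pos_of_ne_zero (NeZero.ne L))]
  push_cast
  field_simp

end Fourier

/-! ### Aliased Wigner deconvolution -/

section Wigner

variable {d L : ℕ} [NeZero d]

/-- The condition `|a| < κ` on the offset singles out one of the aliases of `a` modulo `L`: a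
difference of two positions in the support of a mask that agrees with `a` modulo
`L = ρ + κ - 1` is equal to `a`. -/
lemma alias_eq {ρ κ : ℕ} (hLe : L = ρ + κ - 1) (hL : L ∣ d) {p q : ZMod d}
    (hp : p.val < ρ) (hq : q.val < ρ) {a : ℤ} (ha : a ∈ Finset.Ioo (-(κ : ℤ)) κ)
    (h : ZMod.castHom hL (ZMod L) (p - q) = (a : ZMod L)) : p - q = (a : ZMod d) := by
  rw [Finset.mem_Ioo] at ha
  have h1 : p - q = (((p.val : ℤ) - q.val : ℤ) : ZMod d) := by
    push_cast
    rw [ZMod.natCast_zmod_val, ZMod.natCast_zmod_val]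
  rw [h1, map_intCast, ZMod.intCast_eq_intCast_iff_dvd_sub] at h
  have h3 : a - ((p.val : ℤ) - q.val) = 0 :=
    Int.eq_zero_of_abs_lt_dvd h (by rw [abs_lt]; omega)
  rw [h1]
  congr 1
  omega

variable [NeZero L]

lemma dft_norm_sq_measurement {ρ κ : ℕ} (hLe : L = ρ + κ - 1) (hL : L ∣ d) {m : ZMod d → ℂ}
    (hm : SupportedIn (ZMod.dft m) ρ) (x : ZMod d → ℂ) {a : ℤ}
    (ha : a ∈ Finset.Ioo (-(κ : ℤ)) κ) (k : ZMod d) :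
    ZMod.dft (fun l : ZMod L => ((measurements m x 0 k l : ℝ) : ℂ)) ((-a : ℤ) : ZMod L) =
      (L : ℂ) / (d : ℂ) ^ 2 *
        ∑ j, autocorr (ZMod.dft x) a j * autocorr (ZMod.dft m) (-a) (k - j) := by
  let φ := ZMod.castHom hL (ZMod L)
  have h1 : ∀ l : ZMod L, ((measurements m x 0 k l : ℝ) : ℂ) = ((d : ℂ) ^ 2)⁻¹ * ∑ j, ∑ i,
      (ZMod.dft x j * (starRingEnd ℂ) (ZMod.dft x i) *
        (ZMod.dft m (k - j) * (starRingEnd ℂ) (ZMod.dft m (k - i)))) *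
          ZMod.stdAddChar (φ (j - i) * l) := by
    intro l
    simp only [measurements, Matrix.zero_apply, add_zero]
    rw [dft_mul_shift]
    set s : ZMod d := ((l.val * (d / L) : ℕ) : ZMod d) with hs
    rw [Complex.ofReal_pow, ← Complex.mul_conj']
    simp only [map_mul, map_sum, map_inv₀, Complex.conj_natCast]
    rw [mul_mul_mul_comm, Finset.sum_mul_sum, ← mul_inv, ← pow_two]
    congr 1
    refine Finset.sum_congr rfl fun j _ => Finset.sum_congr rfl fun i _ => ?_
    have h2 : (ZMod.stdAddChar (φ (j - i) * l) : ℂ) =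
        ZMod.stdAddChar (-((k - j) * s)) * (starRingEnd ℂ) (ZMod.stdAddChar (-((k - i) * s))) := by
      rw [← stdAddChar_mul_div hL, conj_stdAddChar, ← AddChar.map_add_eq_mul, ← hs]
      congr 1
      ring
    rw [h2]
    ring
  have h3 : ∀ t : ZMod L, ∑ l : ZMod L, (ZMod.stdAddChar (-(l * ((-a : ℤ) : ZMod L))) : ℂ) *
      ZMod.stdAddChar (t * l) = if -t = (a : ZMod L) then (L : ℂ) else 0 := by
    intro t
    have h4 : ∀ l : ZMod L, (ZMod.stdAddChar (-(l * ((-a : ℤ) : ZMod L))) : ℂ) *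
        ZMod.stdAddChar (t * l) = ZMod.stdAddChar ((t + (a : ZMod L)) * l) := by
      intro l
      rw [← AddChar.map_add_eq_mul]
      congr 1
      push_cast
      ring
    simp only [h4, sum_stdAddChar_mul]
    congr 1
    rw [neg_eq_iff_add_eq_zero]
  rw [ZMod.dft_apply]
  simp only [h1, smul_eq_mul, Finset.mul_sum]
  rw [Finset.sum_comm]
  refine Finset.sum_congr rfl fun j _ => ?_
  rw [Finset.sum_comm, Finset.sum_eq_single (j + (a : ZMod d))]
  · have h5 := h3 (φ (j - (j + (a : ZMod d))))
    rw [if_pos (by simp)] at h5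
    have h6 : k - j + ((-a : ℤ) : ZMod d) = k - (j + (a : ZMod d)) := by push_cast; ring
    simp only [autocorr, h6]
    rw [div_eq_mul_inv, ← h5, Finset.sum_mul, Finset.sum_mul]
    refine Finset.sum_congr rfl fun l _ => ?_
    ring
  · intro i _ hi
    by_cases hz : ZMod.dft m (k - j) = 0 ∨ ZMod.dft m (k - i) = 0
    · rcases hz with hz | hz <;> simp [hz]
    · push Not at hz
      have h5 := h3 (φ (j - i))
      rw [if_neg] at h5
      · refine Eq.trans ?_ (mul_zero (((d : ℂ) ^ 2)⁻¹ * (ZMod.dft x j *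
          (starRingEnd ℂ) (ZMod.dft x i) *
          (ZMod.dft m (k - j) * (starRingEnd ℂ) (ZMod.dft m (k - i))))))
        rw [← h5, Finset.mul_sum]
        refine Finset.sum_congr rfl fun l _ => ?_
        ring
      · intro h6
        rw [← map_neg, neg_sub, show i - j = (k - j) - (k - i) by ring] at h6
        have h7 := alias_eq hLe hL (hm _ hz.1) (hm _ hz.2) ha h6
        apply hi
        rw [← h7]
        ring
  · intro h
    exact absurd (Finset.mem_univ _) h

lemma doubleDFT_measurements {ρ κ : ℕ} (hLe : L = ρ + κ - 1) (hL : L ∣ d) {m : ZMod d → ℂ}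
    (hm : SupportedIn (ZMod.dft m) ρ) (x : ZMod d → ℂ) {a : ℤ}
    (ha : a ∈ Finset.Ioo (-(κ : ℤ)) κ) (w : ZMod d) :
    doubleDFT (L := L) (measurements m x 0) w ((-a : ℤ) : ZMod L) =
      (L : ℂ) / (d : ℂ) ^ 2 *
        (ZMod.dft (autocorr (ZMod.dft x) a) w * ZMod.dft (autocorr (ZMod.dft m) (-a)) w) := by
  rw [← dft_convolution]
  simp only [doubleDFT, dft_norm_sq_measurement hLe hL hm x ha]
  rw [ZMod.dft_const_mul]

lemma doubleDFT_add (Y N : Matrix (ZMod d) (ZMod L) ℝ) (w : ZMod d) (b : ZMod L) :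
    doubleDFT (Y + N) w b = doubleDFT Y w b + doubleDFT N w b := by
  simp only [doubleDFT, ZMod.dft_apply, Matrix.add_apply, Complex.ofReal_add, smul_eq_mul,
    mul_add, Finset.sum_add_distrib]

lemma measurements_eq_add (m x : ZMod d → ℂ) (N : Matrix (ZMod d) (ZMod L) ℝ) :
    measurements m x N = measurements m x 0 + N := by
  ext k l
  simp [measurements]

lemma maskConst_le {κ : ℕ} (m : ZMod d → ℂ) {a : ℤ} (ha : a ∈ Finset.Ioo (-(κ : ℤ)) κ)
    (w : ZMod d) : maskConst κ m ≤ ‖ZMod.dft (autocorr (ZMod.dft m) (-a)) w‖ := by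
  rw [Finset.mem_Ioo] at ha
  exact ciInf_le (f := fun pq : Set.Icc (1 - (κ : ℤ)) ((κ : ℤ) - 1) × ZMod d =>
    ‖ZMod.dft (autocorr (ZMod.dft m) pq.1) pq.2‖) (Set.finite_range _).bddBelow
    (⟨⟨-a, by rw [Set.mem_Icc]; omega⟩, w⟩ : Set.Icc (1 - (κ : ℤ)) ((κ : ℤ) - 1) × ZMod d)

/-- Wigner deconvolution recovers the diagonal bands, up to the deconvolved noise. -/
lemma band_measurements {ρ κ : ℕ} (hLe : L = ρ + κ - 1) (hL : L ∣ d) {m : ZMod d → ℂ}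
    (hm : SupportedIn (ZMod.dft m) ρ) (hμ : 0 < maskConst κ m) (x : ZMod d → ℂ)
    (N : Matrix (ZMod d) (ZMod L) ℝ) {a : ℤ} (ha : a ∈ Finset.Ioo (-(κ : ℤ)) κ) :
    band m (measurements m x N) a = autocorr (ZMod.dft x) a + band m N a := by
  have h : bandFourier m (measurements m x N) a =
      ZMod.dft (autocorr (ZMod.dft x) a) + bandFourier m N a := by
    funext w
    have h0 : ZMod.dft (autocorr (ZMod.dft m) (-a)) w ≠ 0 :=
      norm_pos_iff.1 (hμ.trans_le (maskConst_le m ha w))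
    have hd : (d : ℂ) ≠ 0 := NeZero.ne _
    have hL0 : (L : ℂ) ≠ 0 := NeZero.ne _
    simp only [bandFourier, Pi.add_apply]
    rw [measurements_eq_add, doubleDFT_add, doubleDFT_measurements hLe hL hm x ha]
    field_simp
  rw [band, h, map_add, LinearEquiv.symm_apply_apply, band]

lemma sum_norm_sq_doubleDFT (N : Matrix (ZMod d) (ZMod L) ℝ) :
    ∑ b, ∑ w, ‖doubleDFT N w b‖ ^ 2 = d * L * frobNorm N ^ 2 := by
  simp only [doubleDFT]
  simp only [sum_norm_sq_dft]
  rw [← Finset.mul_sum, Finset.sum_comm]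
  simp only [sum_norm_sq_dft]
  rw [← Finset.mul_sum, frobNorm, Real.sq_sqrt (by positivity)]
  simp only [Complex.norm_real, Real.norm_eq_abs, sq_abs]
  ring

lemma sum_norm_sq_band_le {κ : ℕ} (hκ : 2 * κ ≤ L + 1) (m : ZMod d → ℂ) (hμ : 0 < maskConst κ m)
    (N : Matrix (ZMod d) (ZMod L) ℝ) :
    ∑ a ∈ Finset.Ioo (-(κ : ℤ)) κ, ∑ j, ‖band m N a j‖ ^ 2 ≤
      (d : ℝ) ^ 4 / (L * maskConst κ m ^ 2) * frobNorm N ^ 2 := by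
  have hd : (0 : ℝ) < d := Nat.cast_pos.2 (Nat.pos_of_ne_zero (NeZero.ne d))
  have hL : (0 : ℝ) < L := Nat.cast_pos.2 (Nat.pos_of_ne_zero (NeZero.ne L))
  set μ := maskConst κ m with hμdef
  have h1 : ∀ a ∈ Finset.Ioo (-(κ : ℤ)) κ, ∑ j, ‖band m N a j‖ ^ 2 ≤
      (d : ℝ) ^ 3 / (L ^ 2 * μ ^ 2) * ∑ w, ‖doubleDFT N w ((-a : ℤ) : ZMod L)‖ ^ 2 := by
    intro a ha
    rw [band, sum_norm_sq_dft_symm, Finset.mul_sum, Finset.mul_sum]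
    refine Finset.sum_le_sum fun w _ => ?_
    have h2 := maskConst_le m ha w
    rw [← hμdef] at h2
    simp only [bandFourier, norm_div, norm_mul, norm_pow, Complex.norm_natCast]
    have h3 : (d : ℝ) ^ 2 * ‖doubleDFT N w ((-a : ℤ) : ZMod L)‖ /
        (L * ‖ZMod.dft (autocorr (ZMod.dft m) (-a)) w‖) ≤
        (d : ℝ) ^ 2 * ‖doubleDFT N w ((-a : ℤ) : ZMod L)‖ / (L * μ) := by gcongr
    calc _ ≤ (d : ℝ)⁻¹ * ((d : ℝ) ^ 2 * ‖doubleDFT N w ((-a : ℤ) : ZMod L)‖ / (L * μ)) ^ 2 := by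
          gcongr
      _ = _ := by field_simp
  refine (Finset.sum_le_sum h1).trans ?_
  rw [← Finset.mul_sum]
  have h4 : ∑ a ∈ Finset.Ioo (-(κ : ℤ)) κ, ∑ w, ‖doubleDFT N w ((-a : ℤ) : ZMod L)‖ ^ 2 ≤
      d * L * frobNorm N ^ 2 := by
    rw [← sum_norm_sq_doubleDFT]
    have hinj : Set.InjOn (fun a : ℤ => ((-a : ℤ) : ZMod L)) (Finset.Ioo (-(κ : ℤ)) κ) := by
      intro a ha b hb hab
      rw [Finset.coe_Ioo, Set.mem_Ioo] at ha hb
      simp only at hab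
      rw [ZMod.intCast_eq_intCast_iff_dvd_sub] at hab
      have := Int.eq_zero_of_abs_lt_dvd hab (by rw [abs_lt]; omega)
      omega
    rw [← Finset.sum_image (f := fun b => ∑ w, ‖doubleDFT N w b‖ ^ 2) hinj]
    exact Finset.sum_le_sum_of_subset_of_nonneg (Finset.subset_univ _)
      fun _ _ _ => Finset.sum_nonneg fun _ _ => by positivity
  calc _ ≤ (d : ℝ) ^ 3 / (L ^ 2 * μ ^ 2) * (d * L * frobNorm N ^ 2) := by gcongr
    _ = _ := by field_simp

end Wigner

/-! ### Sums over the band -/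

section Band

variable {d : ℕ}

/-- The position `(j, k)` lies in the circular band of half-width `κ` around the diagonal. -/
def InBand (κ : ℕ) (j k : ZMod d) : Prop := (offset j k).natAbs < κ

instance (κ : ℕ) (j k : ZMod d) : Decidable (InBand κ j k) := Nat.decLt _ _

lemma inBand_comm {κ : ℕ} {j k : ZMod d} : InBand κ j k ↔ InBand κ k j := by
  rw [InBand, InBand, offset, offset, ← neg_sub, ZMod.natAbs_valMinAbs_neg]

lemma add_offset (j k : ZMod d) : j + ((offset j k : ℤ) : ZMod d) = k := by
  rw [offset, ZMod.coe_valMinAbs]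
  ring

lemma offset_mem {κ : ℕ} {j k : ZMod d} (h : InBand κ j k) :
    offset j k ∈ Finset.Ioo (-(κ : ℤ)) κ := by
  rw [InBand] at h
  rw [Finset.mem_Ioo]
  omega

lemma inBand_self {κ : ℕ} (hκ : 0 < κ) (j : ZMod d) : InBand κ j j := by
  simpa [InBand, offset] using hκ

variable [NeZero d]

/-- The sum of `f j k` over all positions `(j, k)` in the band. -/
def bandSum {M : Type*} [AddCommMonoid M] (κ : ℕ) (f : ZMod d → ZMod d → M) : M :=
  ∑ j, ∑ k, if InBand κ j k then f j k else 0

lemma offset_add {κ : ℕ} (hκ : 2 * κ ≤ d) (j : ZMod d) {a : ℤ}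
    (ha : a ∈ Finset.Ioo (-(κ : ℤ)) κ) : offset j (j + (a : ZMod d)) = a := by
  rw [Finset.mem_Ioo] at ha
  rw [offset, ZMod.valMinAbs_spec, Set.mem_Ioc]
  refine ⟨by ring, ?_⟩
  omega

lemma inBand_add {κ : ℕ} (hκ : 2 * κ ≤ d) (j : ZMod d) {a : ℤ}
    (ha : a ∈ Finset.Ioo (-(κ : ℤ)) κ) : InBand κ j (j + (a : ZMod d)) := by
  rw [InBand, offset_add hκ j ha]
  rw [Finset.mem_Ioo] at ha
  omega

variable {M : Type*} [AddCommMonoid M] {κ : ℕ}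

lemma sum_inBand (hκ : 2 * κ ≤ d) (j : ZMod d) (f : ZMod d → M) :
    ∑ k, (if InBand κ j k then f k else 0) =
      ∑ a ∈ Finset.Ioo (-(κ : ℤ)) κ, f (j + (a : ZMod d)) := by
  rw [← Finset.sum_filter]
  refine Finset.sum_nbij' (fun k => offset j k) (fun a => j + (a : ZMod d)) ?_ ?_ ?_ ?_ ?_
  · intro k hk
    exact offset_mem (Finset.mem_filter.1 hk).2
  · intro a ha
    exact Finset.mem_filter.2 ⟨Finset.mem_univ _, inBand_add hκ j ha⟩
  · intro k _
    exact add_offset j k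
  · intro a ha
    exact offset_add hκ j ha
  · intro k _
    rw [add_offset]

lemma bandSum_eq (hκ : 2 * κ ≤ d) (f : ZMod d → ZMod d → M) :
    bandSum κ f = ∑ a ∈ Finset.Ioo (-(κ : ℤ)) κ, ∑ j, f j (j + (a : ZMod d)) := by
  rw [Finset.sum_comm]
  exact Finset.sum_congr rfl fun j _ => sum_inBand hκ j (f j)

lemma bandSum_congr {f g : ZMod d → ZMod d → M} (h : ∀ j k, InBand κ j k → f j k = g j k) :
    bandSum κ f = bandSum κ g := by
  refine Finset.sum_congr rfl fun j _ => Finset.sum_congr rfl fun k _ => ?_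
  split_ifs with hb
  exacts [h j k hb, rfl]

lemma bandSum_add (f g : ZMod d → ZMod d → M) :
    bandSum κ (fun j k => f j k + g j k) = bandSum κ f + bandSum κ g := by
  simp only [bandSum, ← Finset.sum_add_distrib]
  refine Finset.sum_congr rfl fun j _ => Finset.sum_congr rfl fun k _ => ?_
  split_ifs <;> simp

lemma bandSum_swap (f : ZMod d → ZMod d → M) :
    bandSum κ (fun j k => f k j) = bandSum κ f := by
  rw [bandSum, Finset.sum_comm, bandSum]
  simp only [inBand_comm]

lemma bandSum_mono {f g : ZMod d → ZMod d → ℝ} (h : ∀ j k, InBand κ j k → f j k ≤ g j k) :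
    bandSum κ f ≤ bandSum κ g := by
  refine Finset.sum_le_sum fun j _ => Finset.sum_le_sum fun k _ => ?_
  split_ifs with hb
  exacts [h j k hb, le_rfl]

lemma bandSum_const_mul (c : ℝ) (f : ZMod d → ZMod d → ℝ) :
    bandSum κ (fun j k => c * f j k) = c * bandSum κ f := by
  simp only [bandSum, Finset.mul_sum, mul_ite, mul_zero]

lemma bandSum_nonneg {f : ZMod d → ZMod d → ℝ} (h : ∀ j k, 0 ≤ f j k) : 0 ≤ bandSum κ f := by
  refine Finset.sum_nonneg fun j _ => Finset.sum_nonneg fun k _ => ?_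
  split_ifs
  exacts [h j k, le_rfl]

lemma le_bandSum {f : ZMod d → ZMod d → ℝ} (h : ∀ j k, 0 ≤ f j k) {j k : ZMod d}
    (hb : InBand κ j k) : f j k ≤ bandSum κ f := by
  have h0 : ∀ j k, 0 ≤ if InBand κ j k then f j k else 0 := by
    intro j k
    split_ifs
    exacts [h j k, le_rfl]
  have h1 : f j k = if InBand κ j k then f j k else 0 := by rw [if_pos hb]
  rw [h1]
  exact (Finset.single_le_sum (f := fun k => if InBand κ j k then f j k else 0)
    (fun k _ => h0 j k) (Finset.mem_univ k)).trans
    (Finset.single_le_sum (f := fun j => ∑ k, if InBand κ j k then f j k else 0)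
      (fun j _ => Finset.sum_nonneg fun k _ => h0 j k) (Finset.mem_univ j))

lemma sum_diag_le_bandSum (hκ : 0 < κ) {f : ZMod d → ZMod d → ℝ} (h : ∀ j k, 0 ≤ f j k) :
    ∑ j, f j j ≤ bandSum κ f := by
  refine Finset.sum_le_sum fun j _ => ?_
  have h1 : f j j = if InBand κ j j then f j j else 0 := by rw [if_pos (inBand_self hκ j)]
  rw [h1]
  refine Finset.single_le_sum (f := fun k => if InBand κ j k then f j k else 0)
    (fun k _ => ?_) (Finset.mem_univ j)
  split_ifs
  exacts [h j k, le_rfl]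

end Band

/-! ### The lifted matrix -/

section Lifted

variable {d L : ℕ} [NeZero d] [NeZero L] {κ : ℕ}

lemma lifted_conjTranspose (m : ZMod d → ℂ) (Y : Matrix (ZMod d) (ZMod L) ℝ) (j k : ZMod d) :
    (starRingEnd ℂ) (lifted κ m Y k j) = lifted κ m Y j k := by
  simp only [lifted, hermPart, Matrix.smul_apply, Matrix.add_apply, Matrix.conjTranspose_apply,
    smul_eq_mul, map_mul, map_add, RCLike.star_def, Complex.conj_conj]
  rw [add_comm, map_div₀, map_one, map_ofNat]

lemma lifted_eq (m : ZMod d → ℂ) (Y : Matrix (ZMod d) (ZMod L) ℝ) {j k : ZMod d}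
    (h : InBand κ j k) : lifted κ m Y j k =
      (1 / 2) * (band m Y (offset j k) j + (starRingEnd ℂ) (band m Y (offset k j) k)) := by
  have h' := inBand_comm.1 h
  rw [InBand] at h h'
  simp [lifted, hermPart, bandedMatrix, h, h']

/-- The Frobenius error of the lifted matrix on the band. -/
lemma bandSum_lifted_sub_le {ρ : ℕ} (hLe : L = ρ + κ - 1) (hL : L ∣ d) (hκρ : κ ≤ ρ)
    (hρ : 2 * ρ < d) {m : ZMod d → ℂ} (hm : SupportedIn (ZMod.dft m) ρ)
    (hμ : 0 < maskConst κ m) (x : ZMod d → ℂ) (N : Matrix (ZMod d) (ZMod L) ℝ) :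
    bandSum κ (fun j k => ‖lifted κ m (measurements m x N) j k -
      ZMod.dft x j * (starRingEnd ℂ) (ZMod.dft x k)‖ ^ 2) ≤
      (d : ℝ) ^ 4 / (L * maskConst κ m ^ 2) * frobNorm N ^ 2 := by
  have h1 : bandSum κ (fun j k => ‖lifted κ m (measurements m x N) j k -
      ZMod.dft x j * (starRingEnd ℂ) (ZMod.dft x k)‖ ^ 2) ≤
      bandSum κ (fun j k => (1 / 2) * (‖band m N (offset j k) j‖ ^ 2 +
        ‖band m N (offset k j) k‖ ^ 2)) := by
    refine bandSum_mono fun j k hb => ?_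
    have hb' := inBand_comm.1 hb
    rw [lifted_eq m _ hb, band_measurements hLe hL hm hμ x N (offset_mem hb),
      band_measurements hLe hL hm hμ x N (offset_mem hb')]
    simp only [Pi.add_apply, autocorr, add_offset, map_add, map_mul, Complex.conj_conj]
    set A := band m N (offset j k) j
    set B := band m N (offset k j) k
    have h2 : (1 / 2 : ℂ) * (ZMod.dft x j * (starRingEnd ℂ) (ZMod.dft x k) + A +
        ((starRingEnd ℂ) (ZMod.dft x k) * ZMod.dft x j + (starRingEnd ℂ) B)) -
        ZMod.dft x j * (starRingEnd ℂ) (ZMod.dft x k) = (1 / 2) * (A + (starRingEnd ℂ) B) := by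
      ring
    rw [h2, norm_mul, mul_pow]
    have h3 : ‖A + (starRingEnd ℂ) B‖ ≤ ‖A‖ + ‖B‖ := by
      refine (norm_add_le _ _).trans ?_
      rw [RCLike.norm_conj]
    have h4 : ‖A + (starRingEnd ℂ) B‖ ^ 2 ≤ (‖A‖ + ‖B‖) ^ 2 := by gcongr
    norm_num
    nlinarith [sq_nonneg (‖A‖ - ‖B‖)]
  refine h1.trans ?_
  rw [bandSum_const_mul, bandSum_add, bandSum_swap fun j k => ‖band m N (offset j k) j‖ ^ 2]
  refine le_trans (le_of_eq ?_) (sum_norm_sq_band_le (by omega) m hμ N)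
  rw [bandSum_eq (by omega)]
  ring_nf
  refine Finset.sum_congr rfl fun a ha => Finset.sum_congr rfl fun j _ => ?_
  rw [offset_add (by omega) j ha]

end Lifted

/-! ### The Euclidean norm and phases -/

section Norm

variable {d : ℕ} [NeZero d]

lemma l2norm_sq (x : ZMod d → ℂ) : l2norm x ^ 2 = ∑ j, ‖x j‖ ^ 2 := by
  rw [l2norm, EuclideanSpace.norm_sq_eq]

lemma l2norm_nonneg (x : ZMod d → ℂ) : 0 ≤ l2norm x := norm_nonneg _

lemma l2norm_add_le (x y : ZMod d → ℂ) : l2norm (x + y) ≤ l2norm x + l2norm y := by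
  rw [l2norm, WithLp.toLp_add]
  exact norm_add_le _ _

lemma l2norm_smul (c : ℂ) (x : ZMod d → ℂ) : l2norm (c • x) = ‖c‖ * l2norm x := by
  rw [l2norm, WithLp.toLp_smul, norm_smul, l2norm]

lemma l2norm_sub_comm (x y : ZMod d → ℂ) : l2norm (x - y) = l2norm (y - x) := by
  rw [l2norm, WithLp.toLp_sub, norm_sub_rev, ← WithLp.toLp_sub, l2norm]

lemma l2norm_le_of_sq_le {x : ZMod d → ℂ} {b : ℝ} (hb : 0 ≤ b) (h : ∑ j, ‖x j‖ ^ 2 ≤ b ^ 2) :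
    l2norm x ≤ b := by
  rw [← l2norm_sq] at h
  exact le_of_sq_le_sq h hb

lemma norm_apply_le_l2norm (x : ZMod d → ℂ) (j : ZMod d) : ‖x j‖ ≤ l2norm x :=
  PiLp.norm_apply_le (WithLp.toLp 2 x) j

lemma l2norm_dft_symm (y : ZMod d → ℂ) :
    l2norm (ZMod.dft.symm y) = (Real.sqrt d)⁻¹ * l2norm y := by
  have hd : (0 : ℝ) ≤ d := Nat.cast_nonneg d
  rw [← sq_eq_sq₀ (l2norm_nonneg _) (mul_nonneg (by positivity) (l2norm_nonneg _)), mul_pow,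
    l2norm_sq, l2norm_sq, sum_norm_sq_dft_symm, inv_pow, Real.sq_sqrt hd]

lemma norm_sgn (z : ℂ) : ‖sgn z‖ = 1 := by
  rw [sgn]
  split_ifs with h
  · simp
  · rw [norm_div, Complex.norm_real, norm_norm, div_self (norm_ne_zero_iff.2 h)]

lemma norm_mul_sgn (z : ℂ) : (‖z‖ : ℂ) * sgn z = z := by
  rw [sgn]
  split_ifs with h
  · simp [h]
  · have : (‖z‖ : ℂ) ≠ 0 := by simpa using h
    field_simp

lemma sgn_conj (z : ℂ) : sgn ((starRingEnd ℂ) z) = (starRingEnd ℂ) (sgn z) := by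
  simp only [sgn, RCLike.norm_conj]
  split_ifs with h1 h2 h2
  · simp
  · exact absurd ((map_eq_zero _).1 h1) h2
  · exact absurd (by rw [h2, map_zero]) h1
  · rw [map_div₀, Complex.conj_ofReal]

lemma sgn_mul (a b : ℂ) (ha : a ≠ 0) (hb : b ≠ 0) : sgn (a * b) = sgn a * sgn b := by
  simp only [sgn, ha, hb, mul_ne_zero ha hb, if_false, norm_mul, Complex.ofReal_mul]
  rw [mul_div_mul_comm]

lemma sgn_of_norm_eq_one {z : ℂ} (hz : ‖z‖ = 1) : sgn z = z := by
  have : z ≠ 0 := norm_ne_zero_iff.1 (by rw [hz]; exact one_ne_zero)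
  simp [sgn, this, hz]

lemma sgn_real_mul {r : ℝ} (hr : 0 < r) (z : ℂ) : sgn ((r : ℂ) * z) = sgn z := by
  have hr' : (r : ℂ) ≠ 0 := by exact_mod_cast hr.ne'
  rcases eq_or_ne z 0 with rfl | hz
  · simp
  · rw [sgn_mul _ _ hr' hz]
    simp [sgn, hr.ne', abs_of_pos hr]

/-- The phase `z / |z|` depends on `z` in a Lipschitz way, whatever value is taken at `0`. -/
lemma norm_phase_sub_sgn_le {s a b : ℂ} (hs : ‖s‖ ≤ 1) (hsa : (‖a‖ : ℂ) * s = a) :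
    ‖s - sgn b‖ * ‖b‖ ≤ 2 * ‖a - b‖ := by
  have h1 : (s - sgn b) * (‖b‖ : ℂ) = s * ((‖b‖ : ℂ) - ‖a‖) + (a - b) := by
    have h2 := norm_mul_sgn b
    linear_combination -h2 + hsa
  have h3 : ‖s - sgn b‖ * ‖b‖ = ‖(s - sgn b) * (‖b‖ : ℂ)‖ := by
    rw [norm_mul, Complex.norm_real, norm_norm]
  have h4 : ‖(‖b‖ : ℂ) - ‖a‖‖ ≤ ‖a - b‖ := by
    rw [← Complex.ofReal_sub, Complex.norm_real, Real.norm_eq_abs, norm_sub_rev a b]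
    exact abs_norm_sub_norm_le b a
  rw [h3, h1]
  calc _ ≤ ‖s * ((‖b‖ : ℂ) - ‖a‖)‖ + ‖a - b‖ := norm_add_le _ _
    _ ≤ 1 * ‖a - b‖ + ‖a - b‖ := by
      rw [norm_mul]
      gcongr
    _ = _ := by ring

lemma norm_sgn_sub_sgn_le (a b : ℂ) : ‖sgn a - sgn b‖ * ‖b‖ ≤ 2 * ‖a - b‖ :=
  norm_phase_sub_sgn_le (norm_sgn a).le (norm_mul_sgn a)

end Norm

/-! ### A Poincaré inequality for the circular band graph -/

section Poincare

variable {d : ℕ} [NeZero d]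

/-- The Euclidean distance between `g` and its translate by `s`. -/
def shiftDist (g : ZMod d → ℂ) (s : ZMod d) : ℝ := l2norm fun j => g j - g (j + s)

lemma shiftDist_nonneg (g : ZMod d → ℂ) (s : ZMod d) : 0 ≤ shiftDist g s := l2norm_nonneg _

lemma shiftDist_sq (g : ZMod d → ℂ) (s : ZMod d) :
    shiftDist g s ^ 2 = ∑ j, ‖g j - g (j + s)‖ ^ 2 := l2norm_sq _

lemma l2norm_translate (x : ZMod d → ℂ) (s : ZMod d) : l2norm (fun j => x (j + s)) = l2norm x := by
  rw [← sq_eq_sq₀ (l2norm_nonneg _) (l2norm_nonneg _), l2norm_sq, l2norm_sq]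
  exact Fintype.sum_equiv (Equiv.addRight s) _ _ fun j => rfl

lemma shiftDist_add_le (g : ZMod d → ℂ) (s t : ZMod d) :
    shiftDist g (s + t) ≤ shiftDist g s + shiftDist g t := by
  have h : (fun j => g j - g (j + (s + t))) =
      (fun j => g j - g (j + s)) + fun j => g (j + s) - g (j + s + t) := by
    funext j
    simp [add_assoc]
  rw [shiftDist, h]
  refine (l2norm_add_le _ _).trans ?_
  rw [l2norm_translate (fun j => g j - g (j + t)) s]
  rfl

lemma shiftDist_neg (g : ZMod d → ℂ) (s : ZMod d) : shiftDist g (-s) = shiftDist g s := by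
  rw [shiftDist, ← l2norm_translate _ s]
  simp only [add_neg_cancel_right]
  exact l2norm_sub_comm (fun j => g (j + s)) g

lemma shiftDist_add_sq_le (g : ZMod d → ℂ) (s t : ZMod d) :
    shiftDist g (s + t) ^ 2 ≤ 2 * shiftDist g s ^ 2 + 2 * shiftDist g t ^ 2 := by
  have h1 := shiftDist_add_le g s t
  have h2 := shiftDist_nonneg g (s + t)
  nlinarith [sq_nonneg (shiftDist g s - shiftDist g t)]

/-- A short translation is, in many ways, a sum or a difference of two short translations, so that
its energy is at most a fraction of the total energy of the short translations. -/
lemma shiftDist_sq_le_of_lt (g : ZMod d → ℂ) {κ r : ℕ} (hr : r < κ) :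
    κ * shiftDist g r ^ 2 ≤ 8 * ∑ a ∈ Finset.range κ, shiftDist g a ^ 2 := by
  set M := ∑ a ∈ Finset.range κ, shiftDist g a ^ 2 with hM
  have hsub : ∀ {s : Finset ℕ}, s ⊆ Finset.range κ → ∑ a ∈ s, shiftDist g a ^ 2 ≤ M := fun hs =>
    Finset.sum_le_sum_of_subset_of_nonneg hs fun _ _ _ => sq_nonneg _
  have hsq := sq_nonneg (shiftDist g r)
  rcases Nat.lt_or_ge (2 * r) κ with h | h
  · have h1 : ∑ b ∈ Finset.range (κ - r), shiftDist g r ^ 2 ≤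
        ∑ b ∈ Finset.range (κ - r),
          (2 * shiftDist g ((r + b : ℕ) : ZMod d) ^ 2 + 2 * shiftDist g (b : ZMod d) ^ 2) := by
      refine Finset.sum_le_sum fun b _ => ?_
      have h2 := shiftDist_add_sq_le g ((r + b : ℕ) : ZMod d) (-(b : ZMod d))
      rw [shiftDist_neg] at h2
      simpa using h2
    rw [Finset.sum_const, Finset.card_range, nsmul_eq_mul, Finset.sum_add_distrib,
      ← Finset.mul_sum, ← Finset.mul_sum] at h1
    have h3 := hsub (s := Finset.range (κ - r)) (Finset.range_subset_range.2 (by omega))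
    have h4 : ∑ b ∈ Finset.range (κ - r), shiftDist g ((r + b : ℕ) : ZMod d) ^ 2 ≤ M := by
      have h5 := Finset.sum_Ico_eq_sum_range (fun b : ℕ => shiftDist g (b : ZMod d) ^ 2) r κ
      rw [← h5]
      exact hsub fun b hb => Finset.mem_range.2 (Finset.mem_Ico.1 hb).2
    have h6 : (κ : ℝ) ≤ 2 * ((κ - r : ℕ) : ℝ) := by
      have : κ ≤ 2 * (κ - r) := by omega
      exact_mod_cast this
    nlinarith
  · have h1 : ∑ b ∈ Finset.range (r + 1), shiftDist g r ^ 2 ≤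
        ∑ b ∈ Finset.range (r + 1),
          (2 * shiftDist g (b : ZMod d) ^ 2 + 2 * shiftDist g ((r - b : ℕ) : ZMod d) ^ 2) := by
      refine Finset.sum_le_sum fun b hb => ?_
      have h2 := shiftDist_add_sq_le g (b : ZMod d) ((r - b : ℕ) : ZMod d)
      rw [← Nat.cast_add, Nat.add_sub_cancel' (Nat.lt_succ_iff.1 (Finset.mem_range.1 hb))] at h2
      exact h2
    have h7 := Finset.sum_range_reflect (fun b : ℕ => shiftDist g (b : ZMod d) ^ 2) (r + 1)
    simp only [Nat.add_sub_cancel] at h7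
    rw [Finset.sum_const, Finset.card_range, nsmul_eq_mul, Finset.sum_add_distrib,
      ← Finset.mul_sum, ← Finset.mul_sum, h7] at h1
    have h3 := hsub (s := Finset.range (r + 1)) (Finset.range_subset_range.2 (by omega))
    have h6 : (κ : ℝ) ≤ 2 * ((r + 1 : ℕ) : ℝ) := by
      have : κ ≤ 2 * (r + 1) := by omega
      exact_mod_cast this
    nlinarith

lemma shiftDist_nat_mul_le (g : ZMod d → ℂ) (q : ℕ) (s : ZMod d) :
    shiftDist g (q * s) ≤ q * shiftDist g s := by
  induction q with
  | zero =>
    simp only [Nat.cast_zero, zero_mul, shiftDist, add_zero, sub_self]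
    exact (norm_zero (E := EuclideanSpace ℂ (ZMod d))).le
  | succ q ih =>
    push_cast
    rw [add_mul, add_mul, one_mul, one_mul]
    exact (shiftDist_add_le _ _ _).trans (by gcongr)

/-- Any translation is a sum of `O(d / κ)` translations shorter than `κ`. -/
lemma shiftDist_sq_le (g : ZMod d → ℂ) {κ : ℕ} (hκ : 2 ≤ κ) (hκd : κ ≤ d) (s : ZMod d) :
    (κ : ℝ) ^ 3 * shiftDist g s ^ 2 ≤
      72 * d ^ 2 * ∑ a ∈ Finset.range κ, shiftDist g a ^ 2 := by
  set M := ∑ a ∈ Finset.range κ, shiftDist g a ^ 2 with hM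
  have hκ0 : (0 : ℝ) < κ := by positivity
  have hM0 : 0 ≤ M := Finset.sum_nonneg fun _ _ => sq_nonneg _
  have hshort : ∀ r < κ, shiftDist g r ≤ Real.sqrt (8 * M / κ) := by
    intro r hr
    refine Real.le_sqrt_of_sq_le ?_
    rw [le_div_iff₀ hκ0, mul_comm]
    exact shiftDist_sq_le_of_lt g hr
  set q := s.val / (κ - 1)
  set r := s.val % (κ - 1)
  have hs : s = q * ((κ - 1 : ℕ) : ZMod d) + (r : ZMod d) := by
    rw [← Nat.cast_mul, ← Nat.cast_add, mul_comm, Nat.div_add_mod, ZMod.natCast_zmod_val]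
  have hr : r < κ := (Nat.mod_lt _ (by omega)).trans_le (Nat.sub_le _ _)
  have h1 : shiftDist g s ≤ (q + 1) * Real.sqrt (8 * M / κ) := by
    rw [hs, add_mul, one_mul]
    refine (shiftDist_add_le _ _ _).trans (add_le_add ?_ (hshort r hr))
    refine (shiftDist_nat_mul_le _ _ _).trans ?_
    gcongr
    exact hshort _ (by omega)
  have h2 : (κ : ℝ) * (q + 1) ≤ 3 * d := by
    have h3 : q * (κ - 1) ≤ d := (Nat.div_mul_le_self _ _).trans (ZMod.val_lt s).le
    have h4 : q * κ ≤ q * (2 * (κ - 1)) := Nat.mul_le_mul_left _ (by omega)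
    have h5 : κ * (q + 1) ≤ 3 * d := by nlinarith
    exact_mod_cast h5
  have h6 : κ * shiftDist g s ≤ 3 * d * Real.sqrt (8 * M / κ) :=
    calc κ * shiftDist g s ≤ κ * ((q + 1) * Real.sqrt (8 * M / κ)) := by gcongr
      _ = (κ * (q + 1)) * Real.sqrt (8 * M / κ) := by ring
      _ ≤ _ := by gcongr
  have h7 : (κ * shiftDist g s) ^ 2 ≤ (3 * d * Real.sqrt (8 * M / κ)) ^ 2 :=
    pow_le_pow_left₀ (mul_nonneg hκ0.le (shiftDist_nonneg _ _)) h6 2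
  rw [mul_pow, mul_pow _ (Real.sqrt _), Real.sq_sqrt (by positivity)] at h7
  calc (κ : ℝ) ^ 3 * shiftDist g s ^ 2 = κ * (κ ^ 2 * shiftDist g s ^ 2) := by ring
    _ ≤ κ * ((3 * d) ^ 2 * (8 * M / κ)) := by gcongr
    _ = _ := by
      field_simp
      ring

lemma sum_shiftDist_sq (g : ZMod d → ℂ) :
    ∑ s, shiftDist g s ^ 2 = 2 * (d * ∑ j, ‖g j‖ ^ 2 - ‖∑ j, g j‖ ^ 2) := by
  have h1 : ∑ s, shiftDist g s ^ 2 = ∑ j, ∑ k, ‖g j - g k‖ ^ 2 := by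
    simp only [shiftDist_sq]
    rw [Finset.sum_comm]
    exact Finset.sum_congr rfl fun j _ => Fintype.sum_equiv (Equiv.addLeft j) _ _ fun s => rfl
  have h2 : ∀ a b : ℂ, ‖a - b‖ ^ 2 = ‖a‖ ^ 2 + ‖b‖ ^ 2 - 2 * (a * (starRingEnd ℂ) b).re := by
    intro a b
    rw [← Complex.normSq_eq_norm_sq, Complex.normSq_sub, Complex.normSq_eq_norm_sq,
      Complex.normSq_eq_norm_sq]
  have h3 : ‖∑ j, g j‖ ^ 2 = ∑ j, ∑ k, (g j * (starRingEnd ℂ) (g k)).re := by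
    rw [← Complex.normSq_eq_norm_sq]
    have h4 := Complex.mul_conj (∑ j, g j)
    rw [map_sum, Finset.sum_mul_sum] at h4
    have h5 := congrArg Complex.re h4
    simp only [Complex.re_sum, Complex.ofReal_re] at h5
    exact h5.symm
  rw [h1, h3]
  simp only [h2, Finset.sum_sub_distrib, Finset.sum_add_distrib, Finset.sum_const,
    Finset.card_univ, ZMod.card, nsmul_eq_mul, ← Finset.mul_sum]
  ring

/-- The Poincaré inequality of the circular band graph: `d ∑ |g|² - |∑ g|²` is `d` times the
squared distance of `g` from the constants. -/
lemma poincare (g : ZMod d → ℂ) {κ : ℕ} (hκ : 2 ≤ κ) (hκd : 2 * κ ≤ d) :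
    (κ : ℝ) ^ 3 * (d * ∑ j, ‖g j‖ ^ 2 - ‖∑ j, g j‖ ^ 2) ≤
      36 * d ^ 3 * bandSum κ fun j k => ‖g j - g k‖ ^ 2 := by
  have h1 : ∑ a ∈ Finset.range κ, shiftDist g (a : ZMod d) ^ 2 ≤
      bandSum κ fun j k => ‖g j - g k‖ ^ 2 := by
    rw [bandSum_eq hκd]
    have h2 : ∑ a ∈ Finset.range κ, shiftDist g (a : ZMod d) ^ 2 =
        ∑ a ∈ (Finset.range κ).image (fun a : ℕ => (a : ℤ)),
          ∑ j, ‖g j - g (j + (a : ZMod d))‖ ^ 2 := by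
      rw [Finset.sum_image fun a _ b _ h => by exact_mod_cast h]
      simp only [shiftDist_sq, Int.cast_natCast]
    rw [h2]
    refine Finset.sum_le_sum_of_subset_of_nonneg ?_ fun _ _ _ =>
      Finset.sum_nonneg fun _ _ => by positivity
    intro a ha
    obtain ⟨b, hb, rfl⟩ := Finset.mem_image.1 ha
    rw [Finset.mem_range] at hb
    rw [Finset.mem_Ioo]
    omega
  have h3 : (κ : ℝ) ^ 3 * ∑ s, shiftDist g s ^ 2 ≤
      d * (72 * d ^ 2 * ∑ a ∈ Finset.range κ, shiftDist g (a : ZMod d) ^ 2) := by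
    rw [Finset.mul_sum]
    refine (Finset.sum_le_sum fun s _ => shiftDist_sq_le g hκ (by omega) s).trans ?_
    rw [Finset.sum_const, Finset.card_univ, ZMod.card, nsmul_eq_mul]
  rw [sum_shiftDist_sq] at h3
  have h4 : (d : ℝ) * (72 * d ^ 2 * ∑ a ∈ Finset.range κ, shiftDist g (a : ZMod d) ^ 2) ≤
      d * (72 * d ^ 2 * bandSum κ fun j k => ‖g j - g k‖ ^ 2) := by gcongr
  nlinarith

end Poincare

/-! ### The spectral theorem in coordinates -/

section Spectral

variable {n : Type*} [Fintype n]

lemma star_dotProduct_self (p : n → ℂ) : star p ⬝ᵥ p = ((∑ j, ‖p j‖ ^ 2 : ℝ) : ℂ) := by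
  simp only [dotProduct, Pi.star_apply, RCLike.star_def, Complex.conj_mul']
  push_cast
  rfl

lemma star_dotProduct_mulVec_of_isHermitian {M : Matrix n n ℂ} (hM : M.IsHermitian) {b : n → ℂ}
    {lam : ℝ} (hb : M *ᵥ b = (lam : ℂ) • b) (p : n → ℂ) :
    star b ⬝ᵥ (M *ᵥ p) = lam * (star b ⬝ᵥ p) := by
  have h : star b ᵥ* M = star (M *ᵥ b) := by
    rw [star_mulVec, hM.eq]
  rw [dotProduct_mulVec, h, hb, star_smul, smul_dotProduct]
  simp

/-- An orthonormal basis `b` of eigenvectors of a Hermitian matrix, with eigenvalues `lam`. -/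
structure IsEigenbasis (M : Matrix n n ℂ) (b : n → n → ℂ) (lam : n → ℝ) : Prop where
  mulVec : ∀ i, M *ᵥ b i = (lam i : ℂ) • b i
  norm_sq : ∀ i, ∑ j, ‖b i j‖ ^ 2 = 1
  orthogonal : ∀ i k, i ≠ k → star (b i) ⬝ᵥ b k = 0
  parseval : ∀ p : n → ℂ, ∑ i, ‖star (b i) ⬝ᵥ p‖ ^ 2 = ∑ j, ‖p j‖ ^ 2
  quadratic : ∀ p : n → ℂ, (star p ⬝ᵥ (M *ᵥ p)).re = ∑ i, lam i * ‖star (b i) ⬝ᵥ p‖ ^ 2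

lemma exists_isEigenbasis [DecidableEq n] {M : Matrix n n ℂ} (hM : M.IsHermitian) :
    ∃ b lam, IsEigenbasis M b lam := by
  let B := hM.eigenvectorBasis
  have hin : ∀ x y : EuclideanSpace ℂ n,
      inner ℂ x y = star (WithLp.ofLp x) ⬝ᵥ WithLp.ofLp y := by
    intro x y
    rw [EuclideanSpace.inner_eq_star_dotProduct, dotProduct_comm]
  have hev : ∀ i, M *ᵥ (WithLp.ofLp (B i)) = (hM.eigenvalues i : ℂ) • WithLp.ofLp (B i) := by
    intro i
    have h := hM.mulVec_eigenvectorBasis i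
    simpa using h
  refine ⟨fun i => WithLp.ofLp (B i), hM.eigenvalues, ⟨hev, ?_, ?_, ?_, ?_⟩⟩
  · intro i
    rw [← EuclideanSpace.norm_sq_eq, B.norm_eq_one, one_pow]
  · intro i k hik
    rw [← hin]
    exact B.inner_eq_zero hik
  · intro p
    have h := B.sum_sq_norm_inner_right (WithLp.toLp 2 p)
    rw [EuclideanSpace.norm_sq_eq] at h
    simpa only [hin] using h
  · intro p
    have h := B.sum_inner_mul_inner (WithLp.toLp 2 p) (WithLp.toLp 2 (M *ᵥ p))
    rw [hin] at h
    simp only at h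
    rw [← h, Complex.re_sum]
    refine Finset.sum_congr rfl fun i _ => ?_
    rw [← inner_conj_symm, hin, hin]
    simp only
    rw [star_dotProduct_mulVec_of_isHermitian hM (hev i), mul_left_comm, Complex.conj_mul',
      ← Complex.ofReal_pow, ← Complex.ofReal_mul, Complex.ofReal_re]

end Spectral

section Leading

variable {d : ℕ} [NeZero d]

/-- The Rayleigh quotient is maximal at a leading eigenvector. -/
lemma IsLeadingEigenvector.rayleigh_le {M : Matrix (ZMod d) (ZMod d) ℂ} (hM : M.IsHermitian)
    {v : ZMod d → ℂ} (hv : IsLeadingEigenvector M v) :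
    ∃ lam : ℝ, M *ᵥ v = (lam : ℂ) • v ∧
      ∀ p : ZMod d → ℂ, (star p ⬝ᵥ (M *ᵥ p)).re ≤ lam * ∑ j, ‖p j‖ ^ 2 := by
  obtain ⟨-, lam, hlam, htop⟩ := hv
  refine ⟨lam, hlam, fun p => ?_⟩
  obtain ⟨b, l, hb⟩ := exists_isEigenbasis hM
  rw [hb.quadratic, ← hb.parseval, Finset.mul_sum]
  refine Finset.sum_le_sum fun i _ => ?_
  gcongr
  refine htop _ (Module.End.hasEigenvalue_of_hasEigenvector (x := b i) ?_)
  rw [Module.End.hasEigenvector_iff, Module.End.mem_eigenspace_iff]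
  refine ⟨by rw [Matrix.toLin'_apply, hb.mulVec], fun h0 => ?_⟩
  have h1 := hb.norm_sq i
  simp [h0] at h1

/-- An eigenvector at which the Rayleigh quotient is maximal is a leading eigenvector. -/
lemma isLeadingEigenvector_of_rayleigh_le {M : Matrix (ZMod d) (ZMod d) ℂ} {v : ZMod d → ℂ}
    (hv : ∑ j, ‖v j‖ ^ 2 = 1) {lam : ℝ} (hlam : M *ᵥ v = (lam : ℂ) • v)
    (hR : ∀ p : ZMod d → ℂ, (star p ⬝ᵥ (M *ᵥ p)).re ≤ lam * ∑ j, ‖p j‖ ^ 2) :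
    IsLeadingEigenvector M v := by
  refine ⟨?_, lam, hlam, fun mu hmu => ?_⟩
  · rw [← l2norm_sq] at hv
    nlinarith [l2norm_nonneg v]
  · obtain ⟨p, hp⟩ := hmu.exists_hasEigenvector
    rw [Module.End.hasEigenvector_iff, Module.End.mem_eigenspace_iff, Matrix.toLin'_apply] at hp
    have h1 := hR p
    rw [hp.1, dotProduct_smul, star_dotProduct_self, smul_eq_mul, ← Complex.ofReal_mul,
      Complex.ofReal_re] at h1
    refine le_of_mul_le_mul_right h1 ?_
    obtain ⟨j, hj⟩ := Function.ne_iff.1 hp.2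
    exact Finset.sum_pos' (fun _ _ => by positivity)
      ⟨j, Finset.mem_univ j, by have := norm_pos_iff.2 hj; positivity⟩

/-- The eigenvector of an eigenbasis with the largest eigenvalue is a leading eigenvector. -/
lemma IsEigenbasis.rayleigh_le {M : Matrix (ZMod d) (ZMod d) ℂ} {b : ZMod d → ZMod d → ℂ}
    {lam : ZMod d → ℝ} (hb : IsEigenbasis M b lam) {i : ZMod d} (hi : ∀ k, lam k ≤ lam i)
    (p : ZMod d → ℂ) : (star p ⬝ᵥ (M *ᵥ p)).re ≤ lam i * ∑ j, ‖p j‖ ^ 2 := by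
  rw [hb.quadratic, ← hb.parseval, Finset.mul_sum]
  exact Finset.sum_le_sum fun k _ => mul_le_mul_of_nonneg_right (hi k) (by positivity)

lemma exists_isLeadingEigenvector {M : Matrix (ZMod d) (ZMod d) ℂ} (hM : M.IsHermitian) :
    ∃ v, IsLeadingEigenvector M v := by
  obtain ⟨b, lam, hb⟩ := exists_isEigenbasis hM
  obtain ⟨i, hi⟩ := Finite.exists_max lam
  exact ⟨b i, isLeadingEigenvector_of_rayleigh_le (hb.norm_sq i) (hb.mulVec i)
    (hb.rayleigh_le hi)⟩

end Leading

/-! ### Angular synchronization on the circular band graph -/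

section Synchronization

variable {d : ℕ} [NeZero d] {κ : ℕ}

/-- A Hermitian matrix of relative phases on the circular band: unimodular inside the band and
zero outside. -/
structure IsPhaseMatrix (κ : ℕ) (T : Matrix (ZMod d) (ZMod d) ℂ) : Prop where
  isHermitian : T.IsHermitian
  norm_eq_one : ∀ j k, InBand κ j k → ‖T j k‖ = 1
  eq_zero : ∀ j k, ¬ InBand κ j k → T j k = 0

/-- The squared distance on the band between the relative phases in `T` and those of the
vector `u`. -/
def phaseError (κ : ℕ) (T : Matrix (ZMod d) (ZMod d) ℂ) (u : ZMod d → ℂ) : ℝ :=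
  bandSum κ fun j k => ‖T j k - u j * (starRingEnd ℂ) (u k)‖ ^ 2

lemma phaseError_nonneg (T : Matrix (ZMod d) (ZMod d) ℂ) (u : ZMod d → ℂ) :
    0 ≤ phaseError κ T u :=
  bandSum_nonneg fun _ _ => by positivity

lemma bandSum_left (hκ : 0 < κ) (hκd : 2 * κ ≤ d) (f : ZMod d → ℝ) :
    bandSum κ (fun j _ => f j) = (2 * κ - 1) * ∑ j, f j := by
  rw [bandSum_eq hκd, Finset.sum_const, nsmul_eq_mul, Int.card_Ioo]
  congr 1
  have h : ((κ : ℤ) - -(κ : ℤ) - 1).toNat = 2 * κ - 1 := by omega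
  rw [h, Nat.cast_sub (by omega)]
  push_cast
  ring

lemma bandSum_right (hκ : 0 < κ) (hκd : 2 * κ ≤ d) (f : ZMod d → ℝ) :
    bandSum κ (fun _ k => f k) = (2 * κ - 1) * ∑ j, f j := by
  rw [← bandSum_left hκ hκd, ← bandSum_swap]

lemma IsPhaseMatrix.mulVec_apply {T : Matrix (ZMod d) (ZMod d) ℂ} (hT : IsPhaseMatrix κ T)
    (w : ZMod d → ℂ) (j : ZMod d) :
    (T *ᵥ w) j = ∑ k, if InBand κ j k then T j k * w k else 0 := by
  rw [mulVec, dotProduct]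
  refine Finset.sum_congr rfl fun k _ => ?_
  split_ifs with h
  · rfl
  · rw [hT.eq_zero j k h, zero_mul]

lemma IsPhaseMatrix.re_quadratic {T : Matrix (ZMod d) (ZMod d) ℂ} (hT : IsPhaseMatrix κ T)
    (w : ZMod d → ℂ) : (star w ⬝ᵥ (T *ᵥ w)).re =
      bandSum κ fun j k => ((starRingEnd ℂ) (w j) * (T j k * w k)).re := by
  rw [dotProduct, Complex.re_sum]
  refine Finset.sum_congr rfl fun j _ => ?_
  rw [hT.mulVec_apply, Finset.mul_sum, Complex.re_sum]
  refine Finset.sum_congr rfl fun k _ => ?_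
  split_ifs <;> simp

/-- The connection Laplacian as a sum of squares; `s` is a sign. -/
lemma IsPhaseMatrix.energy_eq {T : Matrix (ZMod d) (ZMod d) ℂ} (hT : IsPhaseMatrix κ T)
    (hκ : 0 < κ) (hκd : 2 * κ ≤ d) (w : ZMod d → ℂ) {s : ℝ} (hs : s ^ 2 = 1) :
    bandSum κ (fun j k => ‖w j - s * (T j k * w k)‖ ^ 2) =
      2 * ((2 * κ - 1) * ∑ j, ‖w j‖ ^ 2 - s * (star w ⬝ᵥ (T *ᵥ w)).re) := by
  have h1 : bandSum κ (fun j k => ‖w j - s * (T j k * w k)‖ ^ 2) =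
      bandSum κ fun j k => ‖w j‖ ^ 2 +
        (‖w k‖ ^ 2 + (-2 * s) * ((starRingEnd ℂ) (w j) * (T j k * w k)).re) := by
    refine bandSum_congr fun j k hb => ?_
    rw [← Complex.normSq_eq_norm_sq, Complex.normSq_sub, Complex.normSq_eq_norm_sq,
      Complex.normSq_eq_norm_sq, norm_mul, norm_mul, hT.norm_eq_one j k hb, Complex.norm_real,
      one_mul, mul_pow, Real.norm_eq_abs, sq_abs, hs, one_mul]
    have h2 : (w j * (starRingEnd ℂ) (s * (T j k * w k))).re =
        s * ((starRingEnd ℂ) (w j) * (T j k * w k)).re := by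
      rw [← Complex.conj_re]
      simp only [map_mul, Complex.conj_conj, Complex.conj_ofReal]
      rw [mul_left_comm, Complex.re_ofReal_mul]
    rw [h2]
    ring
  rw [h1, bandSum_add, bandSum_add, bandSum_left hκ hκd, bandSum_right hκ hκd,
    bandSum_const_mul, ← hT.re_quadratic]
  ring

lemma IsPhaseMatrix.energy_eq' {T : Matrix (ZMod d) (ZMod d) ℂ} (hT : IsPhaseMatrix κ T)
    (hκ : 0 < κ) (hκd : 2 * κ ≤ d) (w : ZMod d → ℂ) :
    bandSum κ (fun j k => ‖w j - T j k * w k‖ ^ 2) =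
      2 * ((2 * κ - 1) * ∑ j, ‖w j‖ ^ 2 - (star w ⬝ᵥ (T *ᵥ w)).re) := by
  have h := hT.energy_eq hκ hκd w (s := 1) (by norm_num)
  simpa using h

lemma norm_mul_conj_sub {a b u v : ℂ} (hv : ‖v‖ = 1) :
    ‖a * u - b * v‖ = ‖a * (u * (starRingEnd ℂ) v) - b‖ := by
  have h1 : v * (starRingEnd ℂ) v = 1 := by rw [Complex.mul_conj', hv]; norm_num
  have h2 : a * (u * (starRingEnd ℂ) v) - b = (a * u - b * v) * (starRingEnd ℂ) v := by
    linear_combination b * h1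
  rw [h2, norm_mul, RCLike.norm_conj, hv, mul_one]

/-- The energy at the vector `u` measures the phase error. -/
lemma IsPhaseMatrix.rayleigh_of_unimodular {T : Matrix (ZMod d) (ZMod d) ℂ}
    (hT : IsPhaseMatrix κ T) (hκ : 0 < κ) (hκd : 2 * κ ≤ d) {u : ZMod d → ℂ}
    (hu : ∀ j, ‖u j‖ = 1) :
    phaseError κ T u = 2 * ((2 * κ - 1) * d - (star u ⬝ᵥ (T *ᵥ u)).re) := by
  have h := hT.energy_eq' hκ hκd u
  simp only [hu, one_pow, Finset.sum_const, Finset.card_univ, ZMod.card, nsmul_eq_mul,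
    mul_one] at h
  rw [← h, phaseError]
  refine bandSum_congr fun j k _ => ?_
  have h1 : ‖T j k * u k - 1 * u j‖ = ‖T j k * (u k * (starRingEnd ℂ) (u j)) - 1‖ :=
    norm_mul_conj_sub (hu j)
  have h2 : ‖1 * u j - T j k * u k‖ = ‖1 * (u j * (starRingEnd ℂ) (u k)) - T j k‖ :=
    norm_mul_conj_sub (hu k)
  rw [one_mul, one_mul] at h2
  rw [h2, norm_sub_rev]

/-- Comparison of the energies for the relative phases in `T` and for those of `u`. -/
lemma energy_le {T : Matrix (ZMod d) (ZMod d) ℂ} {u : ZMod d → ℂ} (hu : ∀ j, ‖u j‖ = 1)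
    (w : ZMod d → ℂ) {B : ℝ} (hB : ∀ k, ‖w k‖ ^ 2 ≤ B) :
    bandSum κ (fun j k => ‖(starRingEnd ℂ) (u j) * w j - (starRingEnd ℂ) (u k) * w k‖ ^ 2) ≤
      2 * bandSum κ (fun j k => ‖w j - T j k * w k‖ ^ 2) + 2 * B * phaseError κ T u := by
  rw [phaseError, ← bandSum_const_mul, ← bandSum_const_mul, ← bandSum_add]
  refine bandSum_mono fun j k _ => ?_
  have h1 : ‖(starRingEnd ℂ) (u j) * w j - (starRingEnd ℂ) (u k) * w k‖ =
      ‖w j - u j * (starRingEnd ℂ) (u k) * w k‖ := by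
    have h := norm_mul_conj_sub (a := w k) (b := w j) (u := (starRingEnd ℂ) (u k))
      (v := (starRingEnd ℂ) (u j)) (by rw [RCLike.norm_conj, hu])
    rw [Complex.conj_conj] at h
    rw [norm_sub_rev, mul_comm _ (w k), mul_comm _ (w j), h, norm_sub_rev]
    congr 2
    ring
  have h2 : w j - u j * (starRingEnd ℂ) (u k) * w k =
      (w j - T j k * w k) + (T j k - u j * (starRingEnd ℂ) (u k)) * w k := by ring
  have h3 : ‖w j - u j * (starRingEnd ℂ) (u k) * w k‖ ≤
      ‖w j - T j k * w k‖ + ‖T j k - u j * (starRingEnd ℂ) (u k)‖ * ‖w k‖ := by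
    rw [h2, ← norm_mul]
    exact norm_add_le _ _
  rw [h1]
  have h4 := hB k
  have h5 : ‖w j - u j * (starRingEnd ℂ) (u k) * w k‖ ^ 2 ≤
      (‖w j - T j k * w k‖ + ‖T j k - u j * (starRingEnd ℂ) (u k)‖ * ‖w k‖) ^ 2 := by gcongr
  have h6 : ‖T j k - u j * (starRingEnd ℂ) (u k)‖ ^ 2 * ‖w k‖ ^ 2 ≤
      ‖T j k - u j * (starRingEnd ℂ) (u k)‖ ^ 2 * B := by gcongr
  nlinarith [sq_nonneg (‖w j - T j k * w k‖ - ‖T j k - u j * (starRingEnd ℂ) (u k)‖ * ‖w k‖)]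

lemma sum_norm_sq_conj_mul {u : ZMod d → ℂ} (hu : ∀ j, ‖u j‖ = 1) (w : ZMod d → ℂ) :
    ∑ j, ‖(starRingEnd ℂ) (u j) * w j‖ ^ 2 = ∑ j, ‖w j‖ ^ 2 := by
  simp only [norm_mul, RCLike.norm_conj, hu, one_mul]

/-- A vector of norm `√d` is, up to a global phase, as close to the unimodular vector `u` as its
correlation with `u` is large. -/
lemma exists_phase_sum_le {u w : ZMod d → ℂ} (hu : ∀ j, ‖u j‖ = 1) (hw : ∑ j, ‖w j‖ ^ 2 = d) :
    ∃ c : ℂ, ‖c‖ = 1 ∧ (d : ℝ) * ∑ j, ‖w j - c * u j‖ ^ 2 ≤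
      2 * (d * d - ‖∑ j, (starRingEnd ℂ) (u j) * w j‖ ^ 2) := by
  set s := ∑ j, (starRingEnd ℂ) (u j) * w j with hs
  have hd : (0 : ℝ) < d := Nat.cast_pos.2 (Nat.pos_of_ne_zero (NeZero.ne d))
  refine ⟨sgn s, norm_sgn s, ?_⟩
  have h1 : ∀ j, ‖w j - sgn s * u j‖ ^ 2 =
      ‖w j‖ ^ 2 + 1 - 2 * ((starRingEnd ℂ) (sgn s) * ((starRingEnd ℂ) (u j) * w j)).re := by
    intro j
    rw [← Complex.normSq_eq_norm_sq, Complex.normSq_sub, Complex.normSq_eq_norm_sq,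
      Complex.normSq_eq_norm_sq, norm_mul, norm_sgn, hu, map_mul]
    ring_nf
  have h2 : ∑ j, ‖w j - sgn s * u j‖ ^ 2 = 2 * d - 2 * ‖s‖ := by
    simp only [h1, Finset.sum_sub_distrib, Finset.sum_add_distrib, hw, ← Finset.mul_sum,
      ← Complex.re_sum, ← hs]
    have h3 : (starRingEnd ℂ) (sgn s) * s = (‖s‖ : ℂ) := by
      have h4 := norm_mul_sgn s
      have h5 : (starRingEnd ℂ) (sgn s) * sgn s = 1 := by
        rw [Complex.conj_mul', norm_sgn]
        norm_num
      linear_combination -(starRingEnd ℂ) (sgn s) * h4 + (‖s‖ : ℂ) * h5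
    rw [h3, Complex.ofReal_re]
    simp
    ring
  rw [h2]
  have h6 : ‖s‖ ≤ d := by
    have h7 : ‖s‖ ≤ ∑ j, ‖w j‖ := by
      refine (norm_sum_le _ _).trans (le_of_eq ?_)
      simp only [norm_mul, RCLike.norm_conj, hu, one_mul]
    have h8 : (∑ j, ‖w j‖) ^ 2 ≤ (Finset.univ : Finset (ZMod d)).card * ∑ j, ‖w j‖ ^ 2 :=
      sq_sum_le_card_mul_sum_sq
    rw [hw, Finset.card_univ, ZMod.card] at h8
    have h9 : (∑ j, ‖w j‖) ^ 2 ≤ (d : ℝ) ^ 2 := by rw [pow_two (d : ℝ)]; exact h8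
    exact h7.trans (le_of_sq_le_sq h9 hd.le)
  nlinarith [norm_nonneg s]

/-- The leading eigenvector, scaled to norm `√d`, has entries of size `O(√(d / κ))`, because each
entry is an average over one band. -/
lemma IsPhaseMatrix.norm_sq_apply_le {T : Matrix (ZMod d) (ZMod d) ℂ} (hT : IsPhaseMatrix κ T)
    (hκ : 2 ≤ κ) (hκd : 2 * κ ≤ d) {w : ZMod d → ℂ} (hw : ∑ j, ‖w j‖ ^ 2 = d) {lam : ℝ}
    (hlam : T *ᵥ w = (lam : ℂ) • w) (hlow : (κ : ℝ) / 2 ≤ lam) (j : ZMod d) :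
    ‖w j‖ ^ 2 ≤ 8 * d / κ := by
  have hκ0 : (0 : ℝ) < κ := by positivity
  have h1 : (lam : ℂ) * w j = ∑ k, if InBand κ j k then T j k * w k else 0 := by
    rw [← hT.mulVec_apply, hlam]
    rfl
  have h2 : lam * ‖w j‖ ≤ ∑ a ∈ Finset.Ioo (-(κ : ℤ)) κ, ‖w (j + (a : ZMod d))‖ := by
    rw [← sum_inBand hκd j fun k => ‖w k‖]
    calc lam * ‖w j‖ ≤ ‖(lam : ℂ) * w j‖ := by
          rw [norm_mul, Complex.norm_real, Real.norm_eq_abs]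
          gcongr
          exact le_abs_self _
      _ ≤ _ := by
          rw [h1]
          refine (norm_sum_le _ _).trans (Finset.sum_le_sum fun k _ => ?_)
          split_ifs with hb
          · rw [norm_mul, hT.norm_eq_one j k hb, one_mul]
          · rw [norm_zero]
  have h3 : (∑ a ∈ Finset.Ioo (-(κ : ℤ)) κ, ‖w (j + (a : ZMod d))‖) ^ 2 ≤ 2 * κ * d := by
    refine sq_sum_le_card_mul_sum_sq.trans ?_
    rw [← sum_inBand hκd j fun k => ‖w k‖ ^ 2, Int.card_Ioo]
    have h4 : (((κ : ℤ) - -(κ : ℤ) - 1).toNat : ℝ) ≤ 2 * κ := by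
      have : ((κ : ℤ) - -(κ : ℤ) - 1).toNat ≤ 2 * κ := by omega
      exact_mod_cast this
    have h5 : ∑ k, (if InBand κ j k then ‖w k‖ ^ 2 else 0) ≤ d := by
      rw [← hw]
      refine Finset.sum_le_sum fun k _ => ?_
      split_ifs
      exacts [le_rfl, by positivity]
    gcongr
  have h6 : (κ : ℝ) / 2 * ‖w j‖ ≤ ∑ a ∈ Finset.Ioo (-(κ : ℤ)) κ, ‖w (j + (a : ZMod d))‖ :=
    le_trans (by gcongr) h2
  have h7 := (pow_le_pow_left₀ (by positivity) h6 2).trans h3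
  rw [le_div_iff₀ hκ0]
  nlinarith

/-- The leading eigenvector of a phase matrix that is close to `u u*` is close to `u`, up to a
global phase. -/
lemma IsPhaseMatrix.exists_phase_eigenvector {T : Matrix (ZMod d) (ZMod d) ℂ}
    (hT : IsPhaseMatrix κ T) (hκ : 2 ≤ κ) (hκd : 2 * κ ≤ d) {u : ZMod d → ℂ}
    (hu : ∀ j, ‖u j‖ = 1) {w : ZMod d → ℂ} (hw : ∑ j, ‖w j‖ ^ 2 = d) {lam : ℝ}
    (hlam : T *ᵥ w = (lam : ℂ) • w)
    (htop : ∀ p : ZMod d → ℂ, (star p ⬝ᵥ (T *ᵥ p)).re ≤ lam * ∑ j, ‖p j‖ ^ 2)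
    (hδ : phaseError κ T u ≤ d * κ) :
    ∃ c : ℂ, ‖c‖ = 1 ∧ (κ : ℝ) ^ 5 * ∑ j, ‖w j - c * u j‖ ^ 2 ≤
      1296 * d ^ 4 * phaseError κ T u := by
  have hd : (0 : ℝ) < d := Nat.cast_pos.2 (Nat.pos_of_ne_zero (NeZero.ne d))
  have hκ0 : (2 : ℝ) ≤ κ := by exact_mod_cast hκ
  have hκd' : 2 * (κ : ℝ) ≤ d := by exact_mod_cast hκd
  have hδ0 := phaseError_nonneg (κ := κ) T u
  have h1 := hT.rayleigh_of_unimodular (by omega) hκd hu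
  have h2 := htop u
  simp only [hu, one_pow, Finset.sum_const, Finset.card_univ, ZMod.card, nsmul_eq_mul,
    mul_one] at h2
  have hlow : (κ : ℝ) / 2 ≤ lam := by
    have h3 : d * (κ / 2) ≤ d * lam := by nlinarith
    exact le_of_mul_le_mul_left h3 hd
  have henergy : bandSum κ (fun j k => ‖w j - T j k * w k‖ ^ 2) ≤ phaseError κ T u := by
    rw [hT.energy_eq' (by omega) hκd, hlam, dotProduct_smul, star_dotProduct_self, hw,
      smul_eq_mul, ← Complex.ofReal_mul, Complex.ofReal_re]
    nlinarith
  have h4 := energy_le (κ := κ) (T := T) hu w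
    fun k => hT.norm_sq_apply_le hκ hκd hw hlam hlow k
  have h5 := poincare (fun j => (starRingEnd ℂ) (u j) * w j) hκ hκd
  rw [sum_norm_sq_conj_mul hu, hw] at h5
  obtain ⟨c, hc, h6⟩ := exists_phase_sum_le hu hw
  refine ⟨c, hc, ?_⟩
  set E := bandSum κ fun j k =>
    ‖(starRingEnd ℂ) (u j) * w j - (starRingEnd ℂ) (u k) * w k‖ ^ 2
  set s := ∑ j, ‖w j - c * u j‖ ^ 2
  set δ := phaseError κ T u
  have hE : 0 ≤ E := bandSum_nonneg fun _ _ => by positivity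
  have h7 : κ * E ≤ 18 * d * δ := by
    have h8 : κ * E ≤ κ * (2 * δ + 2 * (8 * d / κ) * δ) := by gcongr; linarith
    have h9 : (κ : ℝ) * (2 * δ + 2 * (8 * d / κ) * δ) = 2 * κ * δ + 16 * d * δ := by
      field_simp
      ring
    nlinarith
  have h10 : κ ^ 3 * s ≤ 72 * d ^ 2 * E := by
    have h11 : d * (κ ^ 3 * s) ≤ d * (72 * d ^ 2 * E) := by
      calc d * (κ ^ 3 * s) = κ ^ 3 * (d * s) := by ring
        _ ≤ κ ^ 3 * (2 * (d * d - ‖∑ j, (starRingEnd ℂ) (u j) * w j‖ ^ 2)) := by gcongr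
        _ ≤ _ := by linarith
    exact le_of_mul_le_mul_left h11 hd
  calc κ ^ 5 * s = κ ^ 2 * (κ ^ 3 * s) := by ring
    _ ≤ κ ^ 2 * (72 * d ^ 2 * E) := by gcongr
    _ = 72 * d ^ 2 * κ * (κ * E) := by ring
    _ ≤ 72 * d ^ 2 * d * (18 * d * δ) := by gcongr; omega
    _ = _ := by ring

/-- Angular synchronization: the phases of the leading eigenvector estimate the phases `u`. -/
lemma IsPhaseMatrix.exists_phase_sgn {T : Matrix (ZMod d) (ZMod d) ℂ}
    (hT : IsPhaseMatrix κ T) (hκ : 2 ≤ κ) (hκd : 2 * κ ≤ d) {u : ZMod d → ℂ}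
    (hu : ∀ j, ‖u j‖ = 1) {v : ZMod d → ℂ} (hv : IsLeadingEigenvector T v) :
    ∃ c : ℂ, ‖c‖ = 1 ∧ (κ : ℝ) ^ 5 * ∑ j, ‖sgn (v j) - c * u j‖ ^ 2 ≤
      5184 * d ^ 4 * phaseError κ T u := by
  have hd : (0 : ℝ) < d := Nat.cast_pos.2 (Nat.pos_of_ne_zero (NeZero.ne d))
  have hκ0 : (2 : ℝ) ≤ κ := by exact_mod_cast hκ
  have hκd' : 2 * (κ : ℝ) ≤ d := by exact_mod_cast hκd
  have hδ0 := phaseError_nonneg (κ := κ) T u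
  rcases le_or_gt (phaseError κ T u) (d * κ) with hδ | hδ
  · obtain ⟨lam, hlam, htop⟩ := hv.rayleigh_le hT.isHermitian
    have hsd : 0 < Real.sqrt d := Real.sqrt_pos.2 hd
    set w : ZMod d → ℂ := (Real.sqrt d : ℂ) • v with hwdef
    have hw : ∑ j, ‖w j‖ ^ 2 = d := by
      rw [← l2norm_sq, hwdef, l2norm_smul, hv.1, mul_one, Complex.norm_real, Real.norm_eq_abs,
        sq_abs, Real.sq_sqrt hd.le]
    have hlam' : T *ᵥ w = (lam : ℂ) • w := by
      rw [hwdef, mulVec_smul, hlam, smul_comm]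
    obtain ⟨c, hc, h⟩ := hT.exists_phase_eigenvector hκ hκd hu hw hlam' htop hδ
    refine ⟨c, hc, ?_⟩
    have h1 : ∑ j, ‖sgn (v j) - c * u j‖ ^ 2 ≤ 4 * ∑ j, ‖w j - c * u j‖ ^ 2 := by
      rw [Finset.mul_sum]
      refine Finset.sum_le_sum fun j _ => ?_
      have hcu : ‖c * u j‖ = 1 := by rw [norm_mul, hc, hu, one_mul]
      have h2 := norm_sgn_sub_sgn_le (w j) (c * u j)
      have h3 : sgn (w j) = sgn (v j) := sgn_real_mul hsd _
      rw [hcu, mul_one, sgn_of_norm_eq_one hcu, h3] at h2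
      have h4 := pow_le_pow_left₀ (norm_nonneg _) h2 2
      rw [mul_pow] at h4
      norm_num at h4
      exact h4
    have h5 : (κ : ℝ) ^ 5 * ∑ j, ‖sgn (v j) - c * u j‖ ^ 2 ≤
        κ ^ 5 * (4 * ∑ j, ‖w j - c * u j‖ ^ 2) := by gcongr
    linarith
  · refine ⟨1, by simp, ?_⟩
    have h1 : ∑ j, ‖sgn (v j) - 1 * u j‖ ^ 2 ≤ 4 * d := by
      have h2 : ∀ j, ‖sgn (v j) - 1 * u j‖ ^ 2 ≤ 4 := by
        intro j
        have h3 := norm_sub_le (sgn (v j)) (1 * u j)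
        rw [norm_sgn, one_mul, hu] at h3
        rw [one_mul]
        nlinarith [norm_nonneg (sgn (v j) - u j)]
      refine (Finset.sum_le_sum fun j _ => h2 j).trans (le_of_eq ?_)
      rw [Finset.sum_const, Finset.card_univ, ZMod.card, nsmul_eq_mul, mul_comm]
    calc (κ : ℝ) ^ 5 * ∑ j, ‖sgn (v j) - 1 * u j‖ ^ 2 ≤ (κ : ℝ) ^ 5 * (4 * d) := by gcongr
      _ = 4 * (κ : ℝ) ^ 4 * (d * κ) := by ring
      _ ≤ 4 * (d : ℝ) ^ 4 * phaseError κ T u := by gcongr; linarith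
      _ ≤ _ := by
        have : 0 ≤ (d : ℝ) ^ 4 * phaseError κ T u := by positivity
        linarith

end Synchronization

/-! ### Power iteration -/

section PowerIteration

variable {d : ℕ} [NeZero d] {κ : ℕ}

/-- The product of the relative phases along the path `0, 1, …, n`. -/
def pathPhase (T : Matrix (ZMod d) (ZMod d) ℂ) (n : ℕ) : ℂ :=
  ∏ i ∈ Finset.range n, T ((i + 1 : ℕ) : ZMod d) (i : ZMod d)

/-- The initial guess of the power iteration. -/
def phaseStart (T : Matrix (ZMod d) (ZMod d) ℂ) : ZMod d → ℂ := fun j => pathPhase T j.val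

/-- One step of the power iteration. The shift by the degree `2 κ - 1` of the band graph makes the
matrix positive semidefinite. -/
def powerStep (κ : ℕ) (T : Matrix (ZMod d) (ZMod d) ℂ) (w : ZMod d → ℂ) : ZMod d → ℂ :=
  T *ᵥ w + (2 * (κ : ℂ) - 1) • w

/-- The `t`-th iterate of the power iteration. -/
def powerIterate (κ : ℕ) (T : Matrix (ZMod d) (ZMod d) ℂ) (t : ℕ) : ZMod d → ℂ :=
  (powerStep κ T)^[t] (phaseStart T)

lemma norm_star_dotProduct_le (p q : ZMod d → ℂ) : ‖star p ⬝ᵥ q‖ ≤ l2norm p * l2norm q := by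
  have h := norm_inner_le_norm (𝕜 := ℂ) (WithLp.toLp 2 p) (WithLp.toLp 2 q)
  rw [EuclideanSpace.inner_eq_star_dotProduct, dotProduct_comm] at h
  exact h

lemma inBand_succ (hκ : 2 ≤ κ) (hκd : 2 * κ ≤ d) (i : ℕ) :
    InBand κ ((i + 1 : ℕ) : ZMod d) (i : ZMod d) := by
  rw [inBand_comm]
  have h := inBand_add hκd (i : ZMod d) (a := 1) (by rw [Finset.mem_Ioo]; omega)
  simpa using h

lemma norm_sub_le_of_phaseError {T : Matrix (ZMod d) (ZMod d) ℂ} {u : ZMod d → ℂ} {δ : ℝ}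
    (hδ0 : 0 ≤ δ) (hδ : phaseError κ T u ≤ δ ^ 2) {j k : ZMod d} (h : InBand κ j k) :
    ‖T j k - u j * (starRingEnd ℂ) (u k)‖ ≤ δ :=
  le_of_sq_le_sq ((le_bandSum (f := fun j k => ‖T j k - u j * (starRingEnd ℂ) (u k)‖ ^ 2)
    (fun _ _ => by positivity) h).trans hδ) hδ0

lemma IsPhaseMatrix.norm_pathPhase {T : Matrix (ZMod d) (ZMod d) ℂ} (hT : IsPhaseMatrix κ T)
    (hκ : 2 ≤ κ) (hκd : 2 * κ ≤ d) (n : ℕ) : ‖pathPhase T n‖ = 1 := by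
  rw [pathPhase, norm_prod]
  exact Finset.prod_eq_one fun i _ => hT.norm_eq_one _ _ (inBand_succ hκ hκd i)

lemma IsPhaseMatrix.norm_pathPhase_sub_le {T : Matrix (ZMod d) (ZMod d) ℂ}
    (hT : IsPhaseMatrix κ T) (hκ : 2 ≤ κ) (hκd : 2 * κ ≤ d) {u : ZMod d → ℂ}
    (hu : ∀ j, ‖u j‖ = 1) {δ : ℝ} (hδ0 : 0 ≤ δ) (hδ : phaseError κ T u ≤ δ ^ 2) (n : ℕ) :
    ‖pathPhase T n - u n * (starRingEnd ℂ) (u 0)‖ ≤ n * δ := by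
  have hu' : ∀ j, u j * (starRingEnd ℂ) (u j) = 1 := by
    intro j
    rw [Complex.mul_conj', hu]
    norm_num
  induction n with
  | zero => simp [pathPhase, hu']
  | succ n ih =>
    have h1 := norm_sub_le_of_phaseError hδ0 hδ (inBand_succ hκ hκd n)
    have h2 : pathPhase T (n + 1) - u ((n + 1 : ℕ) : ZMod d) * (starRingEnd ℂ) (u 0) =
        pathPhase T n * (T ((n + 1 : ℕ) : ZMod d) (n : ZMod d) -
          u ((n + 1 : ℕ) : ZMod d) * (starRingEnd ℂ) (u n)) +
        u ((n + 1 : ℕ) : ZMod d) * (starRingEnd ℂ) (u n) *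
          (pathPhase T n - u n * (starRingEnd ℂ) (u 0)) := by
      rw [pathPhase, Finset.prod_range_succ, ← pathPhase]
      linear_combination (u ((n + 1 : ℕ) : ZMod d) * (starRingEnd ℂ) (u 0)) * hu' n
    rw [h2]
    refine (norm_add_le _ _).trans ?_
    rw [norm_mul, norm_mul, norm_mul, hT.norm_pathPhase hκ hκd, RCLike.norm_conj, hu, hu,
      Nat.cast_succ (R := ℝ)]
    linarith

/-- The initial guess is close to `u`, up to a global phase. -/
lemma IsPhaseMatrix.l2norm_phaseStart_sub_le {T : Matrix (ZMod d) (ZMod d) ℂ}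
    (hT : IsPhaseMatrix κ T) (hκ : 2 ≤ κ) (hκd : 2 * κ ≤ d) {u : ZMod d → ℂ}
    (hu : ∀ j, ‖u j‖ = 1) {δ : ℝ} (hδ0 : 0 ≤ δ) (hδ : phaseError κ T u ≤ δ ^ 2) :
    l2norm (phaseStart T - (starRingEnd ℂ) (u 0) • u) ≤ d ^ 2 * δ := by
  have hd : (1 : ℝ) ≤ d := by exact_mod_cast Nat.pos_of_ne_zero (NeZero.ne d)
  refine l2norm_le_of_sq_le (by positivity) ?_
  have h1 : ∀ j, ‖(phaseStart T - (starRingEnd ℂ) (u 0) • u) j‖ ^ 2 ≤ (d * δ) ^ 2 := by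
    intro j
    have h2 := hT.norm_pathPhase_sub_le hκ hκd hu hδ0 hδ j.val
    rw [ZMod.natCast_zmod_val] at h2
    have h3 : (j.val : ℝ) * δ ≤ d * δ := by
      gcongr
      exact (ZMod.val_lt j).le
    have h4 : (phaseStart T - (starRingEnd ℂ) (u 0) • u) j =
        pathPhase T j.val - u j * (starRingEnd ℂ) (u 0) := by
      simp [phaseStart, mul_comm]
    rw [h4]
    exact pow_le_pow_left₀ (norm_nonneg _) (h2.trans h3) 2
  refine (Finset.sum_le_sum fun j _ => h1 j).trans ?_
  rw [Finset.sum_const, Finset.card_univ, ZMod.card, nsmul_eq_mul]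
  have h5 : (d : ℝ) * (d * δ) ^ 2 = d ^ 3 * δ ^ 2 := by ring
  have h6 : ((d : ℝ) ^ 2 * δ) ^ 2 = d ^ 4 * δ ^ 2 := by ring
  rw [h5, h6]
  gcongr
  norm_num

lemma star_dotProduct_powerIterate {T : Matrix (ZMod d) (ZMod d) ℂ} (hT : T.IsHermitian)
    {b : ZMod d → ℂ} {lam : ℝ} (hb : T *ᵥ b = (lam : ℂ) • b) (t : ℕ) :
    star b ⬝ᵥ powerIterate κ T t =
      ((lam + (2 * κ - 1) : ℝ) : ℂ) ^ t * (star b ⬝ᵥ phaseStart T) := by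
  induction t with
  | zero => simp [powerIterate]
  | succ t ih =>
    have h : powerIterate κ T (t + 1) = powerStep κ T (powerIterate κ T t) :=
      Function.iterate_succ_apply' _ _ _
    rw [h, powerStep, dotProduct_add, star_dotProduct_mulVec_of_isHermitian hT hb,
      dotProduct_smul, ih, smul_eq_mul]
    push_cast
    ring

/-- All eigenvalues of a phase matrix are at least `-(2 κ - 1)`. -/
lemma IsPhaseMatrix.neg_le_eigenvalue {T : Matrix (ZMod d) (ZMod d) ℂ} (hT : IsPhaseMatrix κ T)
    (hκ : 0 < κ) (hκd : 2 * κ ≤ d) {b : ZMod d → ℂ} (hb1 : ∑ j, ‖b j‖ ^ 2 = 1) {lam : ℝ}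
    (hb : T *ᵥ b = (lam : ℂ) • b) : 0 ≤ lam + (2 * κ - 1) := by
  have h := hT.energy_eq hκ hκd b (s := -1) (by norm_num)
  rw [hb, dotProduct_smul, star_dotProduct_self, hb1, smul_eq_mul, ← Complex.ofReal_mul,
    Complex.ofReal_re] at h
  have h0 : 0 ≤ bandSum κ fun j k => ‖b j - ((-1 : ℝ) : ℂ) * (T j k * b k)‖ ^ 2 :=
    bandSum_nonneg fun _ _ => by positivity
  linarith

/-- The spectral gap: an eigenvector that is almost orthogonal to `u` has an eigenvalue well below
the degree `2 κ - 1`. -/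
lemma IsPhaseMatrix.eigenvalue_le {T : Matrix (ZMod d) (ZMod d) ℂ} (hT : IsPhaseMatrix κ T)
    (hκ : 2 ≤ κ) (hκd : 2 * κ ≤ d) {u : ZMod d → ℂ} (hu : ∀ j, ‖u j‖ = 1) {b : ZMod d → ℂ}
    (hb1 : ∑ j, ‖b j‖ ^ 2 = 1) {lam : ℝ} (hb : T *ᵥ b = (lam : ℂ) • b)
    (hub : ‖star u ⬝ᵥ b‖ ≤ 1 / 2) :
    3 / 4 ≤ 36 * (d : ℝ) ^ 3 * (4 * ((2 * κ - 1) - lam) + 2 * phaseError κ T u) := by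
  have hd : (1 : ℝ) ≤ d := by exact_mod_cast Nat.pos_of_ne_zero (NeZero.ne d)
  have hκ1 : (1 : ℝ) ≤ κ := by exact_mod_cast (by omega : 1 ≤ κ)
  have h1 := hT.energy_eq' (by omega) hκd b
  rw [hb, dotProduct_smul, star_dotProduct_self, hb1, smul_eq_mul, ← Complex.ofReal_mul,
    Complex.ofReal_re] at h1
  have h2 := energy_le (κ := κ) (T := T) hu b (B := 1) fun k => by
    rw [← hb1]
    exact Finset.single_le_sum (f := fun j => ‖b j‖ ^ 2) (fun _ _ => by positivity)
      (Finset.mem_univ k)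
  have h3 := poincare (fun j => (starRingEnd ℂ) (u j) * b j) hκ hκd
  rw [sum_norm_sq_conj_mul hu, hb1] at h3
  have h4 : ∑ j, (starRingEnd ℂ) (u j) * b j = star u ⬝ᵥ b := rfl
  rw [h4] at h3
  have h5 : ‖star u ⬝ᵥ b‖ ^ 2 ≤ 1 / 4 := by nlinarith [norm_nonneg (star u ⬝ᵥ b)]
  have h6 : (1 : ℝ) ≤ (κ : ℝ) ^ 3 := one_le_pow₀ hκ1
  set E := bandSum κ fun j k =>
    ‖(starRingEnd ℂ) (u j) * b j - (starRingEnd ℂ) (u k) * b k‖ ^ 2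
  have h7 : 3 / 4 ≤ (κ : ℝ) ^ 3 * (d * 1 - ‖star u ⬝ᵥ b‖ ^ 2) := by nlinarith
  calc (3 / 4 : ℝ) ≤ 36 * d ^ 3 * E := h7.trans h3
    _ ≤ _ := by
      gcongr
      linarith

/-- Bernoulli's inequality for the ratio of two eigenvalues with gap `h`. -/
lemma pow_mul_le_of_add_le {β h Λ D : ℝ} (hβ : 0 < β) (hh : 0 ≤ h) (hβD : β ≤ 2 * D)
    (hΛ : β + h ≤ Λ) (t : ℕ) : β ^ t * (t * h) ≤ 2 * D * Λ ^ t := by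
  have h1 := one_add_mul_le_pow (a := h / β) (le_trans (by norm_num) (by positivity : 0 ≤ h / β)) t
  have h2 : β ^ t * (1 + h / β) ^ t = (β + h) ^ t := by
    rw [← mul_pow]
    congr 1
    field_simp
  have h3 : (β + h) ^ t ≤ Λ ^ t := pow_le_pow_left₀ (by positivity) hΛ t
  have h4 : β ^ t * (t * (h / β)) ≤ Λ ^ t := by
    refine le_trans ?_ (h2.le.trans h3)
    gcongr
    linarith
  have h5 : 0 ≤ Λ ^ t := le_trans (by positivity) h4
  calc β ^ t * (t * h) = β * (β ^ t * (t * (h / β))) := by field_simp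
    _ ≤ β * Λ ^ t := by gcongr
    _ ≤ _ := by gcongr

lemma l2norm_phase_sub_sgn_le (z : ZMod d → ℂ) {b : ZMod d → ℂ} {m : ℝ} (hm : 0 < m)
    (hb : ∀ j, m ≤ ‖b j‖) :
    l2norm (fun j => z j / (‖z j‖ : ℂ) - sgn (b j)) ≤ 2 / m * l2norm (z - b) := by
  refine l2norm_le_of_sq_le (mul_nonneg (by positivity) (l2norm_nonneg _)) ?_
  rw [mul_pow, l2norm_sq, Finset.mul_sum]
  refine Finset.sum_le_sum fun j _ => ?_
  rw [← mul_pow]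
  refine pow_le_pow_left₀ (norm_nonneg _) ?_ 2
  have h1 := norm_phase_sub_sgn_le (s := z j / (‖z j‖ : ℂ)) (a := z j) (b := b j) (by
      rw [norm_div, Complex.norm_real, norm_norm]
      exact div_self_le_one _) (by
      rcases eq_or_ne (z j) 0 with h0 | h0
      · simp [h0]
      · have : (‖z j‖ : ℂ) ≠ 0 := by simpa using h0
        field_simp)
  have h2 : ‖z j / (‖z j‖ : ℂ) - sgn (b j)‖ * m ≤ 2 * ‖z j - b j‖ :=
    le_trans (mul_le_mul_of_nonneg_left (hb j) (norm_nonneg _)) h1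
  rw [Pi.sub_apply, div_mul_eq_mul_div, le_div_iff₀ hm]
  exact h2

set_option maxHeartbeats 1000000 in
/-- The power iteration, started at the path phases, converges to the phases of a leading
eigenvector. The ratio of the two largest eigenvalues depends on `d`, but a small phase error `δ`
makes up for this: the error after `t` steps is at most `δ / t`, up to a power of `d`. -/
lemma IsPhaseMatrix.exists_l2norm_powerIterate_le {T : Matrix (ZMod d) (ZMod d) ℂ}
    (hT : IsPhaseMatrix κ T) (hκ : 2 ≤ κ) (hκd : 2 * κ ≤ d) {u : ZMod d → ℂ}
    (hu : ∀ j, ‖u j‖ = 1) {δ : ℝ} (hδ0 : 0 ≤ δ) (hδ : phaseError κ T u ≤ δ ^ 2)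
    (hδ1 : 100 * d ^ 2 * δ ≤ 1) {t : ℕ} (ht : 0 < t) :
    ∃ v, IsLeadingEigenvector T v ∧
      l2norm (fun j => powerIterate κ T t j / (‖powerIterate κ T t j‖ : ℂ) - sgn (v j)) ≤
        236800 * d ^ 7 * δ / t := by
  have hd : (1 : ℝ) ≤ d := by exact_mod_cast Nat.pos_of_ne_zero (NeZero.ne d)
  have hd0 : (0 : ℝ) < d := by linarith
  have hκ0 : (2 : ℝ) ≤ κ := by exact_mod_cast hκ
  have hκd' : 2 * (κ : ℝ) ≤ d := by exact_mod_cast hκd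
  have ht0 : (0 : ℝ) < t := Nat.cast_pos.2 ht
  obtain ⟨b, lam, hb⟩ := exists_isEigenbasis hT.isHermitian
  obtain ⟨o, ho⟩ := Finite.exists_max lam
  set D : ℝ := 2 * κ - 1 with hD
  set r := Real.sqrt d with hr
  have hr1 : 1 ≤ r := Real.one_le_sqrt.2 hd
  have hr2 : r ^ 2 = d := Real.sq_sqrt hd0.le
  have hrd : r ≤ d := by nlinarith
  have hd2 : (1 : ℝ) ≤ (d : ℝ) ^ 2 := one_le_pow₀ hd
  have hδd : d ^ 2 * δ ≤ 1 / 100 := by linarith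
  have hδ2 : δ ≤ 1 / 100 := by nlinarith
  -- the leading eigenvector, scaled to norm `√d`
  set w : ZMod d → ℂ := (r : ℂ) • b o with hwdef
  have hl2b : ∀ i, l2norm (b i) = 1 := by
    intro i
    have := hb.norm_sq i
    rw [← l2norm_sq] at this
    nlinarith [l2norm_nonneg (b i)]
  have hw : ∑ j, ‖w j‖ ^ 2 = d := by
    rw [← l2norm_sq, hwdef, l2norm_smul, hl2b, mul_one, Complex.norm_real, Real.norm_eq_abs,
      sq_abs, hr2]
  have hlamw : T *ᵥ w = (lam o : ℂ) • w := by
    rw [hwdef, mulVec_smul, hb.mulVec, smul_comm]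
  have hsmall : phaseError κ T u ≤ d * κ := by nlinarith
  obtain ⟨c, hc, hcw⟩ := hT.exists_phase_eigenvector hκ hκd hu hw hlamw (hb.rayleigh_le ho) hsmall
  have hwc : l2norm (w - c • u) ≤ 36 * d ^ 2 * δ := by
    refine l2norm_le_of_sq_le (by positivity) ?_
    have h1 : (1 : ℝ) ≤ (κ : ℝ) ^ 5 := one_le_pow₀ (by linarith)
    have h2 : 0 ≤ ∑ j, ‖w j - c * u j‖ ^ 2 := Finset.sum_nonneg fun _ _ => by positivity
    calc ∑ j, ‖(w - c • u) j‖ ^ 2 = 1 * ∑ j, ‖w j - c * u j‖ ^ 2 := by simp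
      _ ≤ κ ^ 5 * ∑ j, ‖w j - c * u j‖ ^ 2 := by gcongr
      _ ≤ 1296 * d ^ 4 * δ ^ 2 := hcw.trans (by gcongr)
      _ = _ := by ring
  -- the initial guess is close to a multiple of `w`
  set s := phaseStart T with hsdef
  set γ : ℂ := (starRingEnd ℂ) (u 0) * (starRingEnd ℂ) c with hγ
  have hγ1 : ‖γ‖ = 1 := by rw [hγ, norm_mul, RCLike.norm_conj, RCLike.norm_conj, hu, hc, one_mul]
  have hsγ : l2norm (s - γ • w) ≤ 37 * d ^ 2 * δ := by
    have hcc : (starRingEnd ℂ) c * c = 1 := by rw [Complex.conj_mul', hc]; norm_num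
    have h1 : s - γ • w = (s - (starRingEnd ℂ) (u 0) • u) + (-γ) • (w - c • u) := by
      funext j
      simp only [Pi.sub_apply, Pi.add_apply, Pi.smul_apply, smul_eq_mul, hγ]
      linear_combination (-(starRingEnd ℂ) (u 0) * u j) * hcc
    have h2 := hT.l2norm_phaseStart_sub_le hκ hκd hu hδ0 hδ
    rw [h1]
    refine (l2norm_add_le _ _).trans ?_
    rw [l2norm_smul, norm_neg, hγ1, one_mul]
    linarith
  have hparse : ∑ i, ‖star (b i) ⬝ᵥ (s - γ • w)‖ ^ 2 ≤ (37 * d ^ 2 * δ) ^ 2 := by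
    rw [hb.parseval, ← l2norm_sq]
    exact pow_le_pow_left₀ (l2norm_nonneg _) hsγ 2
  set α := star (b o) ⬝ᵥ s with hα
  have hα1 : 1 / 2 ≤ ‖α‖ := by
    have h1 : star (b o) ⬝ᵥ (s - γ • w) = α - γ * r := by
      rw [dotProduct_sub, dotProduct_smul, hwdef, dotProduct_smul, star_dotProduct_self,
        hb.norm_sq, ← hα]
      simp
    have h2 : ‖α - γ * r‖ ≤ 37 * d ^ 2 * δ := by
      rw [← h1]
      refine (norm_star_dotProduct_le _ _).trans ?_
      rw [hl2b, one_mul]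
      exact hsγ
    have h3 : ‖γ * (r : ℂ)‖ = r := by
      rw [norm_mul, hγ1, one_mul, Complex.norm_real, Real.norm_of_nonneg (by linarith)]
    have h4 := norm_sub_norm_le (γ * (r : ℂ)) α
    rw [norm_sub_rev, h3] at h4
    linarith
  have hbo : ∀ j, 1 / (2 * d) ≤ ‖b o j‖ := by
    intro j
    have h1 := (norm_apply_le_l2norm (w - c • u) j).trans hwc
    have h2 := norm_sub_norm_le (c * u j) (w j)
    have h3 : ‖c * u j - w j‖ = ‖(w - c • u) j‖ := by rw [norm_sub_rev]; rfl
    rw [h3, norm_mul, hc, hu, one_mul] at h2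
    have h4 : ‖w j‖ = r * ‖b o j‖ := by
      rw [hwdef, Pi.smul_apply, smul_eq_mul, norm_mul, Complex.norm_real,
        Real.norm_of_nonneg (by linarith)]
    have h5 : 1 / 2 ≤ d * ‖b o j‖ := by
      have : r * ‖b o j‖ ≤ d * ‖b o j‖ := by gcongr
      linarith
    rw [div_le_iff₀ (by positivity)]
    linarith
  -- the spectral gap
  set h : ℝ := 1 / (400 * d ^ 3) with hh
  have hh0 : 0 < h := by positivity
  have hhd : h * d ^ 3 = 1 / 400 := by rw [hh]; field_simp
  set β : ℝ := 2 * D - 2 * h with hβ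
  have hδh : δ ^ 2 ≤ h / 25 := by
    have h1 : (d : ℝ) ^ 3 * δ ^ 2 ≤ 1 / 10000 := by
      have h2 : (d : ℝ) ^ 3 * δ ^ 2 ≤ d ^ 4 * δ ^ 2 := by
        gcongr
        norm_num
      have h3 : (d : ℝ) ^ 4 * δ ^ 2 = (d ^ 2 * δ) ^ 2 := by ring
      have h4 : (d ^ 2 * δ) ^ 2 ≤ (1 / 100) ^ 2 := pow_le_pow_left₀ (by positivity) hδd 2
      linarith
    have h5 : (d : ℝ) ^ 3 * δ ^ 2 ≤ d ^ 3 * (h / 25) := by linarith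
    exact le_of_mul_le_mul_left h5 (by positivity)
  have hgap : ∀ i, i ≠ o → lam i + D ≤ β := by
    intro i hi
    have h1 : ‖star u ⬝ᵥ b i‖ ≤ 1 / 2 := by
      have h2 : star (c • u) ⬝ᵥ b i = -(star (w - c • u) ⬝ᵥ b i) := by
        rw [star_sub, sub_dotProduct, hwdef, star_smul (r : ℂ), smul_dotProduct,
          hb.orthogonal o i hi.symm]
        simp
      have h3 : ‖star (c • u) ⬝ᵥ b i‖ = ‖star u ⬝ᵥ b i‖ := by
        rw [star_smul, smul_dotProduct, norm_smul, norm_star, hc, one_mul]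
      rw [← h3, h2, norm_neg]
      refine (norm_star_dotProduct_le _ _).trans ?_
      rw [hl2b, mul_one]
      linarith
    have h4 := hT.eigenvalue_le hκ hκd hu (hb.norm_sq i) (hb.mulVec i) h1
    rw [← hD] at h4
    by_contra! h5
    have h6 : 4 * (D - lam i) + 2 * phaseError κ T u ≤ (8 + 2 / 25) * h := by linarith
    have h7 : 36 * (d : ℝ) ^ 3 * (4 * (D - lam i) + 2 * phaseError κ T u) ≤
        36 * d ^ 3 * ((8 + 2 / 25) * h) := by gcongr
    have h8 : 36 * (d : ℝ) ^ 3 * ((8 + 2 / 25) * h) = 36 * (8 + 2 / 25) * (1 / 400) := by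
      rw [← hhd]
      ring
    rw [h8] at h7
    norm_num at h7
    linarith
  have hlead : β + h ≤ lam o + D := by
    have h1 := hT.rayleigh_of_unimodular (by omega) hκd hu
    have h2 := hb.rayleigh_le ho u
    simp only [hu, one_pow, Finset.sum_const, Finset.card_univ, ZMod.card, nsmul_eq_mul,
      mul_one] at h2
    rw [← hD] at h1
    have h3 : d * (D - lam o) ≤ d * h := by
      have : h ≤ d * h := by nlinarith
      nlinarith
    have h4 := le_of_mul_le_mul_left h3 hd0
    linarith
  have hh1 : h ≤ 1 := by
    rw [hh, div_le_one (by positivity)]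
    have : (1 : ℝ) ≤ (d : ℝ) ^ 3 := one_le_pow₀ hd
    linarith
  have hβ0 : 0 < β := by linarith
  have hβd : β ≤ 2 * d := by linarith
  have hΛ0 : 0 < lam o + D := by linarith
  -- Bernoulli's inequality bounds the damping of the other eigenvectors
  have hdamp : β ^ t * t ≤ 800 * d ^ 4 * (lam o + D) ^ t := by
    have h1 := pow_mul_le_of_add_le hβ0 hh0.le hβd hlead t
    have h2 : β ^ t * t = 400 * d ^ 3 * (β ^ t * (t * h)) := by
      rw [hh]
      field_simp
    rw [h2]
    calc 400 * (d : ℝ) ^ 3 * (β ^ t * (t * h)) ≤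
        400 * d ^ 3 * (2 * d * (lam o + D) ^ t) := by gcongr
      _ = _ := by ring
  -- the deviation of the iterate from the leading eigenvector
  set z := powerIterate κ T t with hz
  set Λ : ℂ := ((lam o + D : ℝ) : ℂ) ^ t with hΛ
  set y := z - (Λ * α) • b o with hy
  have hyl : l2norm y ≤ β ^ t * (37 * d ^ 2 * δ) := by
    refine l2norm_le_of_sq_le (by positivity) ?_
    rw [← hb.parseval, mul_pow]
    have h1 : ∀ i, ‖star (b i) ⬝ᵥ y‖ ^ 2 ≤
        (β ^ t) ^ 2 * ‖star (b i) ⬝ᵥ (s - γ • w)‖ ^ 2 := by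
      intro i
      rw [hy, dotProduct_sub, dotProduct_smul, hz,
        star_dotProduct_powerIterate hT.isHermitian (hb.mulVec i), ← hD, ← hsdef]
      rcases eq_or_ne i o with rfl | hi
      · rw [star_dotProduct_self, hb.norm_sq, ← hα, ← hΛ]
        simp only [Complex.ofReal_one, smul_eq_mul, mul_one, sub_self, norm_zero,
          zero_pow two_ne_zero]
        positivity
      · have h2 : star (b i) ⬝ᵥ (s - γ • w) = star (b i) ⬝ᵥ s := by
          rw [dotProduct_sub, dotProduct_smul, hwdef, dotProduct_smul, hb.orthogonal i o hi]
          simp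
        rw [hb.orthogonal i o hi, h2, smul_zero, sub_zero, norm_mul, mul_pow, norm_pow,
          Complex.norm_real, Real.norm_of_nonneg
            (hT.neg_le_eigenvalue (by omega) hκd (hb.norm_sq i) (hb.mulVec i))]
        have h3 := hT.neg_le_eigenvalue (by omega) hκd (hb.norm_sq i) (hb.mulVec i)
        rw [← hD] at h3
        have h4 := hgap i hi
        gcongr
    refine (Finset.sum_le_sum fun i _ => h1 i).trans ?_
    rw [← Finset.mul_sum]
    gcongr
  have hΛn : ‖Λ‖ = (lam o + D) ^ t := by
    rw [hΛ, norm_pow, Complex.norm_real, Real.norm_of_nonneg hΛ0.le]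
  have hα0 : α ≠ 0 := norm_pos_iff.1 (by linarith)
  refine ⟨sgn α • b o, isLeadingEigenvector_of_rayleigh_le (lam := lam o) ?_ ?_
    (hb.rayleigh_le ho), ?_⟩
  · rw [← l2norm_sq, l2norm_smul, norm_sgn, hl2b]
    norm_num
  · rw [mulVec_smul, hb.mulVec, smul_comm]
  · have h1 : ∀ j, sgn ((sgn α • b o) j) = sgn (((Λ * α) • b o) j) := by
      intro j
      have h2 : ((Λ * α) • b o) j = (((lam o + D) ^ t * ‖α‖ : ℝ) : ℂ) * (sgn α • b o) j := by
        simp only [Pi.smul_apply, smul_eq_mul, hΛ]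
        push_cast
        linear_combination (-((lam o + D : ℂ)) ^ t * b o j) * norm_mul_sgn α
      rw [h2, sgn_real_mul (by positivity)]
    have h3 : ∀ j, (lam o + D) ^ t * (1 / 2) * (1 / (2 * d)) ≤ ‖((Λ * α) • b o) j‖ := by
      intro j
      rw [Pi.smul_apply, smul_eq_mul, norm_mul, norm_mul, hΛn]
      gcongr
      exact hbo j
    simp only [h1]
    refine (l2norm_phase_sub_sgn_le z (by positivity) h3).trans ?_
    rw [← hy]
    calc 2 / ((lam o + D) ^ t * (1 / 2) * (1 / (2 * d))) * l2norm y ≤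
        2 / ((lam o + D) ^ t * (1 / 2) * (1 / (2 * d))) * (β ^ t * (37 * d ^ 2 * δ)) := by gcongr
      _ = 296 * d ^ 3 * δ * (β ^ t * t) / ((lam o + D) ^ t * t) := by
        field_simp
        ring
      _ ≤ 296 * d ^ 3 * δ * (800 * d ^ 4 * (lam o + D) ^ t) / ((lam o + D) ^ t * t) := by gcongr
      _ = _ := by
        field_simp
        ring

end PowerIteration

/-! ### The program and its flop count -/

section Algorithm

/-- The data of the algorithm: the measurement matrix and the mask. -/
abbrev Data (d L : ℕ) : Type := Matrix (ZMod d) (ZMod L) ℝ × (ZMod d → ℂ)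

/-- The data as the input vector of a recovery program. -/
def encode {d L : ℕ} (u : Data d L) : (ZMod d × ZMod L) ⊕ ZMod d → ℂ :=
  Sum.elim (fun p => (u.1 p.1 p.2 : ℂ)) u.2

/-- The entrywise phases of a matrix inside the band. In contrast to `normalizeBand`, the phase
of `0` is `0`, so that no case distinction is needed to compute it. -/
def bandPhase {d : ℕ} (κ : ℕ) (M : Matrix (ZMod d) (ZMod d) ℂ) : Matrix (ZMod d) (ZMod d) ℂ :=
  fun j k => if InBand κ j k then M j k / (‖M j k‖ : ℂ) else 0

variable {d L κ : ℕ}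

lemma dftCost_le {n : ℕ} (hn : 0 < n) (hnd : n ≤ d) (hd : 4 ≤ d) :
    dftCost n ≤ 63 * n * Nat.log 2 d := by
  set ℓ := Nat.log 2 d with hℓ
  have hℓ2 : 2 ≤ ℓ := by
    exact Nat.le_log_of_pow_le (by norm_num) (by omega)
  set t := Nat.clog 2 (2 * n) with ht
  have h1 : t ≤ ℓ + 2 := by
    refine Nat.clog_le_of_le_pow ?_
    have h2 := Nat.lt_pow_succ_log_self (b := 2) (by norm_num) d
    rw [← hℓ] at h2
    have h3 : 2 ^ (ℓ + 2) = 2 * 2 ^ ℓ.succ := by rw [Nat.succ_eq_add_one, pow_succ, pow_succ]; ring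
    omega
  have h4 : 2 ^ t ≤ 4 * n := by
    have h5 := Nat.pow_pred_clog_lt_self (b := 2) (by norm_num) (x := 2 * n) (by omega)
    rw [← ht] at h5
    have h6 : 0 < t := Nat.clog_pos (by norm_num) (by omega)
    obtain ⟨s, hs⟩ : ∃ s, t = s + 1 := ⟨t - 1, by omega⟩
    rw [hs, Nat.pred_succ] at h5
    rw [hs, pow_succ]
    omega
  simp only [dftCost, ← ht]
  calc 6 * t * 2 ^ t + 2 * 2 ^ t + 5 * n + 2 ≤
      6 * (ℓ + 2) * (4 * n) + 2 * (4 * n) + 5 * n + 2 := by gcongr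
    _ = 24 * (ℓ * n) + 61 * n + 2 := by ring
    _ ≤ 24 * (ℓ * n) + 63 * n := by omega
    _ ≤ 63 * n * ℓ := by nlinarith

lemma flops_le {ρ t : ℕ} (hρ : 2 * ρ < d) (hκ : 2 ≤ κ) (hκρ : κ ≤ ρ) (hL : L = ρ + κ - 1) :
    2 * dftCost d + d * dftCost L + 2 * κ * (3 * dftCost d + 17 * d) + d * L + 10 * d + 1 +
      t * (d * (4 * κ + 4)) ≤ 1000 * (1 + t) * (d * (ρ + κ ^ 2) * Nat.log 2 d) := by
  have h1 := dftCost_le (d := d) (n := d) (by omega) le_rfl (by omega)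
  have h2 := dftCost_le (d := d) (n := L) (by omega) (by omega) (by omega)
  set ℓ := Nat.log 2 d with hℓ
  have hℓ1 : 1 ≤ ℓ := Nat.log_pos (by norm_num) (by omega)
  have hL2 : L ≤ 2 * ρ := by omega
  have hκ2 : 2 * κ ≤ κ ^ 2 := by nlinarith
  set R := ρ + κ ^ 2 with hR
  have hRℓ : R ≤ R * ℓ := Nat.le_mul_of_pos_right _ hℓ1
  have h3 : κ ≤ R := by nlinarith
  have h4 : 1 ≤ R := by omega
  calc _ ≤ 2 * (63 * d * ℓ) + d * (63 * L * ℓ) + 2 * κ * (3 * (63 * d * ℓ) + 17 * d) + d * L +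
        10 * d + d + t * (d * (4 * κ + 4)) := by
        gcongr
        omega
    _ ≤ 2 * (63 * d * ℓ) + d * (63 * (2 * ρ) * ℓ) + κ ^ 2 * (3 * (63 * d * ℓ) + 17 * d) +
        d * (2 * ρ) + 10 * d + d + t * (d * (4 * R + 4 * R)) := by
        gcongr
        omega
    _ = d * (126 * ℓ + 126 * (ρ * ℓ) + 189 * (κ ^ 2 * ℓ) + 17 * κ ^ 2 + 2 * ρ + 11) +
        d * (8 * (t * R)) := by ring
    _ ≤ d * (1000 * (R * ℓ)) + d * (1000 * (t * (R * ℓ))) := by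
        have h5 : ρ ≤ ρ * ℓ := Nat.le_mul_of_pos_right _ hℓ1
        have h6 : κ ^ 2 ≤ κ ^ 2 * ℓ := Nat.le_mul_of_pos_right _ hℓ1
        have h7 : ℓ ≤ R * ℓ := Nat.le_mul_of_pos_left _ h4
        have h8 : R * ℓ = ρ * ℓ + κ ^ 2 * ℓ := by rw [hR]; ring
        have h9 : t * R ≤ t * (R * ℓ) := Nat.mul_le_mul_left t hRℓ
        gcongr
        · omega
        · omega
    _ = _ := by ring

lemma card_Ioo_le (κ : ℕ) : (Finset.Ioo (-(κ : ℤ)) κ).card ≤ 2 * κ := by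
  rw [Int.card_Ioo]
  omega

variable [NeZero d]

/-- The entries in the band of a matrix that depends on the data. -/
def entryFns (κ : ℕ) (T : Data d L → Matrix (ZMod d) (ZMod d) ℂ) : Set (Data d L → ℂ) :=
  {f | ∃ j k, InBand κ j k ∧ f = fun u => T u j k}

lemma computes_entryFns {S : Set (Data d L → ℂ)} {T : Data d L → Matrix (ZMod d) (ZMod d) ℂ}
    {c : ℕ} (hκ : 2 * κ ≤ d)
    (h : ∀ j k, InBand κ j k → Computes encode S {fun u => T u j k} c) :
    Computes encode S (entryFns κ T) (2 * κ * (d * c)) := by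
  refine (Computes.biUnion (Finset.Ioo (-(κ : ℤ)) κ) (c := d * c)
    (T := fun a => ⋃ j : ZMod d, {fun u => T u j (j + (a : ZMod d))}) fun a ha => ?_).mono
    subset_rfl ?_ (Nat.mul_le_mul_right _ (card_Ioo_le κ))
  · exact (Computes.iUnion fun j => h _ _ (inBand_add hκ j ha)).mono subset_rfl subset_rfl
      (by simp [ZMod.card])
  · rintro _ ⟨j, k, hb, rfl⟩
    simp only [Set.mem_iUnion]
    exact ⟨offset j k, offset_mem hb, j, by rw [add_offset]; rfl⟩

lemma computes_bandPhase (hκ : 2 * κ ≤ d) (M : Data d L → Matrix (ZMod d) (ZMod d) ℂ) :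
    Computes encode (entryFns κ M) (entryFns κ fun u => bandPhase κ (M u))
      (2 * κ * (d * 4)) := by
  refine computes_entryFns hκ fun j k hb => ?_
  simp only [bandPhase, hb, if_true]
  exact Computes.phase ⟨j, k, hb, rfl⟩

lemma computes_phaseStart (hκ : 2 ≤ κ) (hκd : 2 * κ ≤ d)
    (T : Data d L → Matrix (ZMod d) (ZMod d) ℂ) :
    Computes encode (entryFns κ T) (Set.range fun j u => phaseStart (T u) j) (d + 1) := by
  have h : ∀ n, Computes encode (entryFns κ T)
      (⋃ i ∈ Finset.range (n + 1), {fun u => pathPhase (T u) i}) (n + 1) := by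
    intro n
    induction n with
    | zero => simpa [pathPhase] using Computes.const (e := encode) (S := entryFns κ T) 1
    | succ n ih =>
      rw [Finset.range_add_one, Finset.set_biUnion_insert, Set.union_comm]
      refine ih.trans_union ?_
      simp only [pathPhase, Finset.prod_range_succ _ n]
      refine (Computes.mul (a := 0) (b := 0) (Computes.of_mem ?_) (Computes.of_mem ?_)).mono
        subset_rfl subset_rfl (by norm_num)
      · right
        simp only [Set.mem_iUnion]
        exact ⟨n, Finset.self_mem_range_succ n, rfl⟩
      · exact Or.inl ⟨_, _, inBand_succ hκ hκd n, rfl⟩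
  refine (h d).mono subset_rfl ?_ le_rfl
  rintro _ ⟨j, rfl⟩
  simp only [Set.mem_iUnion]
  exact ⟨j.val, Finset.mem_range.2 ((ZMod.val_lt j).trans (Nat.lt_succ_self d)), rfl⟩

lemma computes_powerIterate (hκ : 2 ≤ κ) (hκd : 2 * κ ≤ d)
    {T : Data d L → Matrix (ZMod d) (ZMod d) ℂ} (hT : ∀ u j k, ¬ InBand κ j k → T u j k = 0)
    (t : ℕ) :
    Computes encode (entryFns κ T) (Set.range fun j u => powerIterate κ (T u) t j)
      (d + 1 + t * (d * (4 * κ + 4))) := by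
  induction t with
  | zero => exact (computes_phaseStart hκ hκd T).mono subset_rfl subset_rfl (by omega)
  | succ t ih =>
    have h1 := ih.trans (R := Set.range fun j u => powerIterate κ (T u) (t + 1) j)
      (b := d * (4 * κ + 4)) (by
        refine (Computes.family (c := 4 * κ + 4) fun j => ?_).mono subset_rfl subset_rfl
          (by simp [ZMod.card])
        have h2 : ∀ u, powerIterate κ (T u) (t + 1) j =
            ∑ a ∈ Finset.Ioo (-(κ : ℤ)) κ, T u j (j + (a : ZMod d)) *
              powerIterate κ (T u) t (j + (a : ZMod d)) +
            (2 * (κ : ℂ) - 1) * powerIterate κ (T u) t j := by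
          intro u
          have h3 : powerIterate κ (T u) (t + 1) = powerStep κ (T u) (powerIterate κ (T u) t) :=
            Function.iterate_succ_apply' _ _ _
          rw [h3, powerStep, Pi.add_apply, Pi.smul_apply, smul_eq_mul, mulVec, dotProduct,
            ← sum_inBand hκd j fun k => T u j k * powerIterate κ (T u) t k]
          congr 1
          refine Finset.sum_congr rfl fun k _ => ?_
          split_ifs with hb
          · rfl
          · rw [hT u j k hb, zero_mul]
        simp only [h2]
        refine ((Computes.sum (c := 1) (Finset.Ioo (-(κ : ℤ)) κ) fun a ha => ?_).add
          ((Computes.const _).mul (Computes.of_mem (Or.inr ⟨j, rfl⟩)))).mono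
          subset_rfl subset_rfl ?_
        · exact (Computes.of_mem (Or.inl ⟨_, _, inBand_add hκd j ha, rfl⟩)).mul
            (Computes.of_mem (Or.inr ⟨_, rfl⟩))
        · have := card_Ioo_le κ
          linarith)
    refine h1.mono subset_rfl subset_rfl ?_
    linarith

variable [NeZero L]

/-- The vector that is returned after `t` steps of the power iteration. -/
def approxOutput (κ t : ℕ) (u : Data d L) : ZMod d → ℂ :=
  ZMod.dft.symm fun j => (Real.sqrt (lifted κ u.2 u.1 j j).re : ℂ) *
    (powerIterate κ (bandPhase κ (lifted κ u.2 u.1)) t j /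
      (‖powerIterate κ (bandPhase κ (lifted κ u.2 u.1)) t j‖ : ℂ))

/-- The entries of the bands `|a| < κ`, as functions of the data. -/
def bandFns (d L κ : ℕ) [NeZero d] [NeZero L] : Set (Data d L → ℂ) :=
  {f | ∃ a ∈ Finset.Ioo (-(κ : ℤ)) κ, ∃ j, f = fun u => band u.2 u.1 a j}

/-- The deconvolution of one band. -/
lemma computes_band {S : Set (Data d L → ℂ)} (a : ℤ)
    (hm : ∀ j, (fun u : Data d L => ZMod.dft u.2 j) ∈ S)
    (hY : ∀ (k : ZMod d) (b : ZMod L),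
      (fun u : Data d L => ZMod.dft (fun l => (u.1 k l : ℂ)) b) ∈ S) :
    Computes encode S (Set.range fun j (u : Data d L) => band u.2 u.1 a j)
      (3 * dftCost d + 9 * d) := by
  have h1 : Computes encode S
      (Set.range fun j (u : Data d L) => autocorr (ZMod.dft u.2) (-a) j) (d * 2) := by
    refine (Computes.family (c := 2) fun j => ?_).mono subset_rfl subset_rfl (by simp [ZMod.card])
    exact (Computes.of_mem (hm j)).mul (Computes.of_mem (hm _)).conj
  have h2 := h1.comp (computes_dft (e := encode) subset_rfl)
  have h3 : Computes encode S (Set.range fun w (u : Data d L) =>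
      doubleDFT u.1 w ((-a : ℤ) : ZMod L)) (dftCost d) := by
    refine computes_dft (F := fun k (u : Data d L) =>
      ZMod.dft (fun l => (u.1 k l : ℂ)) ((-a : ℤ) : ZMod L)) ?_
    rintro _ ⟨k, rfl⟩
    exact hY k _
  have h4 := (h2.union h3).comp
    (R := Set.range fun w (u : Data d L) => bandFourier u.2 u.1 a w) (b := d * 5) (by
      refine (Computes.family (c := 5) fun w => ?_).mono subset_rfl subset_rfl
        (by simp [ZMod.card])
      exact ((Computes.const _).mul (Computes.of_mem (Or.inr ⟨w, rfl⟩))).div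
        ((Computes.const _).mul (Computes.of_mem (Or.inl ⟨w, rfl⟩))))
  refine (h4.comp (computes_dft_symm (e := encode) subset_rfl)).mono subset_rfl subset_rfl ?_
  linarith

lemma computes_bandFns (d L κ : ℕ) [NeZero d] [NeZero L] :
    Computes encode ∅ (bandFns d L κ)
      (d * L + d + dftCost d + d * dftCost L + 2 * κ * (3 * dftCost d + 9 * d)) := by
  have h1 : Computes encode ∅ (Set.range fun i (u : Data d L) => encode u i) (d * L + d) := by
    refine (Computes.family (c := 1) fun i => Computes.input i).mono subset_rfl subset_rfl ?_
    simp [ZMod.card]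
  have h2 : Computes encode (Set.range fun i (u : Data d L) => encode u i)
      (Set.range fun k (u : Data d L) => ZMod.dft u.2 k) (dftCost d) := by
    refine computes_dft (F := fun j (u : Data d L) => u.2 j) ?_
    rintro _ ⟨j, rfl⟩
    exact ⟨Sum.inr j, rfl⟩
  have h3 : Computes encode (Set.range fun i (u : Data d L) => encode u i)
      (⋃ k, Set.range fun b (u : Data d L) => ZMod.dft (fun l => (u.1 k l : ℂ)) b)
      (d * dftCost L) := by
    refine (Computes.iUnion (c := dftCost L) fun k => ?_).mono subset_rfl subset_rfl
      (by simp [ZMod.card])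
    refine computes_dft (F := fun l (u : Data d L) => (u.1 k l : ℂ)) ?_
    rintro _ ⟨l, rfl⟩
    exact ⟨Sum.inl (k, l), rfl⟩
  have h4 := (h1.comp (h2.union h3)).comp (Computes.biUnion (Finset.Ioo (-(κ : ℤ)) κ)
    fun a _ => computes_band a (fun j => Or.inl ⟨j, rfl⟩)
      fun k b => Or.inr (Set.mem_iUnion.2 ⟨k, b, rfl⟩))
  refine h4.mono subset_rfl ?_ ?_
  · rintro _ ⟨a, ha, j, rfl⟩
    simp only [Set.mem_iUnion]
    exact ⟨a, ha, j, rfl⟩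
  · have h5 := Nat.mul_le_mul_right (3 * dftCost d + 9 * d) (card_Ioo_le κ)
    linarith

lemma computes_lifted (hκ : 2 * κ ≤ d) :
    Computes encode (bandFns d L κ) (entryFns κ fun u => lifted κ u.2 u.1)
      (2 * κ * (d * 4)) := by
  refine computes_entryFns hκ fun j k hb => ?_
  simp only [lifted_eq _ _ hb]
  have h1 : (fun u : Data d L => band u.2 u.1 (offset j k) j) ∈ bandFns d L κ :=
    ⟨_, offset_mem hb, j, rfl⟩
  have h2 : (fun u : Data d L => band u.2 u.1 (offset k j) k) ∈ bandFns d L κ :=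
    ⟨_, offset_mem (inBand_comm.1 hb), k, rfl⟩
  exact (Computes.const _).mul ((Computes.of_mem h1).add (Computes.of_mem h2).conj)

/-- The number of operations of the whole algorithm with `t` steps of the power iteration. -/
lemma computes_approxOutput (hκ : 2 ≤ κ) (hκd : 2 * κ ≤ d) (t : ℕ) :
    Computes encode ∅ (Set.range fun j (u : Data d L) => approxOutput κ t u j)
      (2 * dftCost d + d * dftCost L + 2 * κ * (3 * dftCost d + 17 * d) + d * L + 10 * d + 1 +
        t * (d * (4 * κ + 4))) := by
  have h1 := (computes_bandFns d L κ).comp (computes_lifted hκd)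
  have h2 := (computes_bandPhase hκd fun u : Data d L => lifted κ u.2 u.1).comp
    (computes_powerIterate hκ hκd (fun u j k hb => by simp [bandPhase, hb]) t)
  have h3 := (h1.comp ((Computes.of_subset subset_rfl).union h2)).comp
    (R := Set.range fun j (u : Data d L) => (Real.sqrt (lifted κ u.2 u.1 j j).re : ℂ) *
      (powerIterate κ (bandPhase κ (lifted κ u.2 u.1)) t j /
        (‖powerIterate κ (bandPhase κ (lifted κ u.2 u.1)) t j‖ : ℂ))) (b := d * 6) (by
      refine (Computes.family (c := 6) fun j => ?_).mono subset_rfl subset_rfl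
        (by simp [ZMod.card])
      exact (Computes.of_mem
        (Or.inl ⟨j, j, inBand_self (by omega) j, rfl⟩)).sqrt.mul
          (Computes.phase (Or.inr ⟨j, rfl⟩)))
  refine (h3.comp (computes_dft_symm (e := encode) subset_rfl)).mono subset_rfl subset_rfl ?_
  linarith

/-- The recovery program: Fourier transforms, deconvolution of the bands, and a fixed number of
steps of the power iteration. -/
lemma exists_recoveryProgram {ρ : ℕ} (hρ : 2 * ρ < d) (hκ : 2 ≤ κ) (hκρ : κ ≤ ρ)
    (hL : L = ρ + κ - 1) (t : ℕ) :
    ∃ P : RecoveryProgram d L,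
      (P.flops : ℝ) ≤ 2000 * (1 + t) * (d * (ρ + (κ : ℝ) ^ 2) * Real.log d) ∧
      ∀ (m : ZMod d → ℂ) (Y : Matrix (ZMod d) (ZMod L) ℝ),
        P.recover m Y = approxOutput κ t (Y, m) := by
  have hκd : 2 * κ ≤ d := by omega
  obtain ⟨P, hP, hrun⟩ := (computes_approxOutput (L := L) hκ hκd t).exists_program
  refine ⟨P, ?_, fun m Y => hrun (Y, m)⟩
  have h1 : (P.flops : ℝ) ≤ ((1000 * (1 + t) * (d * (ρ + κ ^ 2) * Nat.log 2 d) : ℕ) : ℝ) :=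
    Nat.cast_le.2 (hP.trans (flops_le hρ hκ hκρ hL))
  refine h1.trans ?_
  have h2 : (Nat.log 2 d : ℝ) ≤ 2 * Real.log d := by
    have h3 : (2 : ℝ) ^ Nat.log 2 d ≤ d := by
      exact_mod_cast Nat.pow_log_le_self 2 (NeZero.ne d)
    have h4 := Real.log_le_log (by positivity) h3
    rw [Real.log_pow] at h4
    have h5 := Real.log_two_gt_d9
    have h6 : (0 : ℝ) ≤ Nat.log 2 d := by positivity
    nlinarith
  push_cast
  calc 1000 * (1 + (t : ℝ)) * (d * (ρ + (κ : ℝ) ^ 2) * Nat.log 2 d) ≤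
      1000 * (1 + (t : ℝ)) * (d * (ρ + (κ : ℝ) ^ 2) * (2 * Real.log d)) := by gcongr
    _ = _ := by ring

end Algorithm

/-! ### The error estimate -/

section Recovery

variable {d L κ : ℕ}

lemma isPhaseMatrix_normalizeBand {M : Matrix (ZMod d) (ZMod d) ℂ}
    (hM : ∀ j k, (starRingEnd ℂ) (M k j) = M j k) : IsPhaseMatrix κ (normalizeBand κ M) := by
  refine ⟨?_, fun j k hb => ?_, fun j k hb => ?_⟩
  · ext j k
    rw [conjTranspose_apply, RCLike.star_def]
    have h : (offset k j).natAbs < κ ↔ (offset j k).natAbs < κ := inBand_comm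
    simp only [normalizeBand, h]
    split_ifs
    · rw [← sgn_conj, hM]
    · exact map_zero _
  · rw [InBand] at hb
    simp only [normalizeBand, hb, if_true, norm_sgn]
  · rw [InBand] at hb
    simp only [normalizeBand, hb, if_false]

variable [NeZero d]

lemma minAbs_le (y : ZMod d → ℂ) (n : ZMod d) : minAbs y ≤ ‖y n‖ :=
  ciInf_le (Set.finite_range _).bddBelow n

lemma le_maxAbs (y : ZMod d → ℂ) (n : ZMod d) : ‖y n‖ ≤ maxAbs y :=
  le_ciSup (f := fun n => ‖y n‖) (Set.finite_range _).bddAbove n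

/-- Normalising the entries of a matrix that is close to the rank-one matrix `y y*` gives a good
approximation of the relative phases of `y`. -/
lemma phaseError_normalizeBand_le (M : Matrix (ZMod d) (ZMod d) ℂ) {y : ZMod d → ℂ}
    (hy : 0 < minAbs y) :
    minAbs y ^ 4 * phaseError κ (normalizeBand κ M) (fun j => sgn (y j)) ≤
      4 * bandSum κ fun j k => ‖M j k - y j * (starRingEnd ℂ) (y k)‖ ^ 2 := by
  rw [phaseError, ← bandSum_const_mul, ← bandSum_const_mul]
  refine bandSum_mono fun j k hb => ?_
  rw [InBand] at hb
  have hj := minAbs_le y j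
  have hk := minAbs_le y k
  have hj0 : y j ≠ 0 := norm_pos_iff.1 (hy.trans_le hj)
  have hk0 : y k ≠ 0 := norm_pos_iff.1 (hy.trans_le hk)
  have h1 : sgn (y j * (starRingEnd ℂ) (y k)) = sgn (y j) * (starRingEnd ℂ) (sgn (y k)) := by
    rw [sgn_mul _ _ hj0 (by simpa using hk0), sgn_conj]
  have h2 := norm_sgn_sub_sgn_le (M j k) (y j * (starRingEnd ℂ) (y k))
  rw [h1, norm_mul, RCLike.norm_conj] at h2
  have h3 : minAbs y ^ 2 ≤ ‖y j‖ * ‖y k‖ := by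
    rw [pow_two]
    gcongr
  simp only [normalizeBand, hb, if_true]
  set X := ‖sgn (M j k) - sgn (y j) * (starRingEnd ℂ) (sgn (y k))‖
  have h4 : X * minAbs y ^ 2 ≤ 2 * ‖M j k - y j * (starRingEnd ℂ) (y k)‖ :=
    le_trans (by gcongr) h2
  have h5 := pow_le_pow_left₀ (by positivity) h4 2
  calc minAbs y ^ 4 * X ^ 2 = (X * minAbs y ^ 2) ^ 2 := by ring
    _ ≤ _ := h5
    _ = _ := by ring

lemma sq_sub_sqrt_le {a g : ℝ} (ha : 0 ≤ a) : (a - Real.sqrt g) ^ 2 ≤ |g - a ^ 2| := by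
  rcases le_total 0 g with hg | hg
  · have hs := Real.sqrt_nonneg g
    have hs2 := Real.sq_sqrt hg
    have h1 : g - a ^ 2 = (Real.sqrt g - a) * (Real.sqrt g + a) := by
      linear_combination -hs2
    have h2 : |Real.sqrt g - a| ≤ Real.sqrt g + a := by
      rw [abs_le]
      constructor <;> linarith
    rw [h1, abs_mul, abs_of_nonneg (add_nonneg hs ha), ← sq_abs, abs_sub_comm, pow_two]
    gcongr
  · rw [Real.sqrt_eq_zero_of_nonpos hg, sub_zero]
    have := neg_abs_le (g - a ^ 2)
    linarith

lemma abs_re_sub_le (g y : ℂ) : |g.re - ‖y‖ ^ 2| ≤ ‖g - y * (starRingEnd ℂ) y‖ := by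
  have h : (g - y * (starRingEnd ℂ) y).re = g.re - ‖y‖ ^ 2 := by
    rw [Complex.sub_re, Complex.mul_conj']
    norm_cast
  rw [← h]
  exact Complex.abs_re_le_norm _

/-- The error of the magnitudes that are read off from the main diagonal. -/
lemma sum_sq_norm_sub_sqrt_le (hκ : 0 < κ) (M : Matrix (ZMod d) (ZMod d) ℂ) (y : ZMod d → ℂ)
    {E : ℝ} (hE0 : 0 ≤ E)
    (hE : bandSum κ (fun j k => ‖M j k - y j * (starRingEnd ℂ) (y k)‖ ^ 2) ≤ E ^ 2) :
    ∑ j, (‖y j‖ - Real.sqrt (M j j).re) ^ 2 ≤ Real.sqrt d * E := by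
  have h1 : ∑ j, (‖y j‖ - Real.sqrt (M j j).re) ^ 2 ≤
      ∑ j, ‖M j j - y j * (starRingEnd ℂ) (y j)‖ :=
    Finset.sum_le_sum fun j _ => (sq_sub_sqrt_le (norm_nonneg _)).trans (abs_re_sub_le _ _)
  refine h1.trans (le_of_sq_le_sq ?_ (by positivity))
  refine sq_sum_le_card_mul_sum_sq.trans ?_
  rw [mul_pow, Real.sq_sqrt (Nat.cast_nonneg d), Finset.card_univ, ZMod.card]
  gcongr
  exact (sum_diag_le_bandSum hκ (f := fun j k => ‖M j k - y j * (starRingEnd ℂ) (y k)‖ ^ 2)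
    fun _ _ => by positivity).trans hE

/-- The error of a signal that is synthesized from approximate phases and magnitudes. -/
lemma l2norm_sub_synthesis_le (x : ZMod d → ℂ) {s : ZMod d → ℂ} (hs : ∀ j, ‖s j‖ = 1)
    (g : ZMod d → ℝ) {c : ℂ} (hc : ‖c‖ = 1) {B H : ℝ} (hB0 : 0 ≤ B) (hH0 : 0 ≤ H)
    (hB : ∑ j, ‖s j - c * sgn (ZMod.dft x j)‖ ^ 2 ≤ B ^ 2)
    (hH : ∑ j, (‖ZMod.dft x j‖ - g j) ^ 2 ≤ H ^ 2) :
    l2norm (x - (starRingEnd ℂ) c • ZMod.dft.symm fun j => (g j : ℂ) * s j) ≤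
      (Real.sqrt d)⁻¹ * (maxAbs (ZMod.dft x) * B + H) := by
  set y := ZMod.dft x with hy
  have hcc : (starRingEnd ℂ) c * c = 1 := by rw [Complex.conj_mul', hc]; norm_num
  have h1 : x - (starRingEnd ℂ) c • ZMod.dft.symm (fun j => (g j : ℂ) * s j) =
      ZMod.dft.symm ((fun j => (‖y j‖ : ℂ) * (-(starRingEnd ℂ) c * (s j - c * sgn (y j)))) +
        fun j => (starRingEnd ℂ) c * s j * ((‖y j‖ - g j : ℝ) : ℂ)) := by
    rw [← map_smul, ← LinearEquiv.symm_apply_apply ZMod.dft x, ← map_sub, ← hy]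
    congr 1
    funext j
    simp only [Pi.sub_apply, Pi.add_apply, Pi.smul_apply, smul_eq_mul]
    push_cast
    linear_combination (-(‖y j‖ : ℂ) * sgn (y j)) * hcc - norm_mul_sgn (y j)
  have hmax : 0 ≤ maxAbs y := (norm_nonneg _).trans (le_maxAbs y 0)
  rw [h1, l2norm_dft_symm]
  gcongr
  refine (l2norm_add_le _ _).trans (add_le_add ?_ ?_)
  · refine l2norm_le_of_sq_le (by positivity) ?_
    rw [mul_pow]
    refine le_trans ?_ (mul_le_mul_of_nonneg_left hB (by positivity))
    rw [Finset.mul_sum]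
    refine Finset.sum_le_sum fun j _ => ?_
    rw [norm_mul, norm_mul, norm_neg, RCLike.norm_conj, hc, one_mul, Complex.norm_real, norm_norm,
      mul_pow]
    gcongr
    exact le_maxAbs y j
  · refine l2norm_le_of_sq_le hH0 (le_trans (le_of_eq ?_) hH)
    refine Finset.sum_congr rfl fun j _ => ?_
    rw [norm_mul, norm_mul, RCLike.norm_conj, hc, hs, one_mul, one_mul, Complex.norm_real,
      Real.norm_eq_abs, sq_abs]

lemma exists_angle {c : ℂ} (hc : ‖c‖ = 1) :
    ∃ φ ∈ Set.Icc (0 : ℝ) (2 * Real.pi), Complex.exp (Complex.I * φ) = c := by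
  have h1 : Complex.exp (Complex.I * c.arg) = c := by
    have h := Complex.norm_mul_exp_arg_mul_I c
    rwa [hc, Complex.ofReal_one, one_mul, mul_comm] at h
  have h2 := Complex.neg_pi_lt_arg c
  have h3 := Complex.arg_le_pi c
  have hpi := Real.pi_pos
  rcases le_or_gt 0 c.arg with h | h
  · exact ⟨c.arg, ⟨h, by linarith⟩, h1⟩
  · refine ⟨c.arg + 2 * Real.pi, ⟨by linarith, by linarith⟩, ?_⟩
    rw [Complex.ofReal_add, mul_add, Complex.ofReal_mul, Complex.ofReal_ofNat, show Complex.I * (2 * (Real.pi : ℂ)) = 2 * Real.pi * Complex.I by ring,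
      Complex.exp_add, Complex.exp_two_pi_mul_I, mul_one, h1]

variable [NeZero L]

/-- The bound on the Frobenius error of the lifted matrix. -/
def liftedError (κ : ℕ) (m : ZMod d → ℂ) (N : Matrix (ZMod d) (ZMod L) ℝ) : ℝ :=
  (d : ℝ) ^ 2 / (Real.sqrt L * maskConst κ m) * frobNorm N

lemma liftedError_nonneg {m : ZMod d → ℂ} (hμ : 0 < maskConst κ m)
    (N : Matrix (ZMod d) (ZMod L) ℝ) : 0 ≤ liftedError κ m N :=
  mul_nonneg (by positivity) (Real.sqrt_nonneg _)

lemma liftedError_sq (m : ZMod d → ℂ) (N : Matrix (ZMod d) (ZMod L) ℝ) :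
    liftedError κ m N ^ 2 = (d : ℝ) ^ 4 / (L * maskConst κ m ^ 2) * frobNorm N ^ 2 := by
  rw [liftedError, mul_pow, div_pow, mul_pow, Real.sq_sqrt (Nat.cast_nonneg L)]
  ring

lemma errorBound_eq (κ : ℕ) (m x : ZMod d → ℂ) (N : Matrix (ZMod d) (ZMod L) ℝ) :
    errorBound 144 1 κ m x N =
      144 * ((d : ℝ) ^ 3 * Real.sqrt d * maxAbs (ZMod.dft x) * frobNorm N /
        (Real.sqrt L * maskConst κ m * ((κ : ℝ) ^ 2 * Real.sqrt κ) * minAbs (ZMod.dft x) ^ 2)) +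
      d * Real.sqrt d / Real.sqrt (Real.sqrt L) * Real.sqrt (frobNorm N / maskConst κ m) := by
  have h0 : ∀ n : ℕ, (n : ℝ) ^ (1 / 2 : ℝ) = Real.sqrt n := fun n => (Real.sqrt_eq_rpow _).symm
  have h1 : (d : ℝ) ^ (7 / 2 : ℝ) = (d : ℝ) ^ 3 * Real.sqrt d := by
    rw [← h0, show (7 / 2 : ℝ) = (3 : ℕ) + 1 / 2 by norm_num,
      Real.rpow_add_of_nonneg (Nat.cast_nonneg d) (by norm_num) (by norm_num), Real.rpow_natCast]
  have h2 : (κ : ℝ) ^ (5 / 2 : ℝ) = (κ : ℝ) ^ 2 * Real.sqrt κ := by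
    rw [← h0, show (5 / 2 : ℝ) = (2 : ℕ) + 1 / 2 by norm_num,
      Real.rpow_add_of_nonneg (Nat.cast_nonneg κ) (by norm_num) (by norm_num), Real.rpow_natCast]
  have h3 : (d : ℝ) ^ (3 / 2 : ℝ) = d * Real.sqrt d := by
    rw [← h0, show (3 / 2 : ℝ) = (1 : ℕ) + 1 / 2 by norm_num,
      Real.rpow_add_of_nonneg (Nat.cast_nonneg d) (by norm_num) (by norm_num), Real.rpow_natCast,
      pow_one]
  have h4 : (L : ℝ) ^ (1 / 4 : ℝ) = Real.sqrt (Real.sqrt L) := by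
    rw [Real.sqrt_eq_rpow, Real.sqrt_eq_rpow, ← Real.rpow_mul (Nat.cast_nonneg L)]
    norm_num
  rw [errorBound, h0, h1, h2, h3, h4, one_mul]

lemma l2norm_sub_synthesize_le {ρ : ℕ} (hLe : L = ρ + κ - 1) (hL : L ∣ d) (hκ : 2 ≤ κ)
    (hκρ : κ ≤ ρ) (hρ : 2 * ρ < d) {m x : ZMod d → ℂ} (hm : SupportedIn (ZMod.dft m) ρ)
    (hx : 0 < minAbs (ZMod.dft x)) (hμ : 0 < maskConst κ m) (N : Matrix (ZMod d) (ZMod L) ℝ)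
    {v : ZMod d → ℂ}
    (hv : IsLeadingEigenvector (normalizeBand κ (lifted κ m (measurements m x N))) v) :
    ∃ φ ∈ Set.Icc (0 : ℝ) (2 * Real.pi),
      l2norm (x - Complex.exp (Complex.I * φ) • synthesize κ m (measurements m x N) v) ≤
        errorBound 144 1 κ m x N := by
  set Y := measurements m x N with hY
  set M := lifted κ m Y with hM
  set y := ZMod.dft x with hy
  set μ := maskConst κ m with hμdef
  set E := liftedError κ m N with hE
  have hd : (1 : ℝ) ≤ d := by exact_mod_cast Nat.pos_of_ne_zero (NeZero.ne d)
  have hL0 : (0 : ℝ) < L := Nat.cast_pos.2 (Nat.pos_of_ne_zero (NeZero.ne L))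
  have hκ0 : (0 : ℝ) < κ := by positivity
  have hN0 : 0 ≤ frobNorm N := Real.sqrt_nonneg _
  have hE0 : 0 ≤ E := liftedError_nonneg hμ N
  have hmax : 0 ≤ maxAbs y := (norm_nonneg _).trans (le_maxAbs y 0)
  have hF : bandSum κ (fun j k => ‖M j k - y j * (starRingEnd ℂ) (y k)‖ ^ 2) ≤ E ^ 2 := by
    rw [hE, liftedError_sq]
    exact bandSum_lifted_sub_le hLe hL hκρ hρ hm hμ x N
  obtain ⟨c, hc, hsync⟩ :=
    (isPhaseMatrix_normalizeBand (κ := κ) (lifted_conjTranspose m Y)).exists_phase_sgn hκ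
      (by omega) (u := fun j => sgn (y j)) (fun j => norm_sgn _) hv
  have hpe := phaseError_normalizeBand_le (κ := κ) M hx
  set pe := phaseError κ (normalizeBand κ M) fun j => sgn (y j)
  set B := 144 * d ^ 2 / ((κ : ℝ) ^ 2 * Real.sqrt κ * minAbs y ^ 2) * E with hB
  have hBS : ∑ j, ‖sgn (v j) - c * sgn (y j)‖ ^ 2 ≤ B ^ 2 := by
    have h1 : B ^ 2 = 20736 * d ^ 4 * E ^ 2 / (κ ^ 5 * minAbs y ^ 4) := by
      rw [hB, mul_pow, div_pow, mul_pow, mul_pow, mul_pow, Real.sq_sqrt hκ0.le]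
      field_simp
      ring
    rw [h1, le_div_iff₀ (by positivity)]
    calc (∑ j, ‖sgn (v j) - c * sgn (y j)‖ ^ 2) * (κ ^ 5 * minAbs y ^ 4) =
        minAbs y ^ 4 * (κ ^ 5 * ∑ j, ‖sgn (v j) - c * sgn (y j)‖ ^ 2) := by ring
      _ ≤ minAbs y ^ 4 * (5184 * d ^ 4 * pe) := by gcongr
      _ = 5184 * d ^ 4 * (minAbs y ^ 4 * pe) := by ring
      _ ≤ 5184 * d ^ 4 * (4 * E ^ 2) :=
        mul_le_mul_of_nonneg_left (hpe.trans (by gcongr)) (by positivity)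
      _ = _ := by ring
  have hH := sum_sq_norm_sub_sqrt_le (by omega : 0 < κ) M y hE0 hF
  have hH0 : 0 ≤ Real.sqrt d * E := by positivity
  rw [← Real.sq_sqrt hH0] at hH
  have hfinal := l2norm_sub_synthesis_le x (s := fun j => sgn (v j)) (fun j => norm_sgn _)
    (fun j => Real.sqrt (M j j).re) hc (B := B) (by positivity) (Real.sqrt_nonneg _) hBS hH
  obtain ⟨φ, hφ, hφc⟩ := exists_angle (c := (starRingEnd ℂ) c) (by rw [RCLike.norm_conj, hc])
  refine ⟨φ, hφ, ?_⟩
  rw [hφc]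
  refine hfinal.trans ?_
  rw [errorBound_eq, ← hy, ← hμdef, mul_add]
  have hsd : 0 < Real.sqrt d := Real.sqrt_pos.2 (by linarith)
  have hsd2 : Real.sqrt d ^ 2 = d := Real.sq_sqrt (by linarith)
  have hsL : 0 < Real.sqrt L := Real.sqrt_pos.2 hL0
  have hE' : E = (d : ℝ) ^ 2 / (Real.sqrt L * μ) * frobNorm N := rfl
  refine add_le_add (le_of_eq ?_) ?_
  · rw [hB, hE']
    have hsκ : 0 < Real.sqrt κ := Real.sqrt_pos.2 hκ0
    field_simp
    rw [hsd2]
    ring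
  · have h1 : Real.sqrt (Real.sqrt d * E) =
        Real.sqrt (Real.sqrt d) * d / Real.sqrt (Real.sqrt L) * Real.sqrt (frobNorm N / μ) := by
      have h2 : Real.sqrt d * E = Real.sqrt d * d ^ 2 / Real.sqrt L * (frobNorm N / μ) := by
        rw [hE']
        field_simp
      rw [h2, Real.sqrt_mul (by positivity), Real.sqrt_div (by positivity),
        Real.sqrt_mul (by positivity), Real.sqrt_sq (by linarith)]
    have h3 : (Real.sqrt d)⁻¹ * Real.sqrt (Real.sqrt d) ≤ Real.sqrt d := by
      have h4 : 1 ≤ Real.sqrt d := Real.one_le_sqrt.2 hd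
      have h5 : Real.sqrt (Real.sqrt d) ≤ Real.sqrt d :=
        Real.sqrt_le_sqrt ((Real.sqrt_le_left (by linarith)).2 (by nlinarith))
      rw [inv_mul_le_iff₀ hsd]
      nlinarith
    rw [h1]
    calc (Real.sqrt d)⁻¹ * (Real.sqrt (Real.sqrt d) * d / Real.sqrt (Real.sqrt L) *
          Real.sqrt (frobNorm N / μ)) =
        d * ((Real.sqrt d)⁻¹ * Real.sqrt (Real.sqrt d)) / Real.sqrt (Real.sqrt L) *
          Real.sqrt (frobNorm N / μ) := by ring
      _ ≤ _ := by gcongr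

/-! ### Accuracy of the program -/

/-- For small noise, the program with `t` steps of the power iteration returns an approximation
of an output of the algorithm, with an error that is proportional to `1 / t`. -/
lemma exists_noise_level {ρ : ℕ} (hLe : L = ρ + κ - 1) (hL : L ∣ d) (hκ : 2 ≤ κ)
    (hκρ : κ ≤ ρ) (hρ : 2 * ρ < d) {m x : ZMod d → ℂ} (hm : SupportedIn (ZMod.dft m) ρ)
    (hx : 0 < minAbs (ZMod.dft x)) (hμ : 0 < maskConst κ m) :
    ∃ η : ℝ, 0 < η ∧ ∀ N : Matrix (ZMod d) (ZMod L) ℝ, frobNorm N ≤ η → ∀ t : ℕ, 0 < t →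
      ∃ v, IsLeadingEigenvector (normalizeBand κ (lifted κ m (measurements m x N))) v ∧
        l2norm (approxOutput κ t (measurements m x N, m) -
          synthesize κ m (measurements m x N) v) ≤ l2norm x / t := by
  set y := ZMod.dft x with hy
  have hd : (1 : ℝ) ≤ d := by exact_mod_cast Nat.pos_of_ne_zero (NeZero.ne d)
  have hL0 : (0 : ℝ) < L := Nat.cast_pos.2 (Nat.pos_of_ne_zero (NeZero.ne L))
  have hmax : 0 ≤ maxAbs y := (norm_nonneg _).trans (le_maxAbs y 0)
  have hxpos : 0 < l2norm x := by
    have h1 : x ≠ 0 := by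
      rintro rfl
      have h2 := minAbs_le y 0
      rw [hy, map_zero, Pi.zero_apply, norm_zero, ← map_zero ZMod.dft, ← hy] at h2
      linarith
    obtain ⟨j, hj⟩ := Function.ne_iff.1 h1
    exact (norm_pos_iff.2 hj).trans_le (norm_apply_le_l2norm x j)
  set K := (d : ℝ) ^ 2 / (Real.sqrt L * maskConst κ m) with hK
  have hK0 : 0 < K := by positivity
  -- a bound on the error of the lifted matrix below which all estimates apply
  obtain ⟨θ, hθ0, hθ1, hθ2, hθ3, hθ4⟩ : ∃ θ : ℝ, 0 < θ ∧ θ < minAbs y ^ 2 ∧ θ ≤ 1 ∧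
      100 * d ^ 2 * (2 / minAbs y ^ 2 * θ) ≤ 1 ∧
      (maxAbs y + 1) * (236800 * d ^ 7 * (2 / minAbs y ^ 2 * θ)) ≤ l2norm x := by
    have hsmall : ∀ C b : ℝ, 0 < b → ∀ᶠ θ in nhdsWithin (0 : ℝ) (Set.Ioi 0), C * θ < b := by
      intro C b hb
      have h1 : Filter.Tendsto (fun θ : ℝ => C * θ) (nhds 0) (nhds (C * 0)) :=
        (continuous_const.mul continuous_id).tendsto 0
      rw [mul_zero] at h1
      exact (h1.mono_left nhdsWithin_le_nhds).eventually_lt_const hb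
    obtain ⟨θ, ⟨⟨⟨h1, h2⟩, h3⟩, h4⟩, h5⟩ := ((((hsmall 1 (minAbs y ^ 2) (by positivity)).and
      (hsmall 1 1 one_pos)).and (hsmall (100 * d ^ 2 * (2 / minAbs y ^ 2)) 1 one_pos)).and
      (hsmall ((maxAbs y + 1) * (236800 * d ^ 7 * (2 / minAbs y ^ 2))) (l2norm x) hxpos)).and
      self_mem_nhdsWithin |>.exists
    exact ⟨θ, h5, by linarith, by linarith, by linarith, by linarith⟩
  refine ⟨θ / K, by positivity, fun N hN t ht => ?_⟩
  have ht0 : (0 : ℝ) < t := Nat.cast_pos.2 ht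
  set Y := measurements m x N with hY
  set M := lifted κ m Y with hM
  have hF : bandSum κ (fun j k => ‖M j k - y j * (starRingEnd ℂ) (y k)‖ ^ 2) ≤ θ ^ 2 := by
    have h1 : liftedError κ m N ≤ θ := by
      rw [le_div_iff₀ hK0] at hN
      rw [liftedError, ← hK, mul_comm]
      exact hN
    refine (bandSum_lifted_sub_le hLe hL hκρ hρ hm hμ x N).trans ?_
    rw [← liftedError_sq]
    exact pow_le_pow_left₀ (liftedError_nonneg hμ N) h1 2
  have hentry : ∀ j k, InBand κ j k → ‖M j k - y j * (starRingEnd ℂ) (y k)‖ ≤ θ := fun j k hb =>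
    le_of_sq_le_sq ((le_bandSum (f := fun j k => ‖M j k - y j * (starRingEnd ℂ) (y k)‖ ^ 2)
      (fun _ _ => by positivity) hb).trans hF) hθ0.le
  have hphase : bandPhase κ M = normalizeBand κ M := by
    funext j k
    simp only [bandPhase, normalizeBand]
    by_cases hb : InBand κ j k
    · have h1 : M j k ≠ 0 := by
        intro h0
        have h2 := hentry j k hb
        rw [h0, zero_sub, norm_neg, norm_mul, RCLike.norm_conj] at h2
        have h3 : minAbs y ^ 2 ≤ ‖y j‖ * ‖y k‖ := by
          rw [pow_two]
          gcongr
          exacts [minAbs_le y j, minAbs_le y k]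
        linarith
      have hb' := hb
      rw [InBand] at hb'
      rw [if_pos hb, if_pos hb', sgn, if_neg h1]
    · have hb' := hb
      rw [InBand] at hb'
      rw [if_neg hb, if_neg hb']
  have hpe : phaseError κ (normalizeBand κ M) (fun j => sgn (y j)) ≤
      (2 / minAbs y ^ 2 * θ) ^ 2 := by
    have h1 := phaseError_normalizeBand_le (κ := κ) M hx
    have h2 : (2 / minAbs y ^ 2 * θ) ^ 2 = 4 * θ ^ 2 / minAbs y ^ 4 := by
      field_simp
      norm_num
    rw [h2, le_div_iff₀ (by positivity)]
    linarith
  obtain ⟨v, hv, hvt⟩ := (isPhaseMatrix_normalizeBand (κ := κ)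
    (lifted_conjTranspose m Y)).exists_l2norm_powerIterate_le hκ (by omega)
    (u := fun j => sgn (y j)) (fun j => norm_sgn _) (by positivity) hpe hθ3 ht
  refine ⟨v, hv, ?_⟩
  set z := powerIterate κ (normalizeBand κ M) t with hz
  have h1 : approxOutput κ t (Y, m) - synthesize κ m Y v = ZMod.dft.symm fun j =>
      (Real.sqrt (M j j).re : ℂ) * (z j / (‖z j‖ : ℂ) - sgn (v j)) := by
    simp only [approxOutput, synthesize]
    rw [← map_sub, ← hM, hphase]
    congr 1
    funext j
    rw [Pi.sub_apply, mul_sub]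
  have hdiag : ∀ j, Real.sqrt (M j j).re ≤ maxAbs y + 1 := by
    intro j
    rw [Real.sqrt_le_left (by positivity)]
    have h2 := (abs_le.1 ((abs_re_sub_le (M j j) (y j)).trans
      (hentry j j (inBand_self (by omega) j)))).2
    have h3 : ‖y j‖ ^ 2 ≤ maxAbs y ^ 2 := pow_le_pow_left₀ (norm_nonneg _) (le_maxAbs y j) 2
    nlinarith
  have h2 : l2norm (fun j => (Real.sqrt (M j j).re : ℂ) * (z j / (‖z j‖ : ℂ) - sgn (v j))) ≤
      (maxAbs y + 1) * l2norm fun j => z j / (‖z j‖ : ℂ) - sgn (v j) := by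
    refine l2norm_le_of_sq_le (mul_nonneg (by positivity) (l2norm_nonneg _)) ?_
    rw [mul_pow, l2norm_sq, Finset.mul_sum]
    refine Finset.sum_le_sum fun j _ => ?_
    rw [norm_mul, mul_pow, Complex.norm_real, Real.norm_of_nonneg (Real.sqrt_nonneg _)]
    gcongr
    exact hdiag j
  have h3 : (Real.sqrt d)⁻¹ ≤ 1 := inv_le_one_of_one_le₀ (Real.one_le_sqrt.2 hd)
  rw [h1, l2norm_dft_symm]
  calc _ ≤ 1 * ((maxAbs y + 1) * (236800 * d ^ 7 * (2 / minAbs y ^ 2 * θ) / t)) :=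
        mul_le_mul h3 (h2.trans (by gcongr)) (l2norm_nonneg _) zero_le_one
    _ = (maxAbs y + 1) * (236800 * d ^ 7 * (2 / minAbs y ^ 2 * θ)) / t := by ring
    _ ≤ _ := by gcongr

end Recovery

end

end Spectrogram

theorem theorem3 :
    ∃ C C' : ℝ, 0 < C ∧ 0 < C' ∧ ∃ A : ℝ → ℝ,
      ∀ (d L ρ κ : ℕ) [NeZero d] [NeZero L],
        2 * ρ < d → 2 ≤ κ → κ ≤ ρ → L = ρ + κ - 1 → L ∣ d →
        -- the error estimate, for every noise matrix
        (∀ m x : ZMod d → ℂ, Spectrogram.SupportedIn (ZMod.dft m) ρ →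
          0 < Spectrogram.minAbs (ZMod.dft x) → 0 < Spectrogram.maskConst κ m →
          ∀ N : Matrix (ZMod d) (ZMod L) ℝ,
            (∃ xe, Spectrogram.IsOutput ρ m (Spectrogram.measurements m x N) xe) ∧
            ∀ xe, Spectrogram.IsOutput ρ m (Spectrogram.measurements m x N) xe →
              ∃ φ ∈ Set.Icc (0 : ℝ) (2 * Real.pi),
                Spectrogram.l2norm (x - Complex.exp (Complex.I * φ) • xe) ≤
                  Spectrogram.errorBound C C' κ m x N) ∧
        -- the flop count for small noise, at relative precision `ε`
        ∃ P : ℝ → Spectrogram.RecoveryProgram d L,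
          (∀ ε ∈ Set.Ioo (0 : ℝ) 1,
            ((P ε).flops : ℝ) ≤ A ε * (d * (ρ + (κ : ℝ) ^ 2) * Real.log d)) ∧
          ∀ m x : ZMod d → ℂ, Spectrogram.SupportedIn (ZMod.dft m) ρ →
            0 < Spectrogram.minAbs (ZMod.dft x) → 0 < Spectrogram.maskConst κ m →
            ∃ η : ℝ, 0 < η ∧ ∀ N : Matrix (ZMod d) (ZMod L) ℝ, Spectrogram.frobNorm N ≤ η →
              ∀ ε ∈ Set.Ioo (0 : ℝ) 1,
                (∃ xe, Spectrogram.IsOutput ρ m (Spectrogram.measurements m x N) xe ∧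
                  Spectrogram.l2norm
                      (Spectrogram.RecoveryProgram.recover (P ε) m
                        (Spectrogram.measurements m x N) - xe) ≤
                    ε * Spectrogram.l2norm x) ∧
                ∃ φ ∈ Set.Icc (0 : ℝ) (2 * Real.pi),
                  Spectrogram.l2norm
                      (x - Complex.exp (Complex.I * φ) •
                        Spectrogram.RecoveryProgram.recover (P ε) m
                          (Spectrogram.measurements m x N)) ≤
                    Spectrogram.errorBound C C' κ m x N + ε * Spectrogram.l2norm x := by
  refine ⟨144, 1, by norm_num, one_pos, fun ε => 2000 * (1 + ⌈1 / ε⌉₊), ?_⟩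
  intro d L ρ κ _ _ hρ hκ hκρ hLe hL
  have hκe : L + 1 - ρ = κ := by omega
  simp only [Spectrogram.IsOutput, hκe]
  refine ⟨fun m x hm hx hμ N => ⟨?_, ?_⟩, ?_⟩
  · obtain ⟨v, hv⟩ := Spectrogram.exists_isLeadingEigenvector
      (Spectrogram.isPhaseMatrix_normalizeBand (κ := κ) (Spectrogram.lifted_conjTranspose m
        (Spectrogram.measurements (L := L) m x N))).isHermitian
    exact ⟨_, v, hv, rfl⟩
  · rintro _ ⟨v, hv, rfl⟩
    exact Spectrogram.l2norm_sub_synthesize_le hLe hL hκ hκρ hρ hm hx hμ N hv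
  · choose P hflops hrecover using fun t =>
      Spectrogram.exists_recoveryProgram (L := L) hρ hκ hκρ hLe t
    refine ⟨fun ε => P ⌈1 / ε⌉₊, fun ε _ => hflops _, fun m x hm hx hμ => ?_⟩
    obtain ⟨η, hη, happrox⟩ := Spectrogram.exists_noise_level hLe hL hκ hκρ hρ hm hx hμ
    refine ⟨η, hη, fun N hN ε hε => ?_⟩
    have hε0 : 0 < ε := hε.1
    have ht : 0 < ⌈1 / ε⌉₊ := Nat.ceil_pos.2 (by positivity)
    obtain ⟨v, hv, hvt⟩ := happrox N hN _ ht
    have hxε : Spectrogram.l2norm x / (⌈1 / ε⌉₊ : ℝ) ≤ ε * Spectrogram.l2norm x := by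
      rw [div_le_iff₀ (Nat.cast_pos.2 ht)]
      have h1 : 1 ≤ ε * (⌈1 / ε⌉₊ : ℝ) := by
        have h2 := Nat.le_ceil (1 / ε)
        rwa [div_le_iff₀' hε0] at h2
      have h3 := mul_le_mul_of_nonneg_right h1 (Spectrogram.l2norm_nonneg x)
      linarith
    rw [hrecover]
    refine ⟨⟨_, ⟨v, hv, rfl⟩, hvt.trans hxε⟩, ?_⟩
    obtain ⟨φ, hφ, hbound⟩ := Spectrogram.l2norm_sub_synthesize_le hLe hL hκ hκρ hρ hm hx hμ N hv
    refine ⟨φ, hφ, ?_⟩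
    set c := Complex.exp (Complex.I * φ)
    set x' := Spectrogram.approxOutput κ ⌈1 / ε⌉₊ (Spectrogram.measurements m x N, m)
    set xe := Spectrogram.synthesize κ m (Spectrogram.measurements m x N) v
    have hc : ‖c‖ = 1 := Complex.norm_exp_I_mul_ofReal φ
    have h1 : x - c • x' = (x - c • xe) + c • (xe - x') := by
      rw [smul_sub]
      abel
    rw [h1]
    refine (Spectrogram.l2norm_add_le _ _).trans (add_le_add hbound ?_)
    rw [Spectrogram.l2norm_smul, hc, one_mul, Spectrogram.l2norm_sub_comm]
    exact hvt.trans hxε
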